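/- **Theorem (Trimming).** Graphs are finite, undirected and unweighted; parallel edges and self-loops are allowed. For a graph $G=(V,E)$ with $m=|E|$, let $\deg(v)$ be the number of edges incident to $v$ (a self-loop contributes $1$), $\mathrm{vol}(S)=\sum_{v\in S}\deg(v)$, and let $E(S,T)$ be the set of edges with one end in $S$ and the other end in $T$. The conductance of $G$ is $$\Phi_G=\min_{S}\frac{|E(S,V\setminus S)|}{\min(\mathrm{vol}(S),\mathrm{vol}(V\setminus S))},$$ the minimum over all $S\subseteq V$ with $\mathrm{vol}(S),\mathrm{vol}(V\setminus S)>0$, and $\Phi_G=1$ if there is no such $S$ (for instance if $G$ is a singleton). For $S\subseteq V$, $G\{S\}$ is the subgraph induced by $S$ in which each edge of $E(S,V\setminus S)$ is kept as a self-loop at its end in $S$, so that degrees are the same as in $G$. A set $A\subseteq V$ is a *nearly $\phi$ expander* in $G$ if $|E(S,V\setminus S)|\ge\phi\,\mathrm{vol}(S)$ for all $S\subseteq A$ with $\mathrm{vol}(S)\le\mathrm{vol}(A)/2$. There are a deterministic word RAM program and constants $C,K$ such that the following holds. Let $G=(V,E)$ be a graph with $V=\{0,\dots,n-1\}$ and $E$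 numbered $0,\dots,m-1$, let $\phi=p/q\in(0,1]$ with positive integers $p\le q$, and let $A\subseteq V$ be a nearly $\phi$ expander in $G$ with $|E(A,V\setminus A)|\le\phi\,\mathrm{vol}(A)/10$. The program is started with the following in memory: $n,m,p,q$ and $|E(A,V\setminus A)|$; the adjacency lists of $G$ (for each vertex its incident edges with their other ends, in any order); the $0/1$ membership array of $A$; the list of the edges in $E(A,V\setminus A)$ with their ends in $A$, in any order; and zeros elsewhere. Words have $w$ bits, for any $w$ with $2^w\ge(n+m+p+q+2)^K$; arithmetic operations, comparisons and memory accesses on words take one step each. Then the program halts after at most $$C\cdot\max\left(1,\ \frac{|E(A,V\setminus A)|\,\log m}{\phi^2}\right)$$ steps, with the array of $A$ overwritten by the membership array of a set $A'\subseteq A$ such that $$\Phi_{G\{A'\}}\ge\frac{\phi}{6},\qquad \mathrm{vol}(A')\ge\mathrm{vol}(A)-\frac{4|E(A,V\setminus A)|}{\phi},\qquad |E(A',V\setminus A')|\le 2|E(A,V\setminus A)|.$$ -/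

import Mathlib

/-! ### Volumes, cuts and conductance in undirected multigraphs -/

namespace Graph

variable {α β : Type*}

/-- The degree of `v`: the number of edges incident to `v`. A self-loop contributes `1`. -/
noncomputable def deg (G : Graph α β) (v : α) : ℕ := {e | G.Inc e v}.ncard

/-- The volume of `S`: the sum of the degrees of its vertices. -/
noncomputable def vol (G : Graph α β) (S : Set α) : ℕ := ∑ᶠ v ∈ S, G.deg v

/-- `E(S, T)`: the edges with one end in `S` and the other end in `T`. -/
def edgesBetween (G : Graph α β) (S T : Set α) : Set β :=
  {e | ∃ u ∈ S, ∃ v ∈ T, G.IsLink e u v}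

/-- The cut-size `δ(S) = |E(S, V ∖ S)|`. -/
noncomputable def cutSize (G : Graph α β) (S : Set α) : ℕ :=
  (G.edgesBetween S (G.vertexSet \ S)).ncard

/-- The conductance of a cut, `δ(S) / min (vol S) (vol (V ∖ S))`. -/
noncomputable def cutConductance (G : Graph α β) (S : Set α) : ℝ :=
  (G.cutSize S : ℝ) / (min (G.vol S) (G.vol (G.vertexSet \ S)) : ℕ)

/-- The cuts whose conductance is a quotient with a nonzero denominator. -/
def properCuts (G : Graph α β) : Set (Set α) :=
  {S | S ⊆ G.vertexSet ∧ 0 < G.vol S ∧ 0 < G.vol (G.vertexSet \ S)}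

open Classical in
/-- The conductance of a graph: the smallest conductance of a cut. It is `1` by convention if there
is no cut with positive volume on both sides, for instance on a singleton. -/
noncomputable def conductance (G : Graph α β) : ℝ :=
  if G.properCuts.Nonempty then sInf (G.cutConductance '' G.properCuts) else 1

/-- The graph `G{S}`: the induced subgraph on `S`, in which every edge of `G` that leaves `S` is
kept as a self-loop at its end in `S`, so that all degrees are the same as in `G`. -/
def inducedWithLoops (G : Graph α β) (S : Set α) : Graph α β where
  vertexSet := G.vertexSet ∩ S
  IsLink e x y :=
    (x ∈ S ∧ y ∈ S ∧ G.IsLink e x y) ∨ (x = y ∧ x ∈ S ∧ ∃ z, z ∉ S ∧ G.IsLink e x z)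
  isLink_symm := by
    refine fun e _ => ⟨?_⟩
    rintro x y (⟨hx, hy, h⟩ | ⟨rfl, h⟩)
    · exact Or.inl ⟨hy, hx, h.symm⟩
    · exact Or.inr ⟨rfl, h⟩
  eq_or_eq_of_isLink_of_isLink := by
    rintro e x y v w (⟨hx, hy, h⟩ | ⟨rfl, hx, z, hz, h⟩) (⟨hv, hw, h'⟩ | ⟨rfl, hv, z', hz', h'⟩)
    · exact h.left_eq_or_eq h'
    · rcases h.left_eq_or_eq h' with rfl | rfl
      · exact Or.inl rfl
      · exact absurd hx hz'
    · exact h.left_eq_or_eq h'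
    · rcases h.left_eq_or_eq h' with rfl | rfl
      · exact Or.inl rfl
      · exact absurd hx hz'
  left_mem_of_isLink := by
    rintro e x y (⟨hx, hy, h⟩ | ⟨rfl, hx, z, hz, h⟩)
    · exact ⟨h.left_mem, hx⟩
    · exact ⟨h.left_mem, hx⟩

/-- `A` is a nearly `φ` expander in `G`. -/
def IsNearlyExpander (G : Graph α β) (φ : ℝ) (A : Set α) : Prop :=
  ∀ S ⊆ A, (G.vol S : ℝ) ≤ G.vol A / 2 → φ * G.vol S ≤ G.cutSize S

end Graph

/-! ### A word RAM with a step count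

A memory consists of word variables and word arrays; a program is a fixed finite text, so it uses
only finitely many of them. Words have `w` bits, and results are reduced modulo `2 ^ w`. Programs
are built from assignments, stores, branches and loops; every operation, memory access and test
costs one step. -/

namespace WordRAM

structure Store where
  var : ℕ → ℕ
  arr : ℕ → ℕ → ℕ

inductive Op where
  | add | sub | mul | div | mod | lt | eq

/-- Subtraction is truncated at `0`, division by `0` gives `0`, and comparisons return `1` or
`0`. -/
def Op.eval : Op → ℕ → ℕ → ℕ
  | .add, a, b => a + b
  | .sub, a, b => a - b
  | .mul, a, b => a * b
  | .div, a, b => a / b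
  | .mod, a, b => a % b
  | .lt, a, b => if a < b then 1 else 0
  | .eq, a, b => if a = b then 1 else 0

inductive Expr where
  | const (k : ℕ)
  | var (x : ℕ)
  | load (a : ℕ) (i : Expr)
  | op (o : Op) (l r : Expr)

namespace Expr

/-- The value of an expression on `w`-bit words; `load a i` reads array `a` at index `i`. -/
def eval (w : ℕ) (σ : Store) : Expr → ℕ
  | const k => k % 2 ^ w
  | var x => σ.var x
  | load a i => σ.arr a (i.eval w σ)
  | op o l r => o.eval (l.eval w σ) (r.eval w σ) % 2 ^ w

/-- The number of steps that the evaluation takes. -/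
def cost : Expr → ℕ
  | const _ => 1
  | var _ => 1
  | load _ i => i.cost + 1
  | op _ l r => l.cost + r.cost + 1

end Expr

inductive Program where
  | skip
  | assign (x : ℕ) (e : Expr)
  | store (a : ℕ) (i e : Expr)
  | seq (p q : Program)
  | ite (b : Expr) (p q : Program)
  | loop (b : Expr) (p : Program)

/-- `Exec w p σ t τ`: with `w`-bit words, `p` started in `σ` halts in `τ` after exactly `t`
steps. -/
inductive Exec (w : ℕ) : Program → Store → ℕ → Store → Prop where
  | skip (σ : Store) : Exec w .skip σ 1 σ
  | assign (σ : Store) (x : ℕ) (e : Expr) :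
      Exec w (.assign x e) σ (e.cost + 1)
        { σ with var := Function.update σ.var x (e.eval w σ) }
  | store (σ : Store) (a : ℕ) (i e : Expr) :
      Exec w (.store a i e) σ (i.cost + e.cost + 1)
        { σ with arr := Function.update σ.arr a
                    (Function.update (σ.arr a) (i.eval w σ) (e.eval w σ)) }
  | seq {σ₁ σ₂ σ₃ : Store} {p q : Program} {s t : ℕ} :
      Exec w p σ₁ s σ₂ → Exec w q σ₂ t σ₃ → Exec w (.seq p q) σ₁ (s + t) σ₃
  | ite_true {σ τ : Store} {b : Expr} {p q : Program} {t : ℕ} :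
      b.eval w σ ≠ 0 → Exec w p σ t τ → Exec w (.ite b p q) σ (b.cost + 1 + t) τ
  | ite_false {σ τ : Store} {b : Expr} {p q : Program} {t : ℕ} :
      b.eval w σ = 0 → Exec w q σ t τ → Exec w (.ite b p q) σ (b.cost + 1 + t) τ
  | loop_false {σ : Store} {b : Expr} {p : Program} :
      b.eval w σ = 0 → Exec w (.loop b p) σ (b.cost + 1) σ
  | loop_true {σ₁ σ₂ σ₃ : Store} {b : Expr} {p : Program} {s t : ℕ} :
      b.eval w σ₁ ≠ 0 → Exec w p σ₁ s σ₂ → Exec w (.loop b p) σ₂ t σ₃ →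
        Exec w (.loop b p) σ₁ (b.cost + 1 + s + t) σ₃

end WordRAM

/-! ### The input and output of the trimming problem -/

namespace Trimming

/-- `adj v` lists, in any order and without repetition, the edges incident to `v`, each one with its
other end (which is `v` itself for a self-loop). -/
def IsAdjacencyLists (G : Graph ℕ ℕ) (adj : ℕ → List (ℕ × ℕ)) : Prop :=
  ∀ v ∈ G.vertexSet, (adj v).Nodup ∧ ∀ e u, (e, u) ∈ adj v ↔ G.IsLink e v u

/-- `cut` lists, in any order and without repetition, the edges that leave `A`, each one with its end
in `A`. -/
def IsCutList (G : Graph ℕ ℕ) (A : Set ℕ) (cut : List (ℕ × ℕ)) : Prop :=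
  cut.Nodup ∧ ∀ e v, (e, v) ∈ cut ↔ v ∈ A ∧ ∃ u ∈ G.vertexSet \ A, G.IsLink e v u

open Classical in
/-- The `0`/`1` membership array of a set of vertices. -/
noncomputable def membership (A : Set ℕ) (v : ℕ) : ℕ := if v ∈ A then 1 else 0

/-- The position of the first entry of `adj v` in the concatenation `adj 0 ++ adj 1 ++ ⋯`. -/
def offset (adj : ℕ → List (ℕ × ℕ)) (v : ℕ) : ℕ := ∑ u ∈ Finset.range v, (adj u).length

/-- The concatenation `adj 0 ++ ⋯ ++ adj (n - 1)`. -/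
def entries (n : ℕ) (adj : ℕ → List (ℕ × ℕ)) : List (ℕ × ℕ) := (List.range n).flatMap adj

/-- The memory at the start. Variables `0` to `4`: the number `n` of vertices, the number `m` of
edges, the numerator `p` and the denominator `q` of `φ`, the number of edges that leave `A`. Arrays
`0` to `2`: the adjacency lists, as the offsets, the edges and the other ends. Array `3`: the
membership array of `A`. Arrays `4` and `5`: the edges that leave `A`, and their ends in `A`. The
rest of the memory is zero. -/
noncomputable def input (n m p q : ℕ) (adj : ℕ → List (ℕ × ℕ)) (A : Set ℕ)
    (cut : List (ℕ × ℕ)) : WordRAM.Store where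
  var
    | 0 => n
    | 1 => m
    | 2 => p
    | 3 => q
    | 4 => cut.length
    | _ => 0
  arr
    | 0 => fun v => if v ≤ n then offset adj v else 0
    | 1 => fun i => ((entries n adj).getD i (0, 0)).1
    | 2 => fun i => ((entries n adj).getD i (0, 0)).2
    | 3 => membership A
    | 4 => fun i => (cut.getD i (0, 0)).1
    | 5 => fun i => (cut.getD i (0, 0)).2
    | _ => fun _ => 0

/-- At the end, array `3` holds the membership array of the computed set `A'`. -/
def Outputs (n : ℕ) (τ : WordRAM.Store) (A' : Set ℕ) : Prop :=
  ∀ v < n, τ.arr 3 v = membership A' v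

end Trimming

/-! The set is trimmed by a unit-by-unit push-relabel flow. Let `N = |E(A, V ∖ A)|` and give every
edge the capacity `c = ⌊3/(2φ)⌋ + 1`, so that `3/2 ≤ cφ ≤ 5/2`. Every edge that leaves the current
set tries to send `c` units inwards, and a vertex `v` keeps at most `deg v` units. A unit walks down
levels of at most `h`. A full vertex that holds one unit too many is relabeled, and at level `h` it
starts a cut.

The cut is grown from that vertex along residual arcs into the current set, layer by layer. A
residual arc descends by at most one level, so depth `d` still has level at least `h - d`. Growth
stops once the number `z` of residual arcs leading onwards satisfies `z D ≤ vol`, where `D = 8c`.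
Otherwise their ends form a new layer of volume at least `z > vol / D`. The volume thus grows by a
factor `1 + 1/D` per layer, and `(1 + 1/D)^D ≥ 2` gives fewer than `D L` layers if the volume of `A`
is below `2^L`. With `h = D L + 2` all removed vertices have positive level, and positive level
means full: they hold at least their degree.

A finished cut adds its `z` arcs to the sources. Each can carry up to `2c` further units (from `-c`
to `c`), in total at most `vol / 4`. If `R` is the removed volume, at most `cN + R/4` units ever
enter, while the removed vertices hold at least `R`. Hence at most `4cN/3` units enter, `R ≤ 4cN/3 ≤
4N/φ`, and at most `cN` units are left inside the final set.

At the end every edge leaving `A'` carries `c` units into `A'`. Counting units gives `|E(A', V ∖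
A')| ≤ N`. Take `S ⊆ A'` of volume `V`, with `x` edges leaving `A'` and `y` edges to `A' ∖ S`. Then
`cx ≤ V + cy`, and near expansion gives `φV ≤ x + y`. So `cφV ≤ V + 2cy`, and `cφ ≥ 3/2` gives `y ≥
φV/6`. This part is `FlowInv.mass_bound` and `Inv.le_conductance`.

For the running time, `measure` grows in every iteration and is `O(cNh)`: only full vertices have a
nonzero level or pointer, so relabeling is charged to the units that entered. As `c = O(1/φ)` and `h
= O(c log m)`, this is `O(N log m / φ²)`. The link to the word RAM is that each iteration is a
program without loops, whose effect on bounded memory is computed over `ℕ`. -/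

/-! ### Word RAM programs: evaluation without overflow, and loops with a measure -/

namespace WordRAM

/-- The value of an expression over the natural numbers, without reduction modulo `2 ^ w`. -/
def Expr.evalNat (σ : Store) : Expr → ℕ
  | const k => k
  | var x => σ.var x
  | load a i => σ.arr a (i.evalNat σ)
  | op o l r => o.eval (l.evalNat σ) (r.evalNat σ)

/-- The result of a program without loops, computed over the natural numbers. -/
def Program.run : Program → Store → Store
  | .skip, σ => σ
  | .assign x e, σ => { σ with var := Function.update σ.var x (e.evalNat σ) }
  | .store a i e, σ =>
      { σ with arr := Function.update σ.arr a
                  (Function.update (σ.arr a) (i.evalNat σ) (e.evalNat σ)) }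
  | .seq p q, σ => q.run (p.run σ)
  | .ite b p q, σ => if b.evalNat σ ≠ 0 then p.run σ else q.run σ
  | .loop _ _, σ => σ

def Program.LoopFree : Program → Prop
  | .seq p q => p.LoopFree ∧ q.LoopFree
  | .ite _ p q => p.LoopFree ∧ q.LoopFree
  | .loop _ _ => False
  | _ => True

/-- An upper bound for the number of steps of a program without loops. -/
def Program.maxCost : Program → ℕ
  | .skip => 1
  | .assign _ e => e.cost + 1
  | .store _ i e => i.cost + e.cost + 1
  | .seq p q => p.maxCost + q.maxCost
  | .ite b p q => b.cost + 1 + (p.maxCost + q.maxCost)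
  | .loop _ _ => 0

/-- All words in the memory are at most `b`. -/
def Store.Bounded (σ : Store) (b : ℕ) : Prop := (∀ x, σ.var x ≤ b) ∧ ∀ a i, σ.arr a i ≤ b

/-- Multiplication is the worst case. The base `b + 2 ≥ 2` makes both bounds at least `2`, so their
product also dominates their sum and the value `1` of a comparison. -/
theorem Op.eval_le (o : Op) {x y s t b : ℕ} (hx : x ≤ (b + 2) ^ (s + 1))
    (hy : y ≤ (b + 2) ^ (t + 1)) : o.eval x y ≤ (b + 2) ^ (s + t + 1 + 1) := by
  have e : (b + 2) ^ (s + t + 1 + 1) = (b + 2) ^ (s + 1) * (b + 2) ^ (t + 1) := by ring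
  have two (r : ℕ) : 2 ≤ (b + 2) ^ (r + 1) := by
    rw [pow_succ]
    nlinarith [Nat.one_le_pow r (b + 2) (by omega)]
  have hs := two s
  have ht := two t
  rw [e]
  generalize (b + 2) ^ (s + 1) = S at *
  generalize (b + 2) ^ (t + 1) = T at *
  have hxS : x ≤ S * T := hx.trans (Nat.le_mul_of_pos_right _ (by omega))
  cases o <;> simp only [Op.eval]
  · nlinarith
  · omega
  · exact Nat.mul_le_mul hx hy
  · exact (Nat.div_le_self _ _).trans hxS
  · exact (Nat.mod_le _ _).trans hxS
  · split_ifs <;> nlinarith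
  · split_ifs <;> nlinarith

/-- The exponent depends on the expression alone, not on `w` or the memory. A fixed program
therefore needs only a fixed exponent `K` in the assumption on the word length. -/
theorem Expr.exists_eval_eq (e : Expr) : ∃ κ : ℕ, ∀ (w b : ℕ) (σ : Store), σ.Bounded b →
    (b + 2) ^ (κ + 1) < 2 ^ w → e.eval w σ = e.evalNat σ ∧ e.evalNat σ ≤ (b + 2) ^ (κ + 1) := by
  induction e with
  | const k =>
    -- The constant itself serves as exponent, since `k < (b + 2) ^ k`.
    refine ⟨k, fun w b σ _ hw => ?_⟩
    have hk : k ≤ (b + 2) ^ (k + 1) :=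
      (Nat.lt_pow_self (by omega : 1 < b + 2)).le.trans (Nat.pow_le_pow_right (by omega) (by omega))
    exact ⟨Nat.mod_eq_of_lt (hk.trans_lt hw), hk⟩
  | var x => exact ⟨0, fun w b σ h _ => ⟨rfl, (h.1 x).trans (by simp)⟩⟩
  | load a i ih =>
    obtain ⟨κ, hκ⟩ := ih
    refine ⟨κ, fun w b σ h hw => ?_⟩
    have := hκ w b σ h hw
    refine ⟨by simp only [eval, evalNat, this.1], (h.2 a _).trans ?_⟩
    exact (by omega : b ≤ b + 2).trans (Nat.le_self_pow (by omega) _)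
  | op o l r ihl ihr =>
    obtain ⟨s, hs⟩ := ihl
    obtain ⟨t, ht⟩ := ihr
    refine ⟨s + t + 1, fun w b σ h hw => ?_⟩
    have hs := hs w b σ h ((Nat.pow_le_pow_right (by omega) (by omega)).trans_lt hw)
    have ht := ht w b σ h ((Nat.pow_le_pow_right (by omega) (by omega)).trans_lt hw)
    have := o.eval_le hs.2 ht.2
    refine ⟨?_, this⟩
    simp only [eval, evalNat, hs.1, ht.1]
    exact Nat.mod_eq_of_lt (this.trans_lt hw)

theorem bound_comp {b κ₁ κ₂ : ℕ} :
    ((b + 2) ^ (κ₁ + 1) + 2) ^ (κ₂ + 1) ≤ (b + 2) ^ ((κ₁ + 2) * (κ₂ + 1)) := by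
  rw [pow_mul]
  refine Nat.pow_le_pow_left ?_ _
  have : 2 ≤ (b + 2) ^ (κ₁ + 1) := (by omega : 2 ≤ b + 2).trans (Nat.le_self_pow (by omega) _)
  rw [pow_succ _ (κ₁ + 1)]
  nlinarith

theorem Store.Bounded.mono {σ : Store} {b b' : ℕ} (h : σ.Bounded b) (hb : b ≤ b') :
    σ.Bounded b' := ⟨fun x => (h.1 x).trans hb, fun a i => (h.2 a i).trans hb⟩

/-- On words that are long enough, a program without loops computes its result over the natural
numbers. -/
theorem Program.exists_exec_run (p : Program) (hp : p.LoopFree) : ∃ κ : ℕ, ∀ (w b : ℕ) (σ : Store),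
    σ.Bounded b → (b + 2) ^ (κ + 1) < 2 ^ w →
      (∃ t ≤ p.maxCost, Exec w p σ t (p.run σ)) ∧ (p.run σ).Bounded ((b + 2) ^ (κ + 1)) := by
  have self (b κ : ℕ) : b ≤ (b + 2) ^ (κ + 1) :=
    (by omega : b ≤ b + 2).trans (Nat.le_self_pow (by omega) _)
  induction p with
  | skip => exact ⟨0, fun w b σ h _ => ⟨⟨1, le_rfl, .skip σ⟩, h.mono (self _ _)⟩⟩
  | assign x e =>
    obtain ⟨κ, hκ⟩ := e.exists_eval_eq
    refine ⟨κ, fun w b σ h hw => ?_⟩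
    have he := hκ w b σ h hw
    refine ⟨⟨_, le_rfl, ?_⟩, ?_, (h.mono (self _ _)).2⟩
    · simp only [run, ← he.1]
      exact .assign σ x e
    · intro y
      simp only [run, Function.update_apply]
      split_ifs
      · exact he.2
      · exact (h.1 y).trans (self _ _)
  | store a i e =>
    obtain ⟨κ, hκ⟩ := e.exists_eval_eq
    obtain ⟨κ', hκ'⟩ := i.exists_eval_eq
    refine ⟨κ + κ', fun w b σ h hw => ?_⟩
    have le₁ : (b + 2) ^ (κ + 1) ≤ (b + 2) ^ (κ + κ' + 1) :=
      Nat.pow_le_pow_right (by omega) (by omega)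
    have le₂ : (b + 2) ^ (κ' + 1) ≤ (b + 2) ^ (κ + κ' + 1) :=
      Nat.pow_le_pow_right (by omega) (by omega)
    have he := hκ w b σ h (le₁.trans_lt hw)
    have hi := hκ' w b σ h (le₂.trans_lt hw)
    refine ⟨⟨_, le_rfl, ?_⟩, (h.mono (self _ _)).1, ?_⟩
    · simp only [run, ← he.1, ← hi.1]
      exact .store σ a i e
    · intro a' j
      simp only [run, Function.update_apply]
      split_ifs
      · simp only [Function.update_apply]
        split_ifs
        · exact he.2.trans le₁
        · exact (h.2 _ _).trans (self _ _)
      · exact (h.2 _ _).trans (self _ _)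
  | seq p q ihp ihq =>
    obtain ⟨κ₁, h₁⟩ := ihp hp.1
    obtain ⟨κ₂, h₂⟩ := ihq hp.2
    refine ⟨(κ₁ + 2) * (κ₂ + 1), fun w b σ h hw => ?_⟩
    have le₁ : (b + 2) ^ (κ₁ + 1) ≤ (b + 2) ^ ((κ₁ + 2) * (κ₂ + 1) + 1) :=
      Nat.pow_le_pow_right (by omega) (by nlinarith)
    have le₂ : ((b + 2) ^ (κ₁ + 1) + 2) ^ (κ₂ + 1) ≤ (b + 2) ^ ((κ₁ + 2) * (κ₂ + 1) + 1) :=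
      bound_comp.trans (Nat.pow_le_pow_right (by omega) (by omega))
    obtain ⟨⟨t₁, ht₁, e₁⟩, b₁⟩ := h₁ w b σ h (le₁.trans_lt hw)
    obtain ⟨⟨t₂, ht₂, e₂⟩, b₂⟩ := h₂ w _ _ b₁ (le₂.trans_lt hw)
    exact ⟨⟨t₁ + t₂, Nat.add_le_add ht₁ ht₂, .seq e₁ e₂⟩, b₂.mono le₂⟩
  | ite c p q ihp ihq =>
    obtain ⟨κ₁, h₁⟩ := ihp hp.1
    obtain ⟨κ₂, h₂⟩ := ihq hp.2
    obtain ⟨κ₃, h₃⟩ := c.exists_eval_eq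
    refine ⟨κ₁ + κ₂ + κ₃, fun w b σ h hw => ?_⟩
    have le₁ : (b + 2) ^ (κ₁ + 1) ≤ (b + 2) ^ (κ₁ + κ₂ + κ₃ + 1) :=
      Nat.pow_le_pow_right (by omega) (by omega)
    have le₂ : (b + 2) ^ (κ₂ + 1) ≤ (b + 2) ^ (κ₁ + κ₂ + κ₃ + 1) :=
      Nat.pow_le_pow_right (by omega) (by omega)
    have le₃ : (b + 2) ^ (κ₃ + 1) ≤ (b + 2) ^ (κ₁ + κ₂ + κ₃ + 1) :=
      Nat.pow_le_pow_right (by omega) (by omega)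
    have hc := h₃ w b σ h (le₃.trans_lt hw)
    by_cases h0 : c.evalNat σ = 0
    · obtain ⟨⟨t, ht, e⟩, b'⟩ := h₂ w b σ h (le₂.trans_lt hw)
      simp only [run, h0, ne_eq, not_true_eq_false, if_false, maxCost]
      exact ⟨⟨_, by omega, .ite_false (hc.1.trans h0) e⟩, b'.mono le₂⟩
    · obtain ⟨⟨t, ht, e⟩, b'⟩ := h₁ w b σ h (le₁.trans_lt hw)
      simp only [run, h0, ne_eq, not_false_eq_true, if_true, maxCost]
      exact ⟨⟨_, by omega, .ite_true (by rwa [hc.1]) e⟩, b'.mono le₁⟩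
  | loop => exact hp.elim

/-- A loop whose body takes at most `B` steps and increases a bounded measure. -/
theorem exec_loop {S : Type*} (rep : S → Store) {w : ℕ} {b : Expr} {p : Program} {Inv : S → Prop}
    {μ : S → ℤ} {B : ℕ} {M : ℤ} (bound : ∀ s, Inv s → μ s ≤ M)
    (step : ∀ s, Inv s → b.eval w (rep s) ≠ 0 →
      ∃ t ≤ B, ∃ s', Exec w p (rep s) t (rep s') ∧ Inv s' ∧ μ s + 1 ≤ μ s')
    {s : S} (hs : Inv s) :
    ∃ (t : ℕ) (s' : S), Exec w (.loop b p) (rep s) t (rep s') ∧ Inv s' ∧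
      b.eval w (rep s') = 0 ∧ (t : ℤ) ≤ (M - μ s + 1) * (B + b.cost + 1) := by
  obtain ⟨k, hk⟩ : ∃ k : ℕ, (M - μ s).toNat = k := ⟨_, rfl⟩
  induction k using Nat.strong_induction_on generalizing s with
  | _ k ih =>
  have hM := bound s hs
  by_cases h0 : b.eval w (rep s) = 0
  · refine ⟨_, s, .loop_false h0, hs, h0, ?_⟩
    push_cast
    nlinarith
  · obtain ⟨r, hr, s', he, hs', hμ⟩ := step s hs h0
    have hM' := bound s' hs'
    obtain ⟨t, s'', he', hs'', h0', ht⟩ := ih _ (by omega) hs' rfl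
    refine ⟨_, s'', .loop_true h0 he he', hs'', h0', ?_⟩
    push_cast
    have : (r : ℤ) ≤ B := by exact_mod_cast hr
    nlinarith

end WordRAM

/-! ### The data of the algorithm, the program, and its transitions -/

namespace Trimming

open WordRAM

/-- The data that stay fixed while the main loop runs: the input graph, the capacity `c` of an edge,
the sparsity parameter `D` of the cuts, and the maximal level `h`. -/
structure Params where
  n : ℕ
  m : ℕ
  p : ℕ
  q : ℕ
  c : ℕ
  D : ℕ
  h : ℕ
  adj : ℕ → List (ℕ × ℕ)

namespace Params

variable (P : Params)

def deg (v : ℕ) : ℕ := (P.adj v).length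

/-- The edge in the `k`-th entry of the adjacency list of `v`. -/
def arcEdge (v k : ℕ) : ℕ := ((P.adj v).getD k (0, 0)).1

/-- The other end in the `k`-th entry of the adjacency list of `v`. -/
def arcEnd (v k : ℕ) : ℕ := ((P.adj v).getD k (0, 0)).2

end Params

/-- The part of the memory that the main loop changes. The edge `e` carries `X e` units of flow into
its end `H e`. Edges `qe i` with an end `qv i` in the current set `A` form a queue of sources; the
entries before `qi` are done. The unit that is being routed is at `cur`. A sparse cut is grown as a
list `lst` of `ln` vertices, whose current layer ends at `le`, scanned up to arc `k` of the vertex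
in position `lo`; it has found `z` residual arcs. The depth `dep` is not stored. -/
structure State where
  mode : ℕ
  qi : ℕ
  qlen : ℕ
  cur : ℕ
  lo : ℕ
  le : ℕ
  ln : ℕ
  k : ℕ
  z : ℕ
  j : ℕ
  vol : ℕ
  dep : ℕ
  A : Finset ℕ
  qe : ℕ → ℕ
  qv : ℕ → ℕ
  X : ℕ → ℕ
  H : ℕ → ℕ
  mass : ℕ → ℕ
  lev : ℕ → ℕ
  ptr : ℕ → ℕ
  lst : ℕ → ℕ

/-- The memory that represents a state. -/
noncomputable def State.toStore (P : Params) (s : State) : Store where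
  var
    | 0 => P.n
    | 1 => P.m
    | 2 => P.p
    | 3 => P.q
    | 4 => s.qlen
    | 5 => P.c
    | 6 => P.D
    | 7 => P.h
    | 8 => s.mode
    | 9 => s.qi
    | 10 => s.cur
    | 11 => s.lo
    | 12 => s.le
    | 13 => s.ln
    | 14 => s.k
    | 15 => s.z
    | 16 => s.j
    | 17 => s.vol
    | _ => 0
  arr
    | 0 => fun v => if v ≤ P.n then offset P.adj v else 0
    | 1 => fun i => ((entries P.n P.adj).getD i (0, 0)).1
    | 2 => fun i => ((entries P.n P.adj).getD i (0, 0)).2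
    | 3 => membership s.A
    | 4 => s.qe
    | 5 => s.qv
    | 6 => s.X
    | 7 => s.H
    | 8 => s.mass
    | 9 => s.lev
    | 10 => s.ptr
    | 11 => s.lst
    | _ => fun _ => 0

/-! ### The program -/

section Program

local infixl:65 " +ₑ " => Expr.op Op.add
local infixl:65 " -ₑ " => Expr.op Op.sub
local infixl:70 " *ₑ " => Expr.op Op.mul
local infix:50 " =ₑ " => Expr.op Op.eq
local infix:50 " <ₑ " => Expr.op Op.lt
local infixr:30 " ;; " => Program.seq
local infix:40 " ≔ " => Program.assign

def degExpr (v : Expr) : Expr := .load 0 (v +ₑ .const 1) -ₑ .load 0 v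

def arcEdgeExpr (v k : Expr) : Expr := .load 1 (.load 0 v +ₑ k)

def arcEndExpr (v k : Expr) : Expr := .load 2 (.load 0 v +ₑ k)

/-- Tests whether the vertex `u` is in the current set and the edge `e` can carry more flow into
`u`. -/
def openExpr (e u : Expr) : Expr :=
  .load 3 u *ₑ (.const 1 -ₑ (.load 6 e =ₑ .var 5) *ₑ (.load 7 e =ₑ u))

def incr (x : ℕ) : Program := x ≔ .var x +ₑ .const 1

def incrAt (a : ℕ) (i : Expr) : Program := .store a i (.load a i +ₑ .const 1)

def decrAt (a : ℕ) (i : Expr) : Program := .store a i (.load a i -ₑ .const 1)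

/-- Sends one unit of flow over the edge `e` into its end `u`. -/
def pushProgram (e u : Expr) : Program :=
  .ite ((.load 6 e =ₑ .const 0) +ₑ (.load 7 e =ₑ u))
    (incrAt 6 e ;; .store 7 e u) (decrAt 6 e)

def sourceProgram : Program :=
  .ite (.var 9 =ₑ .var 4) (8 ≔ .const 0)
    (.ite (openExpr (.load 4 (.var 9)) (.load 5 (.var 9)))
      (pushProgram (.load 4 (.var 9)) (.load 5 (.var 9)) ;; incrAt 8 (.load 5 (.var 9)) ;;
        10 ≔ .load 5 (.var 9) ;; 8 ≔ .const 2)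
      (incr 9))

def walkProgram : Program :=
  .ite (degExpr (.var 10) <ₑ .load 8 (.var 10))
    (.ite (.load 9 (.var 10) =ₑ .var 7)
      (.store 3 (.var 10) (.const 0) ;; .store 11 (.const 0) (.var 10) ;; 11 ≔ .const 0 ;;
        12 ≔ .const 1 ;; 13 ≔ .const 1 ;; 14 ≔ .const 0 ;; 15 ≔ .const 0 ;; 16 ≔ .const 0 ;;
        17 ≔ degExpr (.var 10) ;; 8 ≔ .const 3)
      (.ite (.load 10 (.var 10) =ₑ degExpr (.var 10))
        (incrAt 9 (.var 10) ;; .store 10 (.var 10) (.const 0))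
        (.ite (openExpr (arcEdgeExpr (.var 10) (.load 10 (.var 10)))
              (arcEndExpr (.var 10) (.load 10 (.var 10))) *ₑ
            (.load 9 (.var 10) =ₑ
              .load 9 (arcEndExpr (.var 10) (.load 10 (.var 10))) +ₑ .const 1))
          (pushProgram (arcEdgeExpr (.var 10) (.load 10 (.var 10)))
              (arcEndExpr (.var 10) (.load 10 (.var 10))) ;;
            decrAt 8 (.var 10) ;; incrAt 8 (arcEndExpr (.var 10) (.load 10 (.var 10))) ;;
            10 ≔ arcEndExpr (.var 10) (.load 10 (.var 10)))
          (incrAt 10 (.var 10)))))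
    (8 ≔ .const 1)

def scanProgram : Program :=
  .ite (.var 11 =ₑ .var 12)
    (.ite (.var 17 <ₑ .var 15 *ₑ .var 6) (8 ≔ .const 4)
      (4 ≔ .var 4 +ₑ .var 15 ;; 11 ≔ .const 0 ;; 12 ≔ .const 0 ;; 13 ≔ .const 0 ;;
        14 ≔ .const 0 ;; 15 ≔ .const 0 ;; 17 ≔ .const 0 ;; 8 ≔ .const 1))
    (.ite (.var 14 =ₑ degExpr (.load 11 (.var 11))) (incr 11 ;; 14 ≔ .const 0)
      (.ite (openExpr (arcEdgeExpr (.load 11 (.var 11)) (.var 14))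
          (arcEndExpr (.load 11 (.var 11)) (.var 14)))
        (.store 4 (.var 4 +ₑ .var 15) (arcEdgeExpr (.load 11 (.var 11)) (.var 14)) ;;
          .store 5 (.var 4 +ₑ .var 15) (arcEndExpr (.load 11 (.var 11)) (.var 14)) ;;
          incr 15 ;; incr 14)
        (incr 14)))

def growProgram : Program :=
  .ite (.var 16 =ₑ .var 15)
    (12 ≔ .var 13 ;; 15 ≔ .const 0 ;; 16 ≔ .const 0 ;; 8 ≔ .const 3)
    (.ite (.load 3 (.load 5 (.var 4 +ₑ .var 16)))
      (.store 3 (.load 5 (.var 4 +ₑ .var 16)) (.const 0) ;;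
        .store 11 (.var 13) (.load 5 (.var 4 +ₑ .var 16)) ;; incr 13 ;;
        17 ≔ .var 17 +ₑ degExpr (.load 5 (.var 4 +ₑ .var 16)) ;; incr 16)
      (incr 16))

/-- Variable `8` is the mode: `1` takes the next source, `2` routes a unit, `3` scans the last layer
of a cut for residual arcs, `4` absorbs the ends that were found. Mode `0` ends the loop. One
iteration does a constant amount of work, so that the running time is a count of iterations. -/
def bodyProgram : Program :=
  .ite (.var 8 =ₑ .const 1) sourceProgram
    (.ite (.var 8 =ₑ .const 2) walkProgram
      (.ite (.var 8 =ₑ .const 3) scanProgram growProgram))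

/-- Computes the parameters `c`, `D` and `h`. -/
def setupProgram : Program :=
  5 ≔ .op .div (.const 3 *ₑ .var 3) (.const 2 *ₑ .var 2) +ₑ .const 1 ;;
  6 ≔ .const 8 *ₑ .var 5 ;;
  7 ≔ .var 6 +ₑ .const 2 ;;
  18 ≔ .var 1

/-- Each binary digit of `m` contributes one summand `D` to `h`; this replaces a logarithm. -/
def levelBody : Program :=
  18 ≔ .op .div (.var 18) (.const 2) ;; 7 ≔ .var 7 +ₑ .var 6

/-- An empty boundary is treated apart: only constant time is allowed then, and the loop over the
digits of `m` would exceed it. -/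
def trimProgram : Program :=
  .ite (.var 4)
    (setupProgram ;; .loop (.var 18) levelBody ;; 8 ≔ .const 1 ;; .loop (.var 8) bodyProgram)
    .skip

end Program

/-! ### The transitions -/

namespace State

variable (P : Params) (s : State)

/-- The edge `e` carries `c` units of flow into `u`. -/
def Sat (e u : ℕ) : Prop := s.X e = P.c ∧ s.H e = u

open Classical in
/-- The state after one unit of flow is sent over `e` into `u`. -/
noncomputable def push (e u : ℕ) : State :=
  if s.X e = 0 ∨ s.H e = u then
    { s with X := Function.update s.X e (s.X e + 1), H := Function.update s.H e u }
  else { s with X := Function.update s.X e (s.X e - 1) }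

noncomputable def inject (e v : ℕ) : State :=
  { s.push e v with
    mass := Function.update s.mass v (s.mass v + 1)
    cur := v
    mode := 2 }

def startCut : State :=
  { s with
    A := s.A.erase s.cur
    lst := Function.update s.lst 0 s.cur
    lo := 0, le := 1, ln := 1, k := 0, z := 0, j := 0, vol := P.deg s.cur, dep := 0, mode := 3 }

def relabel : State :=
  { s with
    lev := Function.update s.lev s.cur (s.lev s.cur + 1)
    ptr := Function.update s.ptr s.cur 0 }

noncomputable def move (e u : ℕ) : State :=
  { s.push e u with
    mass := Function.update (Function.update s.mass s.cur (s.mass s.cur - 1)) u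
      (Function.update s.mass s.cur (s.mass s.cur - 1) u + 1)
    cur := u }

def advance : State :=
  { s with ptr := Function.update s.ptr s.cur (s.ptr s.cur + 1) }

def commit : State :=
  { s with
    qlen := s.qlen + s.z
    lo := 0, le := 0, ln := 0, k := 0, z := 0, vol := 0, mode := 1 }

def record (e u : ℕ) : State :=
  { s with
    qe := Function.update s.qe (s.qlen + s.z) e
    qv := Function.update s.qv (s.qlen + s.z) u
    z := s.z + 1
    k := s.k + 1 }

def nextLayer : State :=
  { s with le := s.ln, z := 0, j := 0, dep := s.dep + 1, mode := 3 }

def absorb (u : ℕ) : State :=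
  { s with
    A := s.A.erase u
    lst := Function.update s.lst s.ln u
    ln := s.ln + 1
    vol := s.vol + P.deg u
    j := s.j + 1 }

open Classical in
noncomputable def sourceStep : State :=
  if s.qi = s.qlen then { s with mode := 0 }
  else if s.qv s.qi ∈ s.A ∧ ¬ s.Sat P (s.qe s.qi) (s.qv s.qi) then
    s.inject (s.qe s.qi) (s.qv s.qi)
  else { s with qi := s.qi + 1 }

open Classical in
-- Push-relabel with current-arc pointers, restricted to the one vertex that may be overfull.
-- Reaching level `h` with excess starts a cut instead of a relabeling.
noncomputable def walkStep : State :=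
  if P.deg s.cur < s.mass s.cur then
    if s.lev s.cur = P.h then s.startCut P
    else if s.ptr s.cur = P.deg s.cur then s.relabel
    else if (P.arcEnd s.cur (s.ptr s.cur) ∈ s.A ∧
        ¬ s.Sat P (P.arcEdge s.cur (s.ptr s.cur)) (P.arcEnd s.cur (s.ptr s.cur))) ∧
        s.lev s.cur = s.lev (P.arcEnd s.cur (s.ptr s.cur)) + 1 then
      s.move (P.arcEdge s.cur (s.ptr s.cur)) (P.arcEnd s.cur (s.ptr s.cur))
    else s.advance
  else { s with mode := 1 }

open Classical in
-- When the layer is exhausted, `z * D ≤ vol` decides that the cut is sparse in the residual graph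
-- and may be committed.
noncomputable def scanStep : State :=
  if s.lo = s.le then
    if s.vol < s.z * P.D then { s with mode := 4 } else s.commit
  else if s.k = P.deg (s.lst s.lo) then { s with lo := s.lo + 1, k := 0 }
  else if P.arcEnd (s.lst s.lo) s.k ∈ s.A ∧
      ¬ s.Sat P (P.arcEdge (s.lst s.lo) s.k) (P.arcEnd (s.lst s.lo) s.k) then
    s.record (P.arcEdge (s.lst s.lo) s.k) (P.arcEnd (s.lst s.lo) s.k)
  else { s with k := s.k + 1 }

open Classical in
noncomputable def growStep : State :=
  if s.j = s.z then s.nextLayer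
  else if s.qv (s.qlen + s.j) ∈ s.A then s.absorb P (s.qv (s.qlen + s.j))
  else { s with j := s.j + 1 }

/-- The effect of one iteration of the main loop. -/
noncomputable def step : State :=
  if s.mode = 1 then s.sourceStep P
  else if s.mode = 2 then s.walkStep P
  else if s.mode = 3 then s.scanStep P
  else s.growStep P

end State

/-! ### The program carries out the transitions -/

section Simulation

variable {P : Params} {s : State}

/-- This lemma and the following ones express a write to memory as the change of one field of the
state. Once the index is a numeral, both sides agree by definition. -/
theorem run_assign_qlen (e : Expr) : (Program.assign 4 e).run (s.toStore P) =
    { s with qlen := e.evalNat (s.toStore P) }.toStore P := by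
  simp only [Program.run, State.toStore, Store.mk.injEq, and_true]
  funext x
  iterate 19 (rcases x with _ | x; · rfl)
  rfl

theorem run_assign_mode (e : Expr) : (Program.assign 8 e).run (s.toStore P) =
    { s with mode := e.evalNat (s.toStore P) }.toStore P := by
  simp only [Program.run, State.toStore, Store.mk.injEq, and_true]
  funext x
  iterate 19 (rcases x with _ | x; · rfl)
  rfl

theorem run_assign_qi (e : Expr) : (Program.assign 9 e).run (s.toStore P) =
    { s with qi := e.evalNat (s.toStore P) }.toStore P := by
  simp only [Program.run, State.toStore, Store.mk.injEq, and_true]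
  funext x
  iterate 19 (rcases x with _ | x; · rfl)
  rfl

theorem run_assign_cur (e : Expr) : (Program.assign 10 e).run (s.toStore P) =
    { s with cur := e.evalNat (s.toStore P) }.toStore P := by
  simp only [Program.run, State.toStore, Store.mk.injEq, and_true]
  funext x
  iterate 19 (rcases x with _ | x; · rfl)
  rfl

theorem run_assign_lo (e : Expr) : (Program.assign 11 e).run (s.toStore P) =
    { s with lo := e.evalNat (s.toStore P) }.toStore P := by
  simp only [Program.run, State.toStore, Store.mk.injEq, and_true]
  funext x
  iterate 19 (rcases x with _ | x; · rfl)
  rfl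

theorem run_assign_le (e : Expr) : (Program.assign 12 e).run (s.toStore P) =
    { s with le := e.evalNat (s.toStore P) }.toStore P := by
  simp only [Program.run, State.toStore, Store.mk.injEq, and_true]
  funext x
  iterate 19 (rcases x with _ | x; · rfl)
  rfl

theorem run_assign_ln (e : Expr) : (Program.assign 13 e).run (s.toStore P) =
    { s with ln := e.evalNat (s.toStore P) }.toStore P := by
  simp only [Program.run, State.toStore, Store.mk.injEq, and_true]
  funext x
  iterate 19 (rcases x with _ | x; · rfl)
  rfl

theorem run_assign_k (e : Expr) : (Program.assign 14 e).run (s.toStore P) =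
    { s with k := e.evalNat (s.toStore P) }.toStore P := by
  simp only [Program.run, State.toStore, Store.mk.injEq, and_true]
  funext x
  iterate 19 (rcases x with _ | x; · rfl)
  rfl

theorem run_assign_z (e : Expr) : (Program.assign 15 e).run (s.toStore P) =
    { s with z := e.evalNat (s.toStore P) }.toStore P := by
  simp only [Program.run, State.toStore, Store.mk.injEq, and_true]
  funext x
  iterate 19 (rcases x with _ | x; · rfl)
  rfl

theorem run_assign_j (e : Expr) : (Program.assign 16 e).run (s.toStore P) =
    { s with j := e.evalNat (s.toStore P) }.toStore P := by
  simp only [Program.run, State.toStore, Store.mk.injEq, and_true]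
  funext x
  iterate 19 (rcases x with _ | x; · rfl)
  rfl

theorem run_assign_vol (e : Expr) : (Program.assign 17 e).run (s.toStore P) =
    { s with vol := e.evalNat (s.toStore P) }.toStore P := by
  simp only [Program.run, State.toStore, Store.mk.injEq, and_true]
  funext x
  iterate 19 (rcases x with _ | x; · rfl)
  rfl

theorem run_store_qe (i e : Expr) : (Program.store 4 i e).run (s.toStore P) =
    { s with
      qe := Function.update s.qe (i.evalNat (s.toStore P))
        (e.evalNat (s.toStore P)) }.toStore P := by
  simp only [Program.run, State.toStore, Store.mk.injEq, true_and]
  funext x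
  iterate 12 (rcases x with _ | x; · rfl)
  rfl

theorem run_store_qv (i e : Expr) : (Program.store 5 i e).run (s.toStore P) =
    { s with
      qv := Function.update s.qv (i.evalNat (s.toStore P))
        (e.evalNat (s.toStore P)) }.toStore P := by
  simp only [Program.run, State.toStore, Store.mk.injEq, true_and]
  funext x
  iterate 12 (rcases x with _ | x; · rfl)
  rfl

theorem run_store_X (i e : Expr) : (Program.store 6 i e).run (s.toStore P) =
    { s with
      X := Function.update s.X (i.evalNat (s.toStore P))
        (e.evalNat (s.toStore P)) }.toStore P := by
  simp only [Program.run, State.toStore, Store.mk.injEq, true_and]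
  funext x
  iterate 12 (rcases x with _ | x; · rfl)
  rfl

theorem run_store_H (i e : Expr) : (Program.store 7 i e).run (s.toStore P) =
    { s with
      H := Function.update s.H (i.evalNat (s.toStore P))
        (e.evalNat (s.toStore P)) }.toStore P := by
  simp only [Program.run, State.toStore, Store.mk.injEq, true_and]
  funext x
  iterate 12 (rcases x with _ | x; · rfl)
  rfl

theorem run_store_mass (i e : Expr) : (Program.store 8 i e).run (s.toStore P) =
    { s with
      mass := Function.update s.mass (i.evalNat (s.toStore P))
        (e.evalNat (s.toStore P)) }.toStore P := by
  simp only [Program.run, State.toStore, Store.mk.injEq, true_and]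
  funext x
  iterate 12 (rcases x with _ | x; · rfl)
  rfl

theorem run_store_lev (i e : Expr) : (Program.store 9 i e).run (s.toStore P) =
    { s with
      lev := Function.update s.lev (i.evalNat (s.toStore P))
        (e.evalNat (s.toStore P)) }.toStore P := by
  simp only [Program.run, State.toStore, Store.mk.injEq, true_and]
  funext x
  iterate 12 (rcases x with _ | x; · rfl)
  rfl

theorem run_store_ptr (i e : Expr) : (Program.store 10 i e).run (s.toStore P) =
    { s with
      ptr := Function.update s.ptr (i.evalNat (s.toStore P))
        (e.evalNat (s.toStore P)) }.toStore P := by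
  simp only [Program.run, State.toStore, Store.mk.injEq, true_and]
  funext x
  iterate 12 (rcases x with _ | x; · rfl)
  rfl

theorem run_store_lst (i e : Expr) : (Program.store 11 i e).run (s.toStore P) =
    { s with
      lst := Function.update s.lst (i.evalNat (s.toStore P))
        (e.evalNat (s.toStore P)) }.toStore P := by
  simp only [Program.run, State.toStore, Store.mk.injEq, true_and]
  funext x
  iterate 12 (rcases x with _ | x; · rfl)
  rfl

theorem membership_erase (A : Finset ℕ) (u : ℕ) :
    Function.update (membership A) u 0 = membership (A.erase u) := by
  funext v
  by_cases h : v = u <;> simp [membership, h]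

theorem run_store_A (i : Expr) : (Program.store 3 i (.const 0)).run (s.toStore P) =
    { s with A := s.A.erase (i.evalNat (s.toStore P)) }.toStore P := by
  simp only [Program.run, State.toStore, Store.mk.injEq, true_and]
  funext x
  iterate 3 (rcases x with _ | x; · rfl)
  rcases x with _ | x
  · exact membership_erase _ _
  iterate 9 (rcases x with _ | x; · rfl)
  rfl

end Simulation

end Trimming

/-! ### Expressions and program blocks evaluated on the memory of a state -/

namespace Trimming

open WordRAM

section Simulation

open scoped Classical

variable {P : Params} {s : State}

theorem length_entries (adj : ℕ → List (ℕ × ℕ)) (n : ℕ) : (entries n adj).length = offset adj n := by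
  induction n with
  | zero => rfl
  | succ n ih =>
    rw [entries, List.range_succ, List.flatMap_append, List.length_append, ← entries, ih, offset,
      offset, Finset.sum_range_succ]
    simp

theorem entries_getD (adj : ℕ → List (ℕ × ℕ)) {n v k : ℕ} (hv : v < n) (hk : k < (adj v).length) :
    (entries n adj).getD (offset adj v + k) (0, 0) = (adj v).getD k (0, 0) := by
  induction n with
  | zero => omega
  | succ n ih =>
    rw [entries, List.range_succ, List.flatMap_append, ← entries, List.flatMap_singleton]
    rcases Nat.lt_succ_iff_lt_or_eq.1 hv with h | rfl
    · rw [List.getD_append, ih h]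
      rw [length_entries]
      have : offset adj (v + 1) ≤ offset adj n :=
        Finset.sum_le_sum_of_subset (Finset.range_mono h)
      rw [offset, Finset.sum_range_succ, ← offset] at this
      omega
    · rw [List.getD_append_right _ _ _ _ (by rw [length_entries]; omega), length_entries,
        Nat.add_sub_cancel_left]

theorem evalNat_degExpr {v : Expr} {x : ℕ} (hv : v.evalNat (s.toStore P) = x) (hx : x < P.n) :
    (degExpr v).evalNat (s.toStore P) = P.deg x := by
  have h₁ : x ≤ P.n := hx.le
  have h₂ : x + 1 ≤ P.n := hx
  simp only [degExpr, Expr.evalNat, Op.eval, hv]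
  simp only [State.toStore, if_pos h₁, if_pos h₂, Params.deg]
  rw [offset, Finset.sum_range_succ, ← offset]
  omega

theorem evalNat_arcEdgeExpr {v k : Expr} {x y : ℕ} (hv : v.evalNat (s.toStore P) = x)
    (hk : k.evalNat (s.toStore P) = y) (hx : x < P.n) (hy : y < P.deg x) :
    (arcEdgeExpr v k).evalNat (s.toStore P) = P.arcEdge x y := by
  simp only [arcEdgeExpr, Expr.evalNat, Op.eval, hv, hk]
  simp only [State.toStore, if_pos hx.le, Params.arcEdge]
  rw [entries_getD _ hx hy]

theorem evalNat_arcEndExpr {v k : Expr} {x y : ℕ} (hv : v.evalNat (s.toStore P) = x)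
    (hk : k.evalNat (s.toStore P) = y) (hx : x < P.n) (hy : y < P.deg x) :
    (arcEndExpr v k).evalNat (s.toStore P) = P.arcEnd x y := by
  simp only [arcEndExpr, Expr.evalNat, Op.eval, hv, hk]
  simp only [State.toStore, if_pos hx.le, Params.arcEnd]
  rw [entries_getD _ hx hy]

theorem evalNat_openExpr (e u : Expr) :
    (openExpr e u).evalNat (s.toStore P) ≠ 0 ↔ u.evalNat (s.toStore P) ∈ s.A ∧
      ¬ s.Sat P (e.evalNat (s.toStore P)) (u.evalNat (s.toStore P)) := by
  simp only [openExpr, Expr.evalNat, Op.eval, State.Sat]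
  obtain ⟨x, hx⟩ : ∃ x, e.evalNat (s.toStore P) = x := ⟨_, rfl⟩
  obtain ⟨y, hy⟩ : ∃ y, u.evalNat (s.toStore P) = y := ⟨_, rfl⟩
  simp only [hx, hy]
  simp only [State.toStore, membership]
  by_cases h₁ : y ∈ s.A <;> by_cases h₂ : s.X x = P.c <;> by_cases h₃ : s.H x = y <;>
    simp [h₁, h₂, h₃]

theorem run_incr (x : ℕ) (σ : Store) :
    (incr x).run σ = (Program.assign x (.op .add (.var x) (.const 1))).run σ := rfl

theorem run_incrAt (a : ℕ) (i : Expr) (σ : Store) :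
    (incrAt a i).run σ = (Program.store a i (.op .add (.load a i) (.const 1))).run σ := rfl

theorem run_decrAt (a : ℕ) (i : Expr) (σ : Store) :
    (decrAt a i).run σ = (Program.store a i (.op .sub (.load a i) (.const 1))).run σ := rfl

theorem run_seq (p q : Program) (σ : Store) : (Program.seq p q).run σ = q.run (p.run σ) := rfl

theorem run_ite (b : Expr) (p q : Program) (σ : Store) :
    (Program.ite b p q).run σ = if b.evalNat σ ≠ 0 then p.run σ else q.run σ := rfl

/-- Both expressions are evaluated again after `X` has been overwritten, hence the two hypotheses
that they do not depend on `X`. -/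
theorem run_pushProgram {e u : Expr}
    (he : ∀ i x, e.evalNat ({ s with X := Function.update s.X i x }.toStore P) =
      e.evalNat (s.toStore P))
    (hu : ∀ i x, u.evalNat ({ s with X := Function.update s.X i x }.toStore P) =
      u.evalNat (s.toStore P)) :
    (pushProgram e u).run (s.toStore P) =
      (s.push (e.evalNat (s.toStore P)) (u.evalNat (s.toStore P))).toStore P := by
  rw [pushProgram, run_ite, State.push]
  have : ((Expr.op .add (.op .eq (.load 6 e) (.const 0)) (.op .eq (.load 7 e) u)).evalNat
      (s.toStore P) ≠ 0) ↔ s.X (e.evalNat (s.toStore P)) = 0 ∨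
        s.H (e.evalNat (s.toStore P)) = u.evalNat (s.toStore P) := by
    simp only [Expr.evalNat, Op.eval]
    obtain ⟨x, hx⟩ : ∃ x, e.evalNat (s.toStore P) = x := ⟨_, rfl⟩
    obtain ⟨y, hy⟩ : ∃ y, u.evalNat (s.toStore P) = y := ⟨_, rfl⟩
    simp only [hx, hy]
    simp only [State.toStore]
    by_cases h₂ : s.X x = 0 <;> by_cases h₃ : s.H x = y <;> simp [h₂, h₃]
  rw [if_congr this rfl rfl, run_seq, run_incrAt, run_store_X, run_store_H, he, hu, run_decrAt,
    run_store_X, apply_ite (State.toStore P)]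
  rfl

theorem ite_of_ne_zero_iff {α : Sort*} {x : ℕ} {c : Prop} [Decidable c] (h : x ≠ 0 ↔ c) (a b : α) :
    (if x ≠ 0 then a else b) = if c then a else b := if_congr h rfl rfl

/-- Array reads have their intended value only for indices in range, and the range is often known
only from the branch condition. -/
theorem if_congr_ctx {α : Sort*} {b c : Prop} [Decidable b] [Decidable c] {x y u v : α} (h : b ↔ c)
    (h₁ : c → x = u) (h₂ : ¬ c → y = v) : (if b then x else y) = if c then u else v := by
  by_cases hc : c
  · rw [if_pos hc, if_pos (h.2 hc), h₁ hc]
  · rw [if_neg hc, if_neg (mt h.1 hc), h₂ hc]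

theorem toStore_ite {c : Prop} [Decidable c] (a b : State) :
    (if c then a else b).toStore P = if c then a.toStore P else b.toStore P :=
  apply_ite (State.toStore P) _ _ _

theorem evalNat_eq_ne_zero (a b : Expr) (σ : Store) :
    (Expr.op .eq a b).evalNat σ ≠ 0 ↔ a.evalNat σ = b.evalNat σ := by
  simp [Expr.evalNat, Op.eval]

theorem evalNat_lt_ne_zero (a b : Expr) (σ : Store) :
    (Expr.op .lt a b).evalNat σ ≠ 0 ↔ a.evalNat σ < b.evalNat σ := by
  simp [Expr.evalNat, Op.eval]

theorem evalNat_add (a b : Expr) (σ : Store) :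
    (Expr.op .add a b).evalNat σ = a.evalNat σ + b.evalNat σ := rfl

theorem push_cases (e u : ℕ) : ∃ X H, s.push e u = { s with X := X, H := H } := by
  rw [State.push]
  split_ifs
  exacts [⟨_, _, rfl⟩, ⟨_, _, rfl⟩]

theorem run_sourceProgram : sourceProgram.run (s.toStore P) = (s.sourceStep P).toStore P := by
  rw [sourceProgram, State.sourceStep, run_ite, ite_of_ne_zero_iff (evalNat_eq_ne_zero _ _ _),
    run_ite, if_congr (evalNat_openExpr _ _) rfl rfl, toStore_ite, toStore_ite, run_assign_mode,
    run_seq, run_pushProgram (fun _ _ => rfl) (fun _ _ => rfl), State.inject]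
  obtain ⟨X, H, h⟩ := push_cases (s := s) (Expr.evalNat (s.toStore P) (.load 4 (.var 9)))
    (Expr.evalNat (s.toStore P) (.load 5 (.var 9)))
  have h' : s.push (s.qe s.qi) (s.qv s.qi) = { s with X := X, H := H } := h
  rw [h, h', run_seq, run_incrAt, run_store_mass, run_seq, run_assign_cur, run_assign_mode, run_incr,
    run_assign_qi]
  rfl

theorem run_walkProgram (hc : s.cur < P.n) (hp : s.ptr s.cur ≤ P.deg s.cur) :
    walkProgram.run (s.toStore P) = (s.walkStep P).toStore P := by
  have hd : (degExpr (.var 10)).evalNat (s.toStore P) = P.deg s.cur := evalNat_degExpr rfl hc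
  rw [walkProgram, State.walkStep, run_ite, ite_of_ne_zero_iff (evalNat_lt_ne_zero _ _ _), hd,
    run_ite, ite_of_ne_zero_iff (evalNat_eq_ne_zero _ _ _), run_ite,
    ite_of_ne_zero_iff (evalNat_eq_ne_zero _ _ _), hd, toStore_ite, toStore_ite, toStore_ite]
  refine if_congr Iff.rfl (if_congr Iff.rfl ?_ (if_congr_ctx Iff.rfl (fun _ => ?_) fun hne => ?_)) ?_
  · simp only [run_seq, run_store_A, run_store_lst, run_assign_lo, run_assign_le, run_assign_ln,
      run_assign_k, run_assign_z, run_assign_j, run_assign_vol, run_assign_mode]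
    rw [evalNat_degExpr ?_ hc] <;> rfl
  · rw [run_seq, run_incrAt, run_store_lev, run_store_ptr]
    rfl
  · have hp' : s.ptr s.cur < P.deg s.cur := lt_of_le_of_ne hp hne
    have he' : (arcEdgeExpr (.var 10) (.load 10 (.var 10))).evalNat (s.toStore P) =
      P.arcEdge s.cur (s.ptr s.cur) := evalNat_arcEdgeExpr rfl rfl hc hp'
    have hu' : (arcEndExpr (.var 10) (.load 10 (.var 10))).evalNat (s.toStore P) =
      P.arcEnd s.cur (s.ptr s.cur) := evalNat_arcEndExpr rfl rfl hc hp'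
    rw [run_ite, toStore_ite]
    refine if_congr ?_ ?_ ?_
    · rw [Expr.evalNat, Op.eval, mul_ne_zero_iff, evalNat_openExpr, evalNat_eq_ne_zero, he', hu']
      simp only [Expr.evalNat, Op.eval]
      rw [hu']
      rfl
    · rw [run_seq, run_pushProgram (fun _ _ => rfl) (fun _ _ => rfl), State.move, he', hu']
      obtain ⟨X, H, h⟩ := push_cases (s := s) (P.arcEdge s.cur (s.ptr s.cur))
        (P.arcEnd s.cur (s.ptr s.cur))
      rw [h, run_seq, run_decrAt, run_store_mass, run_seq, run_incrAt, run_store_mass,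
        run_assign_cur]
      simp only [Expr.evalNat, Op.eval]
      rw [evalNat_arcEndExpr (x := s.cur) (y := s.ptr s.cur) rfl rfl hc hp',
        evalNat_arcEndExpr (x := s.cur) (y := s.ptr s.cur) rfl rfl hc hp']
      rfl
    · rw [run_incrAt, run_store_ptr]
      rfl
  · rw [run_assign_mode]
    rfl

theorem run_scanProgram (hl : s.lo ≠ s.le → s.lst s.lo < P.n)
    (hk : s.lo ≠ s.le → s.k ≤ P.deg (s.lst s.lo)) :
    scanProgram.run (s.toStore P) = (s.scanStep P).toStore P := by
  rw [scanProgram, State.scanStep, run_ite, ite_of_ne_zero_iff (evalNat_eq_ne_zero _ _ _),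
    run_ite, ite_of_ne_zero_iff (evalNat_lt_ne_zero _ _ _), toStore_ite, toStore_ite]
  refine if_congr_ctx Iff.rfl (fun _ => if_congr Iff.rfl ?_ ?_) fun hne => ?_
  · rw [run_assign_mode]
    rfl
  · simp only [run_seq, run_assign_qlen, run_assign_lo, run_assign_le, run_assign_ln,
      run_assign_k, run_assign_z, run_assign_vol, run_assign_mode]
    rfl
  · replace hl := hl hne
    have hd : (degExpr (.load 11 (.var 11))).evalNat (s.toStore P) = P.deg (s.lst s.lo) :=
      evalNat_degExpr rfl hl
    rw [run_ite, ite_of_ne_zero_iff (evalNat_eq_ne_zero _ _ _), hd, toStore_ite, toStore_ite]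
    refine if_congr_ctx Iff.rfl (fun _ => ?_) fun hne' => ?_
    · rw [run_seq, run_incr, run_assign_lo, run_assign_k]
      rfl
    have hk' : s.k < P.deg (s.lst s.lo) := lt_of_le_of_ne (hk hne) hne'
    have he : (arcEdgeExpr (.load 11 (.var 11)) (.var 14)).evalNat (s.toStore P) =
      P.arcEdge (s.lst s.lo) s.k := evalNat_arcEdgeExpr rfl rfl hl hk'
    have hu : (arcEndExpr (.load 11 (.var 11)) (.var 14)).evalNat (s.toStore P) =
      P.arcEnd (s.lst s.lo) s.k := evalNat_arcEndExpr rfl rfl hl hk'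
    rw [run_ite, if_congr (evalNat_openExpr _ _) rfl rfl, he, hu]
    refine if_congr Iff.rfl ?_ ?_
    · rw [run_seq, run_store_qe, run_seq, run_store_qv, run_seq, run_incr, run_incr, run_assign_z,
        run_assign_k, he, evalNat_arcEndExpr (x := s.lst s.lo) (y := s.k) ?_ ?_ hl hk'] <;> rfl
    · rw [run_incr, run_assign_k]
      rfl

theorem run_growProgram (hl : s.j ≠ s.z → s.qv (s.qlen + s.j) < P.n) :
    growProgram.run (s.toStore P) = (s.growStep P).toStore P := by
  rw [growProgram, State.growStep, run_ite, ite_of_ne_zero_iff (evalNat_eq_ne_zero _ _ _),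
    toStore_ite, toStore_ite]
  refine if_congr_ctx Iff.rfl (fun _ => ?_) fun hne => ?_
  · simp only [run_seq, run_assign_le, run_assign_z, run_assign_j, run_assign_mode]
    rfl
  rw [run_ite]
  refine if_congr ?_ ?_ ?_
  · simp [Expr.evalNat, Op.eval, State.toStore, membership]
  · simp only [run_seq, run_store_A, run_store_lst, run_incr, run_assign_ln, run_assign_vol,
      run_assign_j]
    rw [evalNat_add (.var 17), evalNat_degExpr (x := s.qv (s.qlen + s.j)) ?_ (hl hne)] <;> rfl
  · rw [run_incr, run_assign_j]
    rfl

end Simulation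

end Trimming

namespace Trimming

open WordRAM

/-! ### The invariants of the main loop -/

/-- The adjacency lists in `P` describe the graph `G`. -/
structure Params.Represents (P : Params) (G : Graph ℕ ℕ) : Prop where
  vertex : ∀ {v}, v ∈ G.vertexSet ↔ v < P.n
  edge : ∀ {e}, e ∈ G.edgeSet ↔ e < P.m
  arc_link : ∀ {v k}, v < P.n → k < P.deg v → G.IsLink (P.arcEdge v k) v (P.arcEnd v k)
  exists_arc : ∀ {e v u}, G.IsLink e v u → ∃ k < P.deg v, P.arcEdge v k = e ∧ P.arcEnd v k = u
  arc_inj : ∀ {v k k'}, v < P.n → k < P.deg v → k' < P.deg v → P.arcEdge v k = P.arcEdge v k' →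
    k = k'

/-- The parameters describe the graph `G` and the set `A₀`, and the maximal level is large
enough. -/
structure Params.Fits (P : Params) (G : Graph ℕ ℕ) (A₀ : Finset ℕ) (L : ℕ) : Prop
    extends P.Represents G where
  lt_n : ∀ {v}, v ∈ A₀ → v < P.n
  c_pos : 0 < P.c
  D_eq : P.D = 8 * P.c
  h_eq : P.h = P.D * L + 2
  vol_lt : ∑ v ∈ A₀, P.deg v < 2 ^ L

open Classical in
/-- The flow over the edge `e` into the vertex `v`. -/
noncomputable def netFlow (G : Graph ℕ ℕ) (X H : ℕ → ℕ) (e v : ℕ) : ℤ :=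
  if G.Inc e v then if H e = v then X e else -X e else 0

/-- Self-loops carry no flow by `head`. Conservation is required only inside the current set: the
mass of a removed vertex stays frozen although flow may later be sent out of it, and such units
count as new. -/
structure FlowInv (G : Graph ℕ ℕ) (P : Params) (s : State) : Prop where
  cap : ∀ e, s.X e ≤ P.c
  head : ∀ e, s.X e ≠ 0 → ∃ u, u ≠ s.H e ∧ G.IsLink e u (s.H e)
  cons : ∀ v ∈ s.A, (s.mass v : ℤ) = ∑ e ∈ Finset.range P.m, netFlow G s.X s.H e v

/-- In `valid` the tail `u` may lie outside the current set; growing a cut uses this for its removed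
vertices. By `cursor`, the arcs before the pointer are not admissible. By `full`, a vertex that was
ever relabeled or scanned holds at least its degree, which bounds both the removed volume and the
work. -/
structure LabelInv (G : Graph ℕ ℕ) (P : Params) (A₀ : Finset ℕ) (s : State) : Prop where
  full : ∀ v, 0 < s.lev v ∨ 0 < s.ptr v → 0 < P.deg v ∧ P.deg v ≤ s.mass v
  valid : ∀ e u v, G.IsLink e u v → v ∈ s.A → ¬ s.Sat P e v → s.lev u ≤ s.lev v + 1
  cursor : ∀ v ∈ s.A, ∀ i < s.ptr v, P.arcEnd v i ∈ s.A →
    ¬ s.Sat P (P.arcEdge v i) (P.arcEnd v i) → s.lev v ≤ s.lev (P.arcEnd v i)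
  lev_le : ∀ v, s.lev v ≤ P.h
  ptr_le : ∀ v, s.ptr v ≤ P.deg v
  supp : ∀ v, v ∉ A₀ → s.mass v = 0
  sub : s.A ⊆ A₀
  removed : ∀ v ∈ A₀, v ∉ s.A → P.deg v ≤ s.mass v
  load : ∀ v ∈ s.A, s.mode = 2 ∧ v = s.cur ∨ s.mass v ≤ P.deg v
  active : s.mode = 2 → s.cur ∈ s.A ∧ s.mass s.cur ≤ P.deg s.cur + 1

/-- The number of units that have entered. -/
def total (A₀ : Finset ℕ) (mass : ℕ → ℕ) : ℕ := ∑ v ∈ A₀, mass v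

/-- The volume of the vertices that have been removed. -/
def removedVol (P : Params) (A₀ A : Finset ℕ) : ℕ := ∑ v ∈ A₀ \ A, P.deg v

/-- The number of units that may still enter through the queue. -/
noncomputable def pending (G : Graph ℕ ℕ) (P : Params) (s : State) : ℤ :=
  ∑ i ∈ Finset.Ico s.qi s.qlen,
    if s.qv i ∈ s.A then (P.c - netFlow G s.X s.H (s.qe i) (s.qv i) : ℤ) else 0

/-- An edge that leaves the current set is saturated inwards, still queued, or still to be scanned
in the cut being grown. In `supply` and `length`, the volume of the unfinished cut is subtracted
from the removed volume: it becomes available only at the commit, to pay for the new sources. -/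
structure QueueInv (G : Graph ℕ ℕ) (P : Params) (A₀ : Finset ℕ) (N : ℕ) (s : State) : Prop where
  link : ∀ i < s.qlen + s.z, ∃ u, u ∉ s.A ∧ G.IsLink (s.qe i) (s.qv i) u
  boundary : ∀ e v u, G.IsLink e v u → v ∈ s.A → u ∉ s.A → s.Sat P e v ∨
    (∃ i, s.qi ≤ i ∧ i < s.qlen + s.z ∧ s.qe i = e ∧ s.qv i = v) ∨
    ∃ i k, (s.lo < i ∨ i = s.lo ∧ s.k ≤ k) ∧ i < s.ln ∧ k < P.deg (s.lst i) ∧ s.lst i = u ∧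
      P.arcEdge u k = e
  supply : 4 * ((total A₀ s.mass : ℤ) + pending G P s) + s.vol ≤
    4 * (P.c * N : ℤ) + removedVol P A₀ s.A
  length : 8 * P.c * s.qlen + s.vol ≤ 8 * P.c * N + removedVol P A₀ s.A
  qi_le : s.qi ≤ s.qlen
  done : s.mode = 0 → s.qi = s.qlen

structure State.Idle (s : State) : Prop where
  lo : s.lo = 0
  le : s.le = 0
  ln : s.ln = 0
  k : s.k = 0
  z : s.z = 0
  j : s.j = 0
  vol : s.vol = 0

/-- Entries `qlen` to `qlen + z - 1` of the queue hold the arcs found from the scanned layer, not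
yet committed. The vertices in positions `le` to `ln - 1` are the layer being built. The ghost
variable `dep` counts layers: levels drop by at most one per layer, and by `growth` the volume is at
least `(1 + 1/D) ^ dep`. -/
structure ScanInv (P : Params) (A₀ : Finset ℕ) (s : State) : Prop where
  mem : ∀ i < s.ln, s.lst i ∈ A₀ ∧ s.lst i ∉ s.A
  inj : ∀ i < s.ln, ∀ i' < s.ln, s.lst i = s.lst i' → i = i'
  vol_eq : s.vol = ∑ i ∈ Finset.range s.ln, P.deg (s.lst i)
  lo_le : s.lo ≤ s.le
  le_ln : s.le ≤ s.ln
  k_le : s.lo < s.ln → s.k ≤ P.deg (s.lst s.lo)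
  k_zero : s.lo = s.le → s.k = 0
  scanning : s.mode = 3 → s.le = s.ln ∧ s.j = 0
  growing : s.mode = 4 → s.lo = s.le ∧ ∑ i ∈ Finset.range s.le, P.deg (s.lst i) < s.z * P.D
  j_le : s.j ≤ s.z
  absorbed : ∀ i < s.j, ∃ i', s.le ≤ i' ∧ i' < s.ln ∧ s.lst i' = s.qv (s.qlen + i)
  found_inj : ∀ i < s.z, ∀ i' < s.z, s.qe (s.qlen + i) = s.qe (s.qlen + i') → i = i'
  found_arc : ∀ i < s.z, ∃ i' k, (i' < s.lo ∨ i' = s.lo ∧ k < s.k) ∧ i' < s.ln ∧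
    k < P.deg (s.lst i') ∧ P.arcEdge (s.lst i') k = s.qe (s.qlen + i) ∧
    P.arcEnd (s.lst i') k = s.qv (s.qlen + i)
  lev_old : ∀ i < s.le, P.h ≤ s.lev (s.lst i) + s.dep
  lev_new : ∀ i < s.ln, P.h ≤ s.lev (s.lst i) + s.dep + 1
  lev_found : ∀ i < s.z, P.h ≤ s.lev (s.qv (s.qlen + i)) + s.dep + 1
  growth : (P.D + 1) ^ s.dep ≤ (∑ i ∈ Finset.range s.le, P.deg (s.lst i)) * P.D ^ s.dep
  found_mem : ∀ i < s.z, s.qv (s.qlen + i) ∈ s.A ∨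
    ∃ i', s.le ≤ i' ∧ i' < s.ln ∧ s.lst i' = s.qv (s.qlen + i)

/-- Needed only to bound the words in memory. -/
structure RangeInv (P : Params) (s : State) : Prop where
  qe : ∀ i, s.qe i ≤ P.m
  qv : ∀ i, s.qv i ≤ P.n
  H : ∀ e, s.H e ≤ P.n
  lst : ∀ i, s.lst i ≤ P.n
  cur : s.cur ≤ P.n
  mode : s.mode ≤ 4

structure Inv (G : Graph ℕ ℕ) (P : Params) (A₀ : Finset ℕ) (N : ℕ) (s : State) : Prop where
  flow : FlowInv G P s
  label : LabelInv G P A₀ s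
  queue : QueueInv G P A₀ N s
  range : RangeInv P s
  idle : s.mode ≤ 2 → s.Idle
  scan : 2 < s.mode → ScanInv P A₀ s

/-! ### Sending one unit over an edge -/

section Push

variable {G : Graph ℕ ℕ} {P : Params} {A₀ : Finset ℕ} {N L : ℕ} {s : State}

theorem FlowInv.netFlow_le (hf : FlowInv G P s) (e v : ℕ) : netFlow G s.X s.H e v ≤ P.c := by
  have := hf.cap e
  rw [netFlow]
  split_ifs <;> omega

theorem FlowInv.neg_le_netFlow (hf : FlowInv G P s) (e v : ℕ) :
    -(P.c : ℤ) ≤ netFlow G s.X s.H e v := by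
  have := hf.cap e
  rw [netFlow]
  split_ifs <;> omega

/-- All that later arguments need about a push from `w` to `u`: the net flow moves by one unit, and
saturation can be lost only in the opposite direction, into `w`. If `e` carried flow into `w`, one
unit is cancelled; otherwise one is added. -/
theorem exists_push_eq (hc0 : 0 < P.c) (hf : FlowInv G P s) {e w u : ℕ} (hl : G.IsLink e w u) (hne : w ≠ u)
    (hs : ¬ s.Sat P e u) : ∃ X H, s.push e u = { s with X := X, H := H } ∧ (∀ e, X e ≤ P.c) ∧
      (∀ e, X e ≠ 0 → ∃ u, u ≠ H e ∧ G.IsLink e u (H e)) ∧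
      (∀ e' v, netFlow G X H e' v = netFlow G s.X s.H e' v +
        if e' = e then if v = u then 1 else if v = w then -1 else 0 else 0) ∧
      (∀ e' v, s.Sat P e' v → X e' = P.c ∧ H e' = v ∨ e' = e ∧ v = w) ∧
      (∀ i, H i = s.H i ∨ H i = u) := by
  have hcap := hf.cap e
  have hinc (v : ℕ) : G.Inc e v ↔ v = u ∨ v = w := by
    constructor
    · intro h
      exact (h.eq_or_eq_of_isLink hl).symm
    · rintro (rfl | rfl)
      exacts [hl.inc_right, hl.inc_left]
  have hH : s.X e ≠ 0 → s.H e = u ∨ s.H e = w := fun h0 => by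
    obtain ⟨y, -, hy⟩ := hf.head e h0
    exact (hinc _).1 hy.inc_right
  rw [State.push]
  split_ifs with hc
  · have hX : s.X e < P.c := by
      rcases hc with h0 | h0
      · omega
      · exact lt_of_le_of_ne hcap fun h => hs ⟨h, h0⟩
    refine ⟨_, _, rfl, fun e' => ?_, fun e' h => ?_, fun e' v => ?_, fun e' v hsat => ?_, fun i => ?_⟩
    · by_cases he : e' = e
      · subst he; simpa using hX
      · simpa [he] using hf.cap e'
    · by_cases he : e' = e
      · subst he; simpa using ⟨w, hne, hl⟩
      · simp only [Function.update_of_ne he] at h ⊢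
        exact hf.head e' h
    · by_cases he : e' = e
      · subst he
        simp only [netFlow, Function.update_self, hinc, if_true]
        by_cases h1 : v = u
        · subst h1
          rcases hc with h0 | h0 <;> simp [h0]
        · by_cases h2 : v = w
          · subst h2
            rcases hc with h0 | h0 <;> simp [h0, hne, hne.symm]
            omega
          · simp [h1, h2]
      · simp [netFlow, he]
    · by_cases he : e' = e
      · subst he
        rcases hc with h0 | h0
        · exact absurd hsat.1 (by omega)
        · exact absurd hsat.1 (by omega)
      · simp only [Function.update_of_ne he]
        exact .inl hsat
    · by_cases he : i = e
      · subst he; simp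
      · simp [he]
  · push Not at hc
    have hw : s.H e = w := (hH hc.1).resolve_left hc.2
    refine ⟨_, _, rfl, fun e' => ?_, fun e' h => ?_, fun e' v => ?_, fun e' v hsat => ?_, fun i => .inl rfl⟩
    · by_cases he : e' = e
      · subst he; simp only [Function.update_self]; omega
      · simpa [he] using hf.cap e'
    · by_cases he : e' = e
      · subst he; exact hf.head e' hc.1
      · simp only [Function.update_of_ne he] at h ⊢
        exact hf.head e' h
    · by_cases he : e' = e
      · subst he
        have h0 := hc.1
        simp only [netFlow, Function.update_self, hinc, if_true, hw]
        by_cases h1 : v = u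
        · subst h1
          simp [hne]
          omega
        · by_cases h2 : v = w
          · subst h2
            simp [hne]
            omega
          · simp [h1, h2]
      · simp [netFlow, he]
    · by_cases he : e' = e
      · subst he
        exact .inr ⟨rfl, hsat.2 ▸ hw⟩
      · simp only [Function.update_of_ne he]
        exact .inl hsat

end Push

end Trimming

/-! ### Preservation of the invariants: sources, relabeling, and arc pointers -/

namespace Trimming

open WordRAM

section Transitions

variable {G : Graph ℕ ℕ} {P : Params} {A₀ : Finset ℕ} {N L : ℕ} {s : State}

theorem removedVol_erase {A : Finset ℕ} (hA : A ⊆ A₀) {u : ℕ} (hu : u ∈ A) :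
    removedVol P A₀ (A.erase u) = removedVol P A₀ A + P.deg u := by
  rw [removedVol, removedVol, Finset.sdiff_erase (hA hu), Finset.sum_insert (by simp [hu]),
    add_comm]

theorem FlowInv.pending_term_nonneg (hf : FlowInv G P s) (i : ℕ) :
    0 ≤ if s.qv i ∈ s.A then (P.c - netFlow G s.X s.H (s.qe i) (s.qv i) : ℤ) else 0 := by
  have := hf.netFlow_le (s.qe i) (s.qv i)
  split_ifs <;> omega

theorem Params.Fits.mem_lt (hP : P.Fits G A₀ L) (h : LabelInv G P A₀ s) {v : ℕ} (hv : v ∈ s.A) :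
    v < P.n := hP.lt_n (h.sub hv)

theorem Inv.finish (h : Inv G P A₀ N s) (hm : s.mode = 1) (hq : s.qi = s.qlen) :
    Inv G P A₀ N { s with mode := 0 } := by
  have hl := h.label
  have hi := h.idle (by omega)
  refine ⟨⟨h.flow.1, h.flow.2, h.flow.3⟩, ⟨hl.full, hl.valid, hl.cursor, hl.lev_le, hl.ptr_le,
    hl.supp, hl.sub, hl.removed, fun v hv => ?_, fun h => by simp at h⟩,
    ⟨h.queue.1, h.queue.2, h.queue.3, h.queue.4, h.queue.5, fun _ => hq⟩,
    ⟨h.range.1, h.range.2, h.range.3, h.range.4, h.range.5, by simp⟩,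
    fun _ => ⟨hi.1, hi.2, hi.3, hi.4, hi.5, hi.6, hi.7⟩, fun h => by simp at h⟩
  have := hl.load v hv
  right
  rcases this with h | h
  · omega
  · exact h

theorem Inv.settle (h : Inv G P A₀ N s) (hm : s.mode = 2) (hc : s.mass s.cur ≤ P.deg s.cur) :
    Inv G P A₀ N { s with mode := 1 } := by
  have hl := h.label
  have hi := h.idle (by omega)
  refine ⟨⟨h.flow.1, h.flow.2, h.flow.3⟩, ⟨hl.full, hl.valid, hl.cursor, hl.lev_le, hl.ptr_le,
    hl.supp, hl.sub, hl.removed, fun v hv => ?_, fun h => by simp at h⟩,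
    ⟨h.queue.1, h.queue.2, h.queue.3, h.queue.4, h.queue.5, fun h => by simp at h⟩,
    ⟨h.range.1, h.range.2, h.range.3, h.range.4, h.range.5, by simp⟩,
    fun _ => ⟨hi.1, hi.2, hi.3, hi.4, hi.5, hi.6, hi.7⟩, fun h => by simp at h⟩
  right
  rcases hl.load v hv with h | h
  · rw [h.2]; exact hc
  · exact h

/-- A skipped source has either lost its end from the current set or is saturated, so no unsaturated
boundary edge loses its entry. -/
theorem Inv.skip (h : Inv G P A₀ N s) (hm : s.mode = 1) (hq : s.qi ≠ s.qlen)
    (hs : ¬ (s.qv s.qi ∈ s.A ∧ ¬ s.Sat P (s.qe s.qi) (s.qv s.qi))) :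
    Inv G P A₀ N { s with qi := s.qi + 1 } := by
  have hl := h.label
  have hi := h.idle (by omega)
  have hqi := h.queue.qi_le
  refine ⟨⟨h.flow.1, h.flow.2, h.flow.3⟩, ⟨hl.full, hl.valid, hl.cursor, hl.lev_le, hl.ptr_le,
    hl.supp, hl.sub, hl.removed, hl.load, hl.active⟩,
    ⟨h.queue.1, fun e v u hlk hv hu => ?_, ?_, h.queue.4, ?_, ?_⟩,
    ⟨h.range.1, h.range.2, h.range.3, h.range.4, h.range.5, h.range.6⟩,
    fun _ => ⟨hi.1, hi.2, hi.3, hi.4, hi.5, hi.6, hi.7⟩, fun h => ?_⟩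
  · rcases h.queue.boundary e v u hlk hv hu with h | ⟨i, h₁, h₂, rfl, rfl⟩ | h
    · exact .inl h
    · rcases h₁.eq_or_lt with rfl | h₁
      · left
        by_contra hc
        exact hs ⟨hv, hc⟩
      · exact .inr (.inl ⟨i, h₁, h₂, rfl, rfl⟩)
    · exact .inr (.inr h)
  · have h₁ := h.queue.supply
    have h₂ : pending G P { s with qi := s.qi + 1 } ≤ pending G P s :=
      Finset.sum_le_sum_of_subset_of_nonneg
        (Finset.Ico_subset_Ico_left (Nat.le_succ _)) fun i _ _ => h.flow.pending_term_nonneg i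
    simp only
    omega
  · simp only; omega
  · simp only; omega
  · simp only at h; omega

/-- The unit comes from a vertex `w` outside the current set. Only the arc into `w` can become
residual, and no label condition speaks of arcs into removed vertices. The supply is kept because
one pending unit becomes one unit that has entered. -/
theorem Inv.inject (hP : P.Fits G A₀ L) (h : Inv G P A₀ N s) (hm : s.mode = 1)
    (hq : s.qi ≠ s.qlen) (hv : s.qv s.qi ∈ s.A) (hs : ¬ s.Sat P (s.qe s.qi) (s.qv s.qi)) :
    Inv G P A₀ N (s.inject (s.qe s.qi) (s.qv s.qi)) := by
  have hl := h.label
  have hi := h.idle (by omega)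
  have hqi := h.queue.qi_le
  obtain ⟨w, hw, hlink⟩ := h.queue.link s.qi (by omega)
  have hne : w ≠ s.qv s.qi := fun hc => hw (hc ▸ hv)
  obtain ⟨X, H, hpush, hcap, hhead, hnet, hsat, hH⟩ :=
    exists_push_eq hP.c_pos h.flow hlink.symm hne hs
  have hem : s.qe s.qi < P.m := hP.edge.1 hlink.edge_mem
  have hA (v : ℕ) (hvA : v ∈ s.A) : v ≠ w := fun hc => hw (hc ▸ hvA)
  have hmass (v : ℕ) : s.mass v ≤ Function.update s.mass (s.qv s.qi) (s.mass (s.qv s.qi) + 1) v := by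
    by_cases hvv : v = s.qv s.qi
    · subst hvv; simp
    · simp [hvv]
  rw [State.inject, hpush]
  refine ⟨⟨hcap, hhead, fun v hvA => ?_⟩, ⟨fun v hv' => ?_, fun e u v hlk hvA hns => ?_,
    fun v hvA i hi' hu hns => ?_, hl.lev_le, hl.ptr_le, fun v hvA => ?_, hl.sub, fun v h₁ h₂ => ?_,
    fun v hvA => ?_, fun _ => ⟨hv, ?_⟩⟩,
    ⟨h.queue.1, fun e v u hlk hvA hu => ?_, ?_, ?_, hqi, fun h => by simp at h⟩,
    ⟨h.range.1, h.range.2, fun i => ?_, h.range.4, h.range.2 _, by simp⟩,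
    fun _ => ⟨hi.1, hi.2, hi.3, hi.4, hi.5, hi.6, hi.7⟩, fun h => by simp at h⟩
  · have h₁ := h.flow.cons v hvA
    simp only [hnet, Finset.sum_add_distrib, Finset.sum_ite_eq', Finset.mem_range, hem, if_true,
      if_neg (hA v hvA)]
    rw [← h₁]
    by_cases hvv : v = s.qv s.qi
    · subst hvv; simp
    · simp [hvv]
  · exact ⟨(hl.full v hv').1, (hl.full v hv').2.trans (hmass v)⟩
  · refine hl.valid e u v hlk hvA fun hc => ?_
    rcases hsat e v hc with h | ⟨-, h⟩
    exacts [hns h, hA v hvA h]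
  · refine hl.cursor v hvA i hi' hu fun hc => ?_
    rcases hsat _ _ hc with h | ⟨-, h⟩
    exacts [hns h, hA _ hu h]
  · have : v ≠ s.qv s.qi := fun hc => hvA (hl.sub (hc ▸ hv))
    simpa [this] using hl.supp v hvA
  · exact (hl.removed v h₁ h₂).trans (hmass v)
  · by_cases hvv : v = s.qv s.qi
    · exact .inl ⟨rfl, hvv⟩
    · rcases hl.load v hvA with h | h
      · omega
      · exact .inr (by simpa [hvv] using h)
  · rcases hl.load _ hv with h | h
    · omega
    · simpa using h
  · rcases h.queue.boundary e v u hlk hvA hu with h | h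
    · refine .inl ((hsat e v h).resolve_right fun h => hA v hvA h.2)
    · exact .inr h
  · have h₁ := h.queue.supply
    have ht : total A₀ (Function.update s.mass (s.qv s.qi) (s.mass (s.qv s.qi) + 1)) =
        total A₀ s.mass + 1 := by
      rw [total, total, Finset.sum_update_of_mem (hl.sub hv),
        ← Finset.add_sum_erase _ _ (hl.sub hv), Finset.sdiff_singleton_eq_erase]
      omega
    have hp : pending G P { s with X := X, H := H } + 1 ≤ pending G P s := by
      have hmem : s.qi ∈ Finset.Ico s.qi s.qlen := Finset.mem_Ico.2 ⟨le_rfl, by omega⟩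
      rw [pending, pending, ← Finset.add_sum_erase _ _ hmem,
        ← Finset.add_sum_erase _ _ hmem, add_right_comm]
      -- The entry `qi` loses exactly one unit. Other entries with the same edge can only lose
      -- units, since their end in the current set differs from `w`.
      refine add_le_add ?_ (Finset.sum_le_sum fun i _ => ?_)
      · simp [hv, hnet]
      · simp only [hnet]
        split_ifs with h₁ h₂ h₃ h₄ <;> first | omega | exact absurd h₄ (hA _ h₁)
    have hp' : pending G P { s with X := X, H := H } = pending G P
      { s with
        X := X, H := H
        mass := Function.update s.mass (s.qv s.qi) (s.mass (s.qv s.qi) + 1)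
        cur := s.qv s.qi, mode := 2 } := rfl
    rw [← hp']
    simp only [ht]
    push_cast
    omega
  · exact h.queue.length
  · rcases hH i with h' | h' <;> simp only [h']
    exacts [h.range.3 i, h.range.2 _]

/-- A positive net inflow needs an incident edge. -/
theorem Inv.deg_pos (hP : P.Fits G A₀ L) (h : Inv G P A₀ N s) {v : ℕ} (hv : v ∈ s.A)
    (h0 : 0 < s.mass v) : 0 < P.deg v := by
  have h₁ := h.flow.cons v hv
  obtain ⟨e, -, he⟩ : ∃ e ∈ Finset.range P.m, netFlow G s.X s.H e v ≠ 0 := by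
    apply Finset.exists_ne_zero_of_sum_ne_zero
    omega
  rw [netFlow] at he
  obtain ⟨u, hu⟩ : G.Inc e v := by
    by_contra hc
    simp [hc] at he
  obtain ⟨k, hk, -⟩ := hP.exists_arc hu
  omega

/-- The pointer has passed all arcs, so by `cursor` no residual arc of the vertex descends, and one
more level keeps the labeling valid. Raising the head of an arc never hurts `valid` or `cursor`. -/
theorem Inv.relabel (hP : P.Fits G A₀ L) (h : Inv G P A₀ N s) (hm : s.mode = 2)
    (hc : P.deg s.cur < s.mass s.cur) (hlev : s.lev s.cur ≠ P.h)
    (hp : s.ptr s.cur = P.deg s.cur) : Inv G P A₀ N s.relabel := by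
  have hl := h.label
  have hi := h.idle (by omega)
  have hcA := (hl.active hm).1
  have hlev' : s.lev s.cur < P.h := lt_of_le_of_ne (hl.lev_le _) hlev
  have hmono (v : ℕ) : s.lev v ≤ Function.update s.lev s.cur (s.lev s.cur + 1) v := by
    by_cases hv : v = s.cur
    · subst hv; simp
    · simp [hv]
  refine ⟨⟨h.flow.1, h.flow.2, h.flow.3⟩, ⟨fun v hv => ?_, fun e u v hlk hvA hns => ?_,
    fun v hvA i hi' hu hns => ?_, fun v => ?_, fun v => ?_, hl.supp, hl.sub, hl.removed, hl.load,
    hl.active⟩, ⟨h.queue.1, h.queue.2, h.queue.3, h.queue.4, h.queue.5, h.queue.6⟩,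
    ⟨h.range.1, h.range.2, h.range.3, h.range.4, h.range.5, h.range.6⟩,
    fun _ => ⟨hi.1, hi.2, hi.3, hi.4, hi.5, hi.6, hi.7⟩, fun h' => by
      change 2 < s.mode at h'; omega⟩
  · by_cases hvc : v = s.cur
    · subst hvc
      exact ⟨h.deg_pos hP hcA (by omega), hc.le⟩
    · exact hl.full v (by simpa [State.relabel, hvc] using hv)
  · have hval := hl.valid e u v hlk hvA hns
    have hmv := hmono v
    simp only [State.relabel]
    by_cases huc : u = s.cur
    · subst huc
      rw [Function.update_self]
      obtain ⟨k, hk, rfl, rfl⟩ := hP.exists_arc hlk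
      have := hl.cursor _ hcA k (by omega) hvA hns
      omega
    · rw [Function.update_of_ne huc]
      omega
  · by_cases hvc : v = s.cur
    · subst hvc
      simp [State.relabel] at hi'
    · simp only [State.relabel, Function.update_of_ne hvc] at hi' ⊢
      exact (hl.cursor v hvA i hi' hu hns).trans (hmono _)
  · simp only [State.relabel, Function.update_apply]
    split_ifs
    exacts [hlev', hl.lev_le v]
  · simp only [State.relabel, Function.update_apply]
    split_ifs
    exacts [Nat.zero_le _, hl.ptr_le v]

theorem Inv.advance (hP : P.Fits G A₀ L) (h : Inv G P A₀ N s) (hm : s.mode = 2)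
    (hc : P.deg s.cur < s.mass s.cur) (hp : s.ptr s.cur ≠ P.deg s.cur)
    (hadm : ¬ ((P.arcEnd s.cur (s.ptr s.cur) ∈ s.A ∧
        ¬ s.Sat P (P.arcEdge s.cur (s.ptr s.cur)) (P.arcEnd s.cur (s.ptr s.cur))) ∧
        s.lev s.cur = s.lev (P.arcEnd s.cur (s.ptr s.cur)) + 1)) : Inv G P A₀ N s.advance := by
  have hl := h.label
  have hi := h.idle (by omega)
  have hcA := (hl.active hm).1
  have hp' : s.ptr s.cur < P.deg s.cur := lt_of_le_of_ne (hl.ptr_le _) hp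
  refine ⟨⟨h.flow.1, h.flow.2, h.flow.3⟩, ⟨fun v hv => ?_, hl.valid,
    fun v hvA i hi' hu hns => ?_, hl.lev_le, fun v => ?_, hl.supp, hl.sub, hl.removed, hl.load,
    hl.active⟩, ⟨h.queue.1, h.queue.2, h.queue.3, h.queue.4, h.queue.5, h.queue.6⟩,
    ⟨h.range.1, h.range.2, h.range.3, h.range.4, h.range.5, h.range.6⟩,
    fun _ => ⟨hi.1, hi.2, hi.3, hi.4, hi.5, hi.6, hi.7⟩, fun h' => by
      change 2 < s.mode at h'; omega⟩
  · by_cases hvc : v = s.cur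
    · subst hvc
      exact ⟨by omega, hc.le⟩
    · exact hl.full v (by simpa [State.advance, hvc] using hv)
  · change P.arcEnd v i ∈ s.A at hu
    change ¬ s.Sat P _ _ at hns
    change s.lev v ≤ s.lev (P.arcEnd v i)
    by_cases hvc : v = s.cur
    · subst hvc
      simp only [State.advance, Function.update_self] at hi'
      rcases Nat.lt_succ_iff_lt_or_eq.1 hi' with hi' | rfl
      · exact hl.cursor _ hvA i hi' hu hns
      -- Validity bounds the descent by one, and the arc is not admissible, so it does not descend.
      · have hval := hl.valid _ _ _ (hP.arc_link (hP.mem_lt hl hcA) hp') hu hns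
        by_contra hcon
        exact hadm ⟨⟨hu, hns⟩, by omega⟩
    · simp only [State.advance, Function.update_of_ne hvc] at hi'
      exact hl.cursor v hvA i hi' hu hns
  · simp only [State.advance, Function.update_apply]
    split_ifs with hvc
    · subst hvc; exact hp'
    · exact hl.ptr_le v

end Transitions

end Trimming

/-! ### Preservation of the invariants: moving a unit, starting and committing a cut -/

namespace Trimming

open WordRAM

section Transitions

variable {G : Graph ℕ ℕ} {P : Params} {A₀ : Finset ℕ} {N L : ℕ} {s : State}

theorem total_move {mass : ℕ → ℕ} {w u : ℕ} (hw : w ∈ A₀) (hu : u ∈ A₀) (hne : u ≠ w)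
    (h0 : 0 < mass w) :
    total A₀ (Function.update (Function.update mass w (mass w - 1)) u
      (Function.update mass w (mass w - 1) u + 1)) = total A₀ mass := by
  have hw' : w ∈ A₀.erase u := Finset.mem_erase.2 ⟨hne.symm, hw⟩
  rw [total, total, ← Finset.add_sum_erase _ _ hu, ← Finset.add_sum_erase _ mass hu,
    ← Finset.add_sum_erase _ _ hw', ← Finset.add_sum_erase _ mass hw']
  rw [Finset.sum_congr (g := mass) rfl fun v hv => ?_]
  · simp only [Function.update_self, Function.update_of_ne hne, Function.update_of_ne hne.symm]
    change _ + (_ + Finset.sum _ mass) = _ + (_ + Finset.sum _ mass)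
    omega
  · simp only [Finset.mem_erase] at hv
    rw [Function.update_of_ne hv.2.1, Function.update_of_ne hv.1]

/-- The only arc that can become residual leads from `u` back up to the old position, so it respects
the labels. The edge has both ends in the current set, hence is not in the queue, and the pending
units are unchanged. -/
theorem Inv.move (hP : P.Fits G A₀ L) (h : Inv G P A₀ N s) (hm : s.mode = 2)
    (hc : P.deg s.cur < s.mass s.cur) {e u : ℕ} (hlink : G.IsLink e s.cur u)
    (hu : u ∈ s.A) (hs : ¬ s.Sat P e u) (hlev : s.lev s.cur = s.lev u + 1) :
    Inv G P A₀ N (s.move e u) := by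
  have hl := h.label
  have hi := h.idle (by omega)
  obtain ⟨hcA, hcm⟩ := hl.active hm
  have hne : s.cur ≠ u := fun hcu => by rw [← hcu] at hlev; omega
  obtain ⟨X, H, hpush, hcap, hhead, hnet, hsat, hH⟩ :=
    exists_push_eq hP.c_pos h.flow hlink hne hs
  have hem : e < P.m := hP.edge.1 hlink.edge_mem
  obtain ⟨mass, hmass⟩ : ∃ mass, mass = Function.update (Function.update s.mass s.cur
    (s.mass s.cur - 1)) u (Function.update s.mass s.cur (s.mass s.cur - 1) u + 1) := ⟨_, rfl⟩
  have hmc : mass s.cur = s.mass s.cur - 1 := by simp [hmass, hne]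
  have hmu : mass u = s.mass u + 1 := by simp [hmass, hne.symm]
  have hmo (v : ℕ) (h₁ : v ≠ s.cur) (h₂ : v ≠ u) : mass v = s.mass v := by simp [hmass, h₁, h₂]
  have hdeg (v : ℕ) (hv : P.deg v ≤ s.mass v) : P.deg v ≤ mass v := by
    by_cases h₁ : v = s.cur
    · subst h₁; omega
    · by_cases h₂ : v = u
      · subst h₂; omega
      · rwa [hmo v h₁ h₂]
  have ht : total A₀ mass = total A₀ s.mass := by
    rw [hmass, total_move (hl.sub hcA) (hl.sub hu) hne.symm (by omega)]
  rw [State.move, hpush, ← hmass]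
  clear hmass
  refine ⟨⟨hcap, hhead, fun v hvA => ?_⟩, ⟨fun v hv' => ?_, fun e' u' v hlk hvA hns => ?_,
    fun v hvA i hi' hu' hns => ?_, hl.lev_le, hl.ptr_le, fun v hvA => ?_, hl.sub,
    fun v h₁ h₂ => hdeg v (hl.removed v h₁ h₂), fun v hvA => ?_, fun _ => ⟨hu, ?_⟩⟩,
    ⟨h.queue.1, fun e' v u' hlk hvA hu' => ?_, ?_, h.queue.4, h.queue.5, h.queue.6⟩,
    ⟨h.range.1, h.range.2, fun i => ?_, h.range.4, (hP.mem_lt hl hu).le, h.range.6⟩,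
    fun _ => ⟨hi.1, hi.2, hi.3, hi.4, hi.5, hi.6, hi.7⟩, fun h' => by
      change 2 < s.mode at h'; omega⟩
  · have h₁ := h.flow.cons v hvA
    simp only [hnet, Finset.sum_add_distrib, Finset.sum_ite_eq', Finset.mem_range, hem, if_true]
    rw [← h₁]
    split_ifs with h₂ h₃
    · subst h₂; omega
    · subst h₃; omega
    · rw [hmo v h₃ h₂]; simp
  · exact ⟨(hl.full v hv').1, hdeg v (hl.full v hv').2⟩
  · by_cases hns' : s.Sat P e' v
    · rcases hsat e' v hns' with h' | ⟨rfl, rfl⟩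
      · exact absurd h' hns
      · rw [hlk.symm.right_unique hlink]
        change s.lev u ≤ s.lev s.cur + 1
        omega
    · exact hl.valid e' u' v hlk hvA hns'
  · by_cases hns' : s.Sat P (P.arcEdge v i) (P.arcEnd v i)
    · rcases hsat _ _ hns' with h' | ⟨h₁, h₂⟩
      · exact absurd h' hns
      · have hlk := hP.arc_link (hP.mem_lt hl hvA) (hi'.trans_le (hl.ptr_le v))
        rw [h₁, h₂] at hlk
        rw [h₂, hlk.symm.right_unique hlink]
        change s.lev u ≤ s.lev s.cur
        omega
    · exact hl.cursor v hvA i hi' hu' hns'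
  · have h₁ : v ≠ s.cur := fun h' => hvA (h' ▸ hl.sub hcA)
    have h₂ : v ≠ u := fun h' => hvA (h' ▸ hl.sub hu)
    exact (hmo v h₁ h₂).trans (hl.supp v hvA)
  · by_cases h₂ : v = u
    · exact .inl ⟨hm, h₂⟩
    · right
      by_cases h₁ : v = s.cur
      · subst h₁
        simp only [hmc]
        omega
      · simp only [hmo v h₁ h₂]
        exact (hl.load v hvA).resolve_left fun h' => h₁ h'.2
  · simp only [hmu]
    have := (hl.load u hu).resolve_left fun h' => hne h'.2.symm
    omega
  · rcases h.queue.boundary e' v u' hlk hvA hu' with h' | h'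
    · rcases hsat e' v h' with h' | ⟨rfl, rfl⟩
      · exact .inl h'
      · exact absurd hu (hlk.right_unique hlink ▸ hu')
    · exact .inr h'
  · have h₁ := h.queue.supply
    have hp : pending G P { s with X := X, H := H } = pending G P s := by
      refine Finset.sum_congr rfl fun i hi' => ?_
      rw [Finset.mem_Ico] at hi'
      obtain ⟨w, hw, hlk⟩ := h.queue.link i (by omega)
      have hqe : s.qe i ≠ e := fun hcon => by
        subst hcon
        rcases hlk.symm.left_eq_or_eq hlink with rfl | rfl
        exacts [hw hcA, hw hu]
      simp only [hnet, if_neg hqe, add_zero]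
    have hp' : pending G P { s with X := X, H := H } = pending G P
      { s with X := X, H := H, mass := mass, cur := u } := rfl
    rw [← hp', hp]
    simp only [ht]
    exact h₁
  · rcases hH i with h' | h' <;> simp only [h']
    exacts [h.range.3 i, (hP.mem_lt hl hu).le]

theorem FlowInv.erase (h : FlowInv G P s) (u : ℕ) : FlowInv G P { s with A := s.A.erase u } :=
  ⟨h.1, h.2, fun v hv => h.3 v (Finset.mem_of_mem_erase hv)⟩

theorem LabelInv.erase (h : LabelInv G P A₀ s) {u : ℕ} (hu : P.deg u ≤ s.mass u)
    (hm : s.mode = 2 → s.cur = u) : LabelInv G P A₀ { s with A := s.A.erase u, mode := 3 } := by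
  refine ⟨h.full, fun e w v hlk hv hns => h.valid e w v hlk (Finset.mem_of_mem_erase hv) hns,
    fun v hv i hi hw hns => h.cursor v (Finset.mem_of_mem_erase hv) i hi
      (Finset.mem_of_mem_erase hw) hns, h.lev_le, h.ptr_le, h.supp,
    (Finset.erase_subset _ _).trans h.sub, fun v hv hvA => ?_, fun v hv => ?_,
    fun h => by simp at h⟩
  · by_cases hvu : v = u
    · exact hvu ▸ hu
    · exact h.removed v hv fun hc => hvA (Finset.mem_erase.2 ⟨hvu, hc⟩)
  · obtain ⟨h₁, h₂⟩ := Finset.mem_erase.1 hv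
    exact .inr ((h.load v h₂).resolve_left fun h' => h₁ (h'.2.trans (hm h'.1)))

theorem pending_erase (h : FlowInv G P s) (u : ℕ) :
    pending G P { s with A := s.A.erase u } ≤ pending G P s := by
  refine Finset.sum_le_sum fun i _ => ?_
  have := h.netFlow_le (s.qe i) (s.qv i)
  simp only [Finset.mem_erase]
  split_ifs <;> first | omega | exact absurd (by tauto) ‹¬ s.qv i ∈ s.A›

/-- Removing the vertex raises `vol` and the removed volume by the same amount, so the supply does
not change. New boundary edges are arcs of the vertex still to be scanned. -/
theorem Inv.startCut (hP : P.Fits G A₀ L) (h : Inv G P A₀ N s) (hm : s.mode = 2)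
    (hc : P.deg s.cur < s.mass s.cur) (hlev : s.lev s.cur = P.h) :
    Inv G P A₀ N (s.startCut P) := by
  have hl := h.label
  have hi := h.idle (by omega)
  have hcA := (hl.active hm).1
  have hle := hl.erase hc.le fun _ => rfl
  have hz := hi.z
  have hR := removedVol_erase (P := P) hl.sub hcA
  have hv := hi.vol
  refine ⟨⟨h.flow.1, h.flow.2, (h.flow.erase _).3⟩, ⟨hle.1, hle.2, hle.3, hle.4, hle.5, hle.6,
    hle.7, hle.8, hle.9, hle.10⟩, ⟨fun i hi' => ?_, fun e v u hlk hvA hu => ?_, ?_, ?_, h.queue.5,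
    fun h => by simp [State.startCut] at h⟩,
    ⟨h.range.1, h.range.2, h.range.3, fun i => ?_, h.range.5, by simp [State.startCut]⟩,
    fun h => by simp [State.startCut] at h, fun _ => ?_⟩
  · simp only [State.startCut] at hi' ⊢
    obtain ⟨u, hu, hlk⟩ := h.queue.link i (by omega)
    exact ⟨u, fun hc => hu (Finset.mem_of_mem_erase hc), hlk⟩
  · simp only [State.startCut] at hvA hu ⊢
    by_cases huA : u ∈ s.A
    · have huc : u = s.cur := by
        by_contra hne
        exact hu (Finset.mem_erase.2 ⟨hne, huA⟩)
      obtain ⟨k, hk, hk', -⟩ := hP.exists_arc hlk.symm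
      exact .inr (.inr ⟨0, k, by simp, by simp, by simpa [huc] using hk, by simp [huc], hk'⟩)
    · rcases h.queue.boundary e v u hlk (Finset.mem_of_mem_erase hvA) huA with
        h' | ⟨i, h₁, h₂, h₃⟩ | ⟨i, k, h₁, h₂, h₃⟩
      · exact .inl h'
      · exact .inr (.inl ⟨i, h₁, by omega, h₃⟩)
      · have := hi.ln
        omega
  · have h₁ := h.queue.supply
    have h₂ := pending_erase h.flow s.cur
    have h₃ : pending G P (s.startCut P) = pending G P { s with A := s.A.erase s.cur } := rfl
    rw [h₃]
    simp only [State.startCut, hR]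
    push_cast
    omega
  · have h₁ := h.queue.length
    simp only [State.startCut, hR]
    omega
  · simp only [State.startCut, Function.update_apply]
    split_ifs
    exacts [h.range.5, h.range.4 i]
  · have hdeg := h.deg_pos hP hcA (by omega)
    constructor <;> simp only [State.startCut, Nat.lt_one_iff, forall_eq, Function.update_self]
    · exact ⟨hl.sub hcA, by simp⟩
    · simp
    · simp
    · simp
    · simp
    · simp
    · simp
    · simp
    · simp
    · simp
    · simp
    · simp
    · simp
    · omega
    · omega
    · simp
    · simp only [Finset.sum_range_one, Function.update_self, pow_zero, mul_one]
      exact hdeg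
    · simp

theorem Inv.toGrow (h : Inv G P A₀ N s) (hm : s.mode = 3) (hlo : s.lo = s.le)
    (hz : s.vol < s.z * P.D) : Inv G P A₀ N { s with mode := 4 } := by
  have hl := h.label
  have hs := h.scan (by omega)
  refine ⟨⟨h.flow.1, h.flow.2, h.flow.3⟩, ⟨hl.full, hl.valid, hl.cursor, hl.lev_le, hl.ptr_le,
    hl.supp, hl.sub, hl.removed, fun v hv => .inr ((hl.load v hv).resolve_left (by omega)),
    fun h => by simp at h⟩,
    ⟨h.queue.1, h.queue.2, h.queue.3, h.queue.4, h.queue.5, fun h => by simp at h⟩,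
    ⟨h.range.1, h.range.2, h.range.3, h.range.4, h.range.5, by simp⟩,
    fun h => by simp at h, fun _ => ⟨hs.1, hs.2, hs.3, hs.4, hs.5, hs.6, hs.7,
      fun h => by simp at h, fun _ => ⟨hlo, ?_⟩, hs.10, hs.11, hs.12, hs.13, hs.14, hs.15, hs.16,
      hs.17, hs.18⟩⟩
  simp only
  rwa [(hs.scanning hm).1, ← hs.vol_eq]

/-- Each new source adds at most `2c` pending units, as the flow on it is at least `-c`. With the
factor `4` of `supply` this is `8c * z ≤ vol`, exactly what is released when `vol` is reset to `0`.
-/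
theorem Inv.commit (hP : P.Fits G A₀ L) (h : Inv G P A₀ N s) (hm : s.mode = 3)
    (hlo : s.lo = s.le) (hz : s.z * P.D ≤ s.vol) : Inv G P A₀ N s.commit := by
  have hl := h.label
  have hs := h.scan (by omega)
  have hz' : 8 * P.c * s.z ≤ s.vol := by rw [← hP.D_eq, mul_comm]; exact hz
  refine ⟨⟨h.flow.1, h.flow.2, h.flow.3⟩, ⟨hl.full, hl.valid, hl.cursor, hl.lev_le, hl.ptr_le,
    hl.supp, hl.sub, hl.removed, fun v hv => .inr ((hl.load v hv).resolve_left (by omega)),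
    fun h => by simp [State.commit] at h⟩,
    ⟨h.queue.1, fun e v u hlk hv hu => ?_, ?_, ?_, ?_, fun h => by simp [State.commit] at h⟩,
    ⟨h.range.1, h.range.2, h.range.3, h.range.4, h.range.5, by simp [State.commit]⟩,
    fun _ => ⟨rfl, rfl, rfl, rfl, rfl, (hs.scanning hm).2, rfl⟩,
    fun h => by simp [State.commit] at h⟩
  · rcases h.queue.boundary e v u hlk hv hu with h' | h' | ⟨i, k, h₁, h₂, -⟩
    · exact .inl h'
    · exact .inr (.inl h')
    · have := (hs.scanning hm).1
      have := hs.k_zero hlo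
      omega
  · have h₁ := h.queue.supply
    have h₂ : pending G P s.commit ≤ pending G P s + 2 * P.c * s.z := by
      have hsplit := Finset.sum_Ico_consecutive (fun i => if s.qv i ∈ s.A then
        (P.c - netFlow G s.X s.H (s.qe i) (s.qv i) : ℤ) else 0) h.queue.qi_le
        (Nat.le_add_right s.qlen s.z)
      have hnew : ∑ i ∈ Finset.Ico s.qlen (s.qlen + s.z), (if s.qv i ∈ s.A then
          (P.c - netFlow G s.X s.H (s.qe i) (s.qv i) : ℤ) else 0) ≤ s.z * (2 * P.c) := by
        refine (Finset.sum_le_card_nsmul _ _ (2 * P.c : ℤ) fun i _ => ?_).trans (by simp)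
        have := h.flow.neg_le_netFlow (s.qe i) (s.qv i)
        split_ifs <;> omega
      have : pending G P s.commit = _ := hsplit.symm
      rw [this, pending]
      linarith
    have h₃ : (8 * P.c * s.z : ℤ) ≤ s.vol := by exact_mod_cast hz'
    simp only [State.commit] at h₂ ⊢
    push_cast
    linarith
  · have h₁ := h.queue.length
    simp only [State.commit]
    linarith
  · have := h.queue.qi_le
    simp only [State.commit]
    omega

end Transitions

end Trimming

/-! ### Preservation of the invariants: growing a cut, and the bound for its depth -/

namespace Trimming

open WordRAM

section Transitions

variable {G : Graph ℕ ℕ} {P : Params} {A₀ : Finset ℕ} {N L : ℕ} {s : State}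

theorem ScanInv.lo_lt (hs : ScanInv P A₀ s) (hlo : s.lo ≠ s.le) : s.lo < s.ln :=
  (lt_of_le_of_ne hs.lo_le hlo).trans_le hs.le_ln

theorem ScanInv.lst_lt (hP : P.Fits G A₀ L) (hs : ScanInv P A₀ s) {i : ℕ} (hi : i < s.ln) :
    s.lst i < P.n := hP.lt_n (hs.mem i hi).1

theorem LabelInv.of_ne_two (hl : LabelInv G P A₀ s) (hm : s.mode ≠ 2) :
    ∀ v ∈ s.A, s.mass v ≤ P.deg v :=
  fun v hv => (hl.load v hv).resolve_left fun h => hm h.1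

theorem Inv.nextVertex (h : Inv G P A₀ N s) (hm : s.mode = 3)
    (hlo : s.lo ≠ s.le) (hk : s.k = P.deg (s.lst s.lo)) :
    Inv G P A₀ N { s with lo := s.lo + 1, k := 0 } := by
  have hl := h.label
  have hs := h.scan (by omega)
  have hll := hs.lo_le
  refine ⟨⟨h.flow.1, h.flow.2, h.flow.3⟩, ⟨hl.full, hl.valid, hl.cursor, hl.lev_le, hl.ptr_le,
    hl.supp, hl.sub, hl.removed, hl.load, hl.active⟩,
    ⟨h.queue.1, fun e v u hlk hv hu => ?_, h.queue.3, h.queue.4, h.queue.5, h.queue.6⟩,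
    ⟨h.range.1, h.range.2, h.range.3, h.range.4, h.range.5, h.range.6⟩,
    fun h' => by simp only at h'; omega, fun _ => ⟨hs.1, hs.2, hs.3, ?_, hs.5,
      fun _ => Nat.zero_le _, fun _ => rfl, hs.8, fun h' => by simp only at h'; omega, hs.10, hs.11,
      hs.12, fun i hi => ?_, hs.14, hs.15, hs.16, hs.17, hs.18⟩⟩
  · rcases h.queue.boundary e v u hlk hv hu with h' | h' | ⟨i, k, h₁, h₂, h₃, h₄⟩
    · exact .inl h'
    · exact .inr (.inl h')
    · refine .inr (.inr ⟨i, k, ?_, h₂, h₃, h₄⟩)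
      rcases h₁ with h₁ | ⟨rfl, h₁⟩
      · simp only; omega
      · omega
  · simp only; omega
  · obtain ⟨i', k, h₁, h₂⟩ := hs.found_arc i hi
    exact ⟨i', k, by simp only; omega, h₂⟩

/-- If the skipped arc is a boundary edge, its end lies in the current set, so it was skipped
because it is saturated inwards. -/
theorem Inv.nextArc (hP : P.Fits G A₀ L) (h : Inv G P A₀ N s) (hm : s.mode = 3)
    (hlo : s.lo ≠ s.le) (hk : s.k ≠ P.deg (s.lst s.lo))
    (hno : ¬ (P.arcEnd (s.lst s.lo) s.k ∈ s.A ∧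
      ¬ s.Sat P (P.arcEdge (s.lst s.lo) s.k) (P.arcEnd (s.lst s.lo) s.k))) :
    Inv G P A₀ N { s with k := s.k + 1 } := by
  have hl := h.label
  have hs := h.scan (by omega)
  have hll := hs.lo_lt hlo
  have hk' : s.k < P.deg (s.lst s.lo) := lt_of_le_of_ne (hs.k_le hll) hk
  refine ⟨⟨h.flow.1, h.flow.2, h.flow.3⟩, ⟨hl.full, hl.valid, hl.cursor, hl.lev_le, hl.ptr_le,
    hl.supp, hl.sub, hl.removed, hl.load, hl.active⟩,
    ⟨h.queue.1, fun e v u hlk hv hu => ?_, h.queue.3, h.queue.4, h.queue.5, h.queue.6⟩,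
    ⟨h.range.1, h.range.2, h.range.3, h.range.4, h.range.5, h.range.6⟩,
    fun h' => by simp only at h'; omega, fun _ => ⟨hs.1, hs.2, hs.3, hs.4, hs.5,
      fun _ => hk', fun h' => absurd h' hlo, hs.8, fun h' => by simp only at h'; omega, hs.10, hs.11,
      hs.12, fun i hi => ?_, hs.14, hs.15, hs.16, hs.17, hs.18⟩⟩
  · rcases h.queue.boundary e v u hlk hv hu with h' | h' | ⟨i, k, h₁, h₂, h₃, h₄, h₅⟩
    · exact .inl h'
    · exact .inr (.inl h')
    · by_cases hc : i = s.lo ∧ s.k = k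
      · obtain ⟨rfl, rfl⟩ := hc
        have hlk' := hP.arc_link (hs.lst_lt hP hll) hk'
        rw [h₄, h₅] at hlk'
        have hv' := hlk'.right_unique hlk.symm
        left
        by_contra hns
        refine hno ⟨?_, ?_⟩
        · rw [h₄, hv']; exact hv
        · rw [h₄, hv', h₅]; exact hns
      · exact .inr (.inr ⟨i, k, by simp only; omega, h₂, h₃, h₄, h₅⟩)
  · obtain ⟨i', k, h₁, h₂⟩ := hs.found_arc i hi
    exact ⟨i', k, by simp only; omega, h₂⟩

theorem Inv.record (hP : P.Fits G A₀ L) (h : Inv G P A₀ N s) (hm : s.mode = 3)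
    (hlo : s.lo ≠ s.le) (hk : s.k ≠ P.deg (s.lst s.lo)) (huA : P.arcEnd (s.lst s.lo) s.k ∈ s.A)
    (hns : ¬ s.Sat P (P.arcEdge (s.lst s.lo) s.k) (P.arcEnd (s.lst s.lo) s.k)) :
    Inv G P A₀ N (s.record (P.arcEdge (s.lst s.lo) s.k) (P.arcEnd (s.lst s.lo) s.k)) := by
  have hl := h.label
  have hs := h.scan (by omega)
  have hll := hs.lo_lt hlo
  have hk' : s.k < P.deg (s.lst s.lo) := lt_of_le_of_ne (hs.k_le hll) hk
  have hlink := hP.arc_link (hs.lst_lt hP hll) hk'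
  have hout := (hs.mem _ hll).2
  obtain ⟨e, he⟩ : ∃ e, P.arcEdge (s.lst s.lo) s.k = e := ⟨_, rfl⟩
  obtain ⟨u, hu⟩ : ∃ u, P.arcEnd (s.lst s.lo) s.k = u := ⟨_, rfl⟩
  rw [he, hu] at hlink hns
  rw [hu] at huA
  rw [he, hu]
  -- The same edge could only have been found from the same vertex, at an earlier arc, or from its
  -- other end; but that end is still in the current set and hence not listed.
  have hnew (i : ℕ) (hi : i < s.z) : s.qe (s.qlen + i) ≠ e := by
    intro hc
    obtain ⟨i', k, h₁, h₂, h₃, h₄, h₅⟩ := hs.found_arc i hi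
    have hlk := hP.arc_link (hs.lst_lt hP h₂) h₃
    rw [h₄, hc] at hlk
    rcases hlk.left_eq_or_eq hlink with h' | h'
    · have := hs.inj _ h₂ _ hll h'
      subst this
      have := hP.arc_inj (hs.lst_lt hP hll) h₃ hk' (by rw [h₄, hc, he])
      omega
    · exact (hs.mem _ h₂).2 (h' ▸ huA)
  have hqe (i : ℕ) (hi : i < s.qlen + s.z) : Function.update s.qe (s.qlen + s.z) e i = s.qe i :=
    Function.update_of_ne hi.ne _ _
  have hqv (i : ℕ) (hi : i < s.qlen + s.z) : Function.update s.qv (s.qlen + s.z) u i = s.qv i :=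
    Function.update_of_ne hi.ne _ _
  refine ⟨⟨h.flow.1, h.flow.2, h.flow.3⟩, ⟨hl.full, hl.valid, hl.cursor, hl.lev_le, hl.ptr_le,
    hl.supp, hl.sub, hl.removed, hl.load, hl.active⟩,
    ⟨fun i hi => ?_, fun e' v u' hlk hv hu' => ?_, ?_, h.queue.4, h.queue.5, h.queue.6⟩,
    ⟨fun i => ?_, fun i => ?_, h.range.3, h.range.4, h.range.5, h.range.6⟩,
    fun h' => by simp only [State.record] at h'; omega, fun _ => ⟨hs.1, hs.2, hs.3, hs.4, hs.5,
      fun _ => hk', fun h' => absurd h' hlo, hs.8,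
      fun h' => by simp only [State.record] at h'; omega, ?_, fun i hi => ?_, fun i hi i' hi' hii => ?_,
      fun i hi => ?_, hs.14, hs.15, fun i hi => ?_, hs.17, fun i hi => ?_⟩⟩
  · simp only [State.record] at hi ⊢
    by_cases hi' : i = s.qlen + s.z
    · subst hi'
      simp only [Function.update_self]
      exact ⟨_, hout, hlink.symm⟩
    · rw [hqe i (by omega), hqv i (by omega)]
      exact h.queue.link i (by omega)
  · simp only [State.record]
    rcases h.queue.boundary e' v u' hlk hv hu' with h' | ⟨i, h₁, h₂, h₃, h₄⟩ | ⟨i, k, h₁, h₂, h₃, h₄, h₅⟩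
    · exact .inl h'
    · exact .inr (.inl ⟨i, h₁, by omega, by rw [hqe i h₂, h₃], by rw [hqv i h₂, h₄]⟩)
    · by_cases hc : i = s.lo ∧ s.k = k
      · obtain ⟨rfl, rfl⟩ := hc
        rw [h₄, h₅] at he
        subst he
        rw [h₄] at hlink
        refine .inr (.inl ⟨s.qlen + s.z, ?_, by omega, by simp, ?_⟩)
        · have := h.queue.qi_le; omega
        · simpa using hlink.right_unique hlk.symm
      · exact .inr (.inr ⟨i, k, by omega, h₂, h₃, h₄, h₅⟩)
  · have h₁ := h.queue.supply
    have h₂ : pending G P (s.record e u) = pending G P s := by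
      refine Finset.sum_congr rfl fun i hi => ?_
      rw [Finset.mem_Ico] at hi
      have hi' : i < s.qlen + s.z := lt_of_lt_of_le hi.2 (Nat.le_add_right _ _)
      simp only [State.record, hqe i hi', hqv i hi']
    rw [h₂]
    exact h₁
  · simp only [State.record, Function.update_apply]
    split_ifs
    exacts [(hP.edge.1 hlink.edge_mem).le, h.range.1 i]
  · simp only [State.record, Function.update_apply]
    split_ifs
    exacts [(hP.mem_lt hl huA).le, h.range.2 i]
  · have := hs.j_le
    simp only [State.record]; omega
  · simp only [State.record] at hi ⊢
    have := (hs.scanning hm).2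
    omega
  · simp only [State.record] at hi hi' hii
    rcases Nat.lt_succ_iff_lt_or_eq.1 hi with hi | rfl <;>
      rcases Nat.lt_succ_iff_lt_or_eq.1 hi' with hi' | rfl
    · rw [hqe _ (by omega), hqe _ (by omega)] at hii
      exact hs.found_inj i hi i' hi' hii
    · rw [hqe _ (by omega), Function.update_self] at hii
      exact absurd hii (hnew i hi)
    · rw [hqe (s.qlen + i') (by omega), Function.update_self] at hii
      exact absurd hii.symm (hnew i' hi')
    · rfl
  · simp only [State.record] at hi ⊢
    rcases Nat.lt_succ_iff_lt_or_eq.1 hi with hi | rfl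
    · rw [hqe _ (by omega), hqv _ (by omega)]
      obtain ⟨i', k, h₁, h₂⟩ := hs.found_arc i hi
      exact ⟨i', k, by omega, h₂⟩
    · simp only [Function.update_self]
      exact ⟨s.lo, s.k, by omega, hll, hk', he, hu⟩
  · simp only [State.record] at hi ⊢
    rcases Nat.lt_succ_iff_lt_or_eq.1 hi with hi | rfl
    · rw [hqv _ (by omega)]
      exact hs.lev_found i hi
    · rw [Function.update_self]
      -- Validity for an arc whose tail has already been removed: the found end is at most one level
      -- below.
      have h₁ := hl.valid _ _ _ hlink huA hns
      have h₂ := hs.lev_old s.lo (lt_of_le_of_ne hs.lo_le hlo)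
      omega
  · simp only [State.record] at hi ⊢
    rcases Nat.lt_succ_iff_lt_or_eq.1 hi with hi | rfl
    · rw [hqv _ (by omega)]
      exact hs.found_mem i hi
    · exact .inl (by rwa [Function.update_self])

/-- Each residual arc that was found leads to a vertex of the new layer. -/
theorem Inv.found_le (hP : P.Fits G A₀ L) (h : Inv G P A₀ N s) (hm : s.mode = 4)
    (hj : s.j = s.z) : s.z ≤ ∑ i ∈ Finset.Ico s.le s.ln, P.deg (s.lst i) := by
  have hs := h.scan (by omega)
  have key (i : ℕ) (hi : i < s.z) : ∃ i' k, (s.le ≤ i' ∧ i' < s.ln) ∧ k < P.deg (s.lst i') ∧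
      P.arcEdge (s.lst i') k = s.qe (s.qlen + i) := by
    obtain ⟨i', h₁, h₂, h₃⟩ := hs.absorbed i (by omega)
    obtain ⟨u, -, hlk⟩ := h.queue.link (s.qlen + i) (by omega)
    rw [← h₃] at hlk
    obtain ⟨k, hk, hk', -⟩ := hP.exists_arc hlk
    exact ⟨i', k, ⟨h₁, h₂⟩, hk, hk'⟩
  choose! f g h₁ h₂ h₃ using key
  have hcard : ((Finset.Ico s.le s.ln).sigma fun i => Finset.range (P.deg (s.lst i))).card =
      ∑ i ∈ Finset.Ico s.le s.ln, P.deg (s.lst i) := by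
    simp [Finset.card_sigma]
  rw [← hcard]
  conv_lhs => rw [← Finset.card_range s.z]
  -- A found edge is sent to its occurrence in the adjacency list of its end, which lies in the new
  -- layer. Found edges are distinct, so this is injective.
  refine Finset.card_le_card_of_injOn (fun i => ⟨f i, g i⟩) (fun i hi => ?_) fun i hi i' hi' hii => ?_
  · simp only [Finset.coe_range, Set.mem_Iio] at hi
    simp [h₁ i hi, h₂ i hi]
  · simp only [Finset.coe_range, Set.mem_Iio] at hi hi'
    simp only [Sigma.mk.injEq, heq_eq_eq] at hii
    exact hs.found_inj i hi i' hi' (by rw [← h₃ i hi, ← h₃ i' hi', hii.1, hii.2])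

theorem Inv.le_lt_ln (hP : P.Fits G A₀ L) (h : Inv G P A₀ N s) (hm : s.mode = 4)
    (hj : s.j = s.z) : s.le < s.ln := by
  have hs := h.scan (by omega)
  have h₁ := h.found_le hP hm hj
  have h₂ := (hs.growing hm).2
  by_contra hc
  rw [Finset.Ico_eq_empty (by omega), Finset.sum_empty] at h₁
  rw [Nat.le_zero.1 h₁] at h₂
  omega

/-- The found entries may be dropped, because all their ends have left the current set. The new
layer has volume at least `z`, and `z * D` exceeds the old volume; this gives the factor `(D + 1) /
D` of `growth`. -/
theorem Inv.nextLayer (hP : P.Fits G A₀ L) (h : Inv G P A₀ N s) (hm : s.mode = 4)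
    (hj : s.j = s.z) : Inv G P A₀ N s.nextLayer := by
  have hl := h.label
  have hs := h.scan (by omega)
  have hfound := h.found_le hP hm hj
  have hgrow := hs.growing hm
  have hle := hs.le_ln
  refine ⟨⟨h.flow.1, h.flow.2, h.flow.3⟩, ⟨hl.full, hl.valid, hl.cursor, hl.lev_le, hl.ptr_le,
    hl.supp, hl.sub, hl.removed, fun v hv => .inr (hl.of_ne_two (by omega) v hv),
    fun h => by simp [State.nextLayer] at h⟩,
    ⟨fun i hi => ?_, fun e v u hlk hv hu => ?_, h.queue.3, h.queue.4, h.queue.5,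
      fun h' => by simp [State.nextLayer] at h'⟩,
    ⟨h.range.1, h.range.2, h.range.3, h.range.4, h.range.5, by simp [State.nextLayer]⟩,
    fun h' => by simp [State.nextLayer] at h', fun _ => ⟨hs.1, hs.2, hs.3, hs.lo_le.trans hs.le_ln,
      le_rfl, hs.k_le, fun _ => hs.k_zero hgrow.1, fun _ => ⟨rfl, rfl⟩,
      fun h' => by simp [State.nextLayer] at h', le_rfl, fun i hi => absurd hi (Nat.not_lt_zero _),
      fun i hi => absurd hi (Nat.not_lt_zero _), fun i hi => absurd hi (Nat.not_lt_zero _),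
      hs.lev_new, fun i hi => (hs.lev_new i hi).trans (Nat.le_succ _),
      fun i hi => absurd hi (Nat.not_lt_zero _), ?_, fun i hi => absurd hi (Nat.not_lt_zero _)⟩⟩
  · simp only [State.nextLayer] at hi ⊢
    exact h.queue.link i (by omega)
  · rcases h.queue.boundary e v u hlk hv hu with h' | ⟨i, h₁, h₂, h₃, h₄⟩ | h'
    · exact .inl h'
    · refine .inr (.inl ⟨i, h₁, ?_, h₃, h₄⟩)
      by_contra hc
      simp only [State.nextLayer, add_zero, not_lt] at hc
      obtain ⟨i', -, h₅, h₆⟩ := hs.absorbed (i - s.qlen) (by omega)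
      rw [Nat.add_sub_cancel' hc, h₄] at h₆
      exact (hs.mem i' h₅).2 (h₆ ▸ hv)
    · exact .inr (.inr h')
  · simp only [State.nextLayer]
    have h₁ := Finset.sum_range_add_sum_Ico (fun i => P.deg (s.lst i)) hle
    rw [← h₁, pow_succ, pow_succ]
    calc (P.D + 1) ^ s.dep * (P.D + 1)
        ≤ (∑ i ∈ Finset.range s.le, P.deg (s.lst i)) * P.D ^ s.dep * (P.D + 1) :=
          Nat.mul_le_mul_right _ hs.growth
      _ = (∑ i ∈ Finset.range s.le, P.deg (s.lst i)) * (P.D + 1) * P.D ^ s.dep := by ring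
      _ ≤ (∑ i ∈ Finset.range s.le, P.deg (s.lst i) + ∑ i ∈ Finset.Ico s.le s.ln, P.deg (s.lst i)) *
            P.D * P.D ^ s.dep := by
          refine Nat.mul_le_mul_right _ ?_
          have := Nat.mul_le_mul_right P.D hfound
          nlinarith [hgrow.2]
      _ = _ := by ring

theorem ScanInv.vol_le (hs : ScanInv P A₀ s) : s.vol ≤ ∑ v ∈ A₀, P.deg v := by
  rw [hs.vol_eq, ← Finset.sum_image (f := P.deg) (g := s.lst) (s := Finset.range s.ln)]
  · refine Finset.sum_le_sum_of_subset fun v hv => ?_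
    obtain ⟨i, hi, rfl⟩ := Finset.mem_image.1 hv
    exact (hs.mem i (Finset.mem_range.1 hi)).1
  · intro i hi i' hi' hii
    simp only [Finset.coe_range, Set.mem_Iio] at hi hi'
    exact hs.inj i hi i' hi' hii

theorem pow_add_mul_pow_le (a n : ℕ) : a ^ (n + 1) + (n + 1) * a ^ n ≤ (a + 1) ^ (n + 1) := by
  induction n with
  | zero => simp
  | succ n ih =>
    have := Nat.mul_le_mul_right (a + 1) ih
    calc a ^ (n + 1 + 1) + (n + 1 + 1) * a ^ (n + 1)
        ≤ (a ^ (n + 1) + (n + 1) * a ^ n) * (a + 1) := by ring_nf; omega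
      _ ≤ _ := this

/-- Bernoulli's inequality `(1 + 1/D) ^ D ≥ 2`, raised to the power `L` and cleared of denominators.
-/
theorem two_pow_mul_le {D : ℕ} (hD : 0 < D) (L : ℕ) :
    2 ^ L * D ^ (D * L) ≤ (D + 1) ^ (D * L) := by
  rw [pow_mul, pow_mul, ← mul_pow]
  refine Nat.pow_le_pow_left ?_ _
  obtain ⟨n, rfl⟩ : ∃ n, D = n + 1 := ⟨D - 1, by omega⟩
  have := pow_add_mul_pow_le (n + 1) n
  rw [← pow_succ'] at this
  omega

/-- After `D * L` layers the exponential growth would give volume at least `2 ^ L`, more than the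
initial set has. -/
theorem ScanInv.dep_lt (hP : P.Fits G A₀ L) (hs : ScanInv P A₀ s) : s.dep < P.D * L := by
  by_contra hc
  push Not at hc
  have hD : 0 < P.D := by rw [hP.D_eq]; have := hP.c_pos; omega
  have h₁ : ∑ i ∈ Finset.range s.le, P.deg (s.lst i) ≤ s.vol := by
    rw [hs.vol_eq]
    exact Finset.sum_le_sum_of_subset (Finset.range_mono hs.le_ln)
  have h₂ : ∑ i ∈ Finset.range s.le, P.deg (s.lst i) < 2 ^ L :=
    (h₁.trans hs.vol_le).trans_lt hP.vol_lt
  have h₃ := hs.growth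
  obtain ⟨r, hr⟩ := Nat.exists_eq_add_of_le hc
  have h₄ : 2 ^ L * P.D ^ s.dep ≤ (P.D + 1) ^ s.dep := by
    rw [hr, pow_add, pow_add, ← mul_assoc]
    exact Nat.mul_le_mul (two_pow_mul_le hD _) (Nat.pow_le_pow_left (Nat.le_succ _) _)
  have h₅ := h₄.trans h₃
  have := Nat.le_of_mul_le_mul_right h₅ (pow_pos hD _)
  omega

theorem Inv.pass (h : Inv G P A₀ N s) (hm : s.mode = 4) (hj : s.j ≠ s.z)
    (hA : s.qv (s.qlen + s.j) ∉ s.A) : Inv G P A₀ N { s with j := s.j + 1 } := by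
  have hl := h.label
  have hs := h.scan (by omega)
  have hjz : s.j < s.z := lt_of_le_of_ne hs.j_le hj
  refine ⟨⟨h.flow.1, h.flow.2, h.flow.3⟩, ⟨hl.full, hl.valid, hl.cursor, hl.lev_le, hl.ptr_le,
    hl.supp, hl.sub, hl.removed, hl.load, hl.active⟩,
    ⟨h.queue.1, h.queue.2, h.queue.3, h.queue.4, h.queue.5, h.queue.6⟩,
    ⟨h.range.1, h.range.2, h.range.3, h.range.4, h.range.5, h.range.6⟩,
    fun h' => by simp only at h'; omega, fun _ => ⟨hs.1, hs.2, hs.3, hs.4, hs.5,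
      hs.6, hs.7, fun h' => by simp only at h'; omega, hs.9, hjz, fun i hi => ?_,
      hs.12, hs.13, hs.14, hs.15, hs.16, hs.17, hs.18⟩⟩
  rcases Nat.lt_succ_iff_lt_or_eq.1 hi with hi | rfl
  · exact hs.absorbed i hi
  · exact (hs.found_mem _ hjz).resolve_left hA

theorem Inv.absorb (hP : P.Fits G A₀ L) (h : Inv G P A₀ N s) (hm : s.mode = 4) (hj : s.j ≠ s.z)
    (hA : s.qv (s.qlen + s.j) ∈ s.A) : Inv G P A₀ N (s.absorb P (s.qv (s.qlen + s.j))) := by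
  have hl := h.label
  have hs := h.scan (by omega)
  have hjz : s.j < s.z := lt_of_le_of_ne hs.j_le hj
  obtain ⟨u, hu⟩ : ∃ u, s.qv (s.qlen + s.j) = u := ⟨_, rfl⟩
  have hlevu := hs.lev_found s.j hjz
  rw [hu] at hA hlevu ⊢
  have hdep := hs.dep_lt hP
  have hh := hP.h_eq
  -- The level of `u` is at least `h - dep - 1`, and `dep < D * L = h - 2`; so it is positive and
  -- `u` is full.
  have hfull := (hl.full u (.inl (by omega))).2
  have hle := hl.erase hfull (by omega)
  have hR := removedVol_erase (P := P) hl.sub hA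
  have hgrow := hs.growing hm
  have hk := hs.k_zero hgrow.1
  have hlst (i : ℕ) (hi : i < s.ln) : Function.update s.lst s.ln u i = s.lst i :=
    Function.update_of_ne hi.ne _ _
  have hsum (r : ℕ) (hr : r ≤ s.ln) : ∑ i ∈ Finset.range r, P.deg (Function.update s.lst s.ln u i) =
      ∑ i ∈ Finset.range r, P.deg (s.lst i) := by
    refine Finset.sum_congr rfl fun i hi => ?_
    rw [hlst i (by rw [Finset.mem_range] at hi; omega)]
  refine ⟨⟨h.flow.1, h.flow.2, (h.flow.erase _).3⟩, ⟨hle.1, hle.2, hle.3, hle.4, hle.5, hle.6,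
    hle.7, hle.8, fun v hv => .inr ((hle.9 v hv).resolve_left (by simp)),
    fun h' => by simp only [State.absorb] at h'; omega⟩,
    ⟨fun i hi' => ?_, fun e v u' hlk hvA hu' => ?_, ?_, ?_, h.queue.5, h.queue.6⟩,
    ⟨h.range.1, h.range.2, h.range.3, fun i => ?_, h.range.5, h.range.6⟩,
    fun h' => by simp only [State.absorb] at h'; omega, fun _ => ⟨fun i hi => ?_,
      fun i hi i' hi' hii => ?_, ?_, hs.lo_le, ?_, fun _ => ?_, hs.k_zero,
      fun h' => by simp only [State.absorb] at h'; omega, fun _ => ⟨hgrow.1, ?_⟩, hjz,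
      fun i hi => ?_, hs.found_inj, fun i hi => ?_, fun i hi => ?_, fun i hi => ?_, hs.lev_found, ?_,
      fun i hi => ?_⟩⟩
  · obtain ⟨u', hu', hlk⟩ := h.queue.link i hi'
    exact ⟨u', fun hc => hu' (Finset.mem_of_mem_erase hc), hlk⟩
  · simp only [State.absorb] at hvA hu' ⊢
    by_cases huA : u' ∈ s.A
    · have huc : u' = u := by
        by_contra hne
        exact hu' (Finset.mem_erase.2 ⟨hne, huA⟩)
      obtain ⟨k, hk', hk'', -⟩ := hP.exists_arc hlk.symm
      refine .inr (.inr ⟨s.ln, k, ?_, by omega, by simpa [huc] using hk', by simp [huc], hk''⟩)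
      have := hs.le_ln
      omega
    · rcases h.queue.boundary e v u' hlk (Finset.mem_of_mem_erase hvA) huA with
        h' | h' | ⟨i, k, h₁, h₂, h₃⟩
      · exact .inl h'
      · exact .inr (.inl h')
      · exact .inr (.inr ⟨i, k, h₁, by omega, by rwa [hlst i h₂]⟩)
  · have h₁ := h.queue.supply
    have h₂ := pending_erase h.flow u
    have h₃ : pending G P (s.absorb P u) = pending G P { s with A := s.A.erase u } := rfl
    rw [h₃]
    simp only [State.absorb, hR]
    push_cast
    omega
  · have h₁ := h.queue.length
    simp only [State.absorb, hR]
    omega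
  · simp only [State.absorb, Function.update_apply]
    split_ifs
    exacts [(hP.mem_lt hl hA).le, h.range.4 i]
  · simp only [State.absorb] at hi ⊢
    rcases Nat.lt_succ_iff_lt_or_eq.1 hi with hi | rfl
    · rw [hlst i hi]
      exact ⟨(hs.mem i hi).1, fun hc => (hs.mem i hi).2 (Finset.mem_of_mem_erase hc)⟩
    · rw [Function.update_self]
      exact ⟨hl.sub hA, by simp⟩
  · simp only [State.absorb] at hi hi' hii
    rcases Nat.lt_succ_iff_lt_or_eq.1 hi with hi | rfl <;>
      rcases Nat.lt_succ_iff_lt_or_eq.1 hi' with hi' | rfl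
    · rw [hlst i hi, hlst i' hi'] at hii
      exact hs.inj i hi i' hi' hii
    · rw [hlst i hi, Function.update_self] at hii
      exact absurd hA (hii ▸ (hs.mem i hi).2)
    · rw [hlst i' hi', Function.update_self] at hii
      exact absurd hA (hii ▸ (hs.mem i' hi').2)
    · rfl
  · simp only [State.absorb]
    rw [Finset.sum_range_succ, hsum _ le_rfl, Function.update_self, hs.vol_eq]
  · exact hs.le_ln.trans (Nat.le_succ _)
  · simp only [State.absorb]
    omega
  · simp only [State.absorb]
    rw [hsum _ hs.le_ln]
    exact hgrow.2
  · simp only [State.absorb] at hi ⊢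
    rcases Nat.lt_succ_iff_lt_or_eq.1 hi with hi | rfl
    · obtain ⟨i', h₁, h₂, h₃⟩ := hs.absorbed i hi
      exact ⟨i', h₁, by omega, by rwa [hlst i' h₂]⟩
    · exact ⟨s.ln, hs.le_ln, by omega, by rw [Function.update_self, hu]⟩
  · simp only [State.absorb] at hi ⊢
    obtain ⟨i', k, h₁, h₂, h₃⟩ := hs.found_arc i hi
    exact ⟨i', k, h₁, by omega, by rwa [hlst i' h₂]⟩
  · simp only [State.absorb] at hi ⊢
    rw [hlst i (hi.trans_le hs.le_ln)]
    exact hs.lev_old i hi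
  · simp only [State.absorb] at hi ⊢
    rcases Nat.lt_succ_iff_lt_or_eq.1 hi with hi | rfl
    · rw [hlst i hi]
      exact hs.lev_new i hi
    · rwa [Function.update_self]
  · simp only [State.absorb]
    rw [hsum _ hs.le_ln]
    exact hs.growth
  · simp only [State.absorb] at hi ⊢
    rcases hs.found_mem i hi with h' | ⟨i', h₁, h₂, h₃⟩
    · by_cases hc : s.qv (s.qlen + i) = u
      · exact .inr ⟨s.ln, hs.le_ln, by omega, by rw [Function.update_self, hc]⟩
      · exact .inl (Finset.mem_erase.2 ⟨hc, h'⟩)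
    · exact .inr ⟨i', h₁, by omega, by rwa [hlst i' h₂]⟩

end Transitions

end Trimming

namespace Trimming

open WordRAM

/-! ### The number of iterations -/

/-- The total number of relabelings and of advances of the arc pointers. -/
def labelWork (P : Params) (A₀ : Finset ℕ) (lev ptr : ℕ → ℕ) : ℕ :=
  ∑ v ∈ A₀, (lev v * (P.deg v + 1) + ptr v)

/-- The work that the vertices of the current cut still cause. -/
def scanWork (P : Params) (s : State) : ℕ := ∑ i ∈ Finset.Ico s.lo s.ln, (2 * P.deg (s.lst i) + 3)

/-- The part of the measure that depends on the mode. -/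
def modeWork (P : Params) (s : State) : ℤ :=
  if s.mode = 0 then P.h + 2
  else if s.mode = 1 then P.h + 1
  else if s.mode = 2 then P.h - s.lev s.cur
  else if s.mode = 3 then
    -(scanWork P s - 2 * s.k + s.z + if s.lo < s.le then 0 else 2 : ℤ)
  else -(scanWork P s + (s.z - s.j) + 1 : ℤ)

/-- A measure that grows in every iteration of the main loop. -/
def measure (P : Params) (A₀ : Finset ℕ) (s : State) : ℤ :=
  s.qi + (P.h + 4) * total A₀ s.mass + 2 * labelWork P A₀ s.lev s.ptr +
    10 * removedVol P A₀ s.A + modeWork P s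

section Transitions

variable {G : Graph ℕ ℕ} {P : Params} {A₀ : Finset ℕ} {N L : ℕ} {s : State}

theorem total_update {mass : ℕ → ℕ} {v : ℕ} (hv : v ∈ A₀) :
    total A₀ (Function.update mass v (mass v + 1)) = total A₀ mass + 1 := by
  rw [total, total, Finset.sum_update_of_mem hv, ← Finset.add_sum_erase _ _ hv,
    Finset.sdiff_singleton_eq_erase]
  omega

theorem push_eq_same (e u : ℕ) : (s.push e u).qi = s.qi ∧ (s.push e u).A = s.A ∧
    (s.push e u).lev = s.lev ∧ (s.push e u).ptr = s.ptr ∧ (s.push e u).mode = s.mode := by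
  obtain ⟨X, H, h⟩ := push_cases (s := s) e u
  rw [h]
  exact ⟨rfl, rfl, rfl, rfl, rfl⟩

/-- A new unit is worth `h + 4`, which covers the drop of the mode term from `h + 1` to `h - lev v ≥
0`. -/
theorem Inv.sourceStep (hP : P.Fits G A₀ L) (h : Inv G P A₀ N s) (hm : s.mode = 1) :
    Inv G P A₀ N (s.sourceStep P) ∧ measure P A₀ s + 1 ≤ measure P A₀ (s.sourceStep P) := by
  rw [State.sourceStep]
  split_ifs with h₁ h₂
  · refine ⟨h.finish hm h₁, ?_⟩
    simp [measure, modeWork, hm]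
  · refine ⟨h.inject hP hm h₁ h₂.1 h₂.2, ?_⟩
    obtain ⟨e₁, e₂, e₃, e₄, -⟩ := push_eq_same (s := s) (s.qe s.qi) (s.qv s.qi)
    have := h.label.lev_le (s.qv s.qi)
    simp only [measure, modeWork, hm, State.inject, e₁, e₂, e₃, e₄,
      total_update (h.label.sub h₂.1)]
    push_cast
    nlinarith
  · refine ⟨h.skip hm h₁ h₂, ?_⟩
    simp only [measure, modeWork, hm]
    push_cast
    linarith

theorem labelWork_update {lev ptr : ℕ → ℕ} {v : ℕ} (hv : v ∈ A₀) (l p : ℕ) :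
    labelWork P A₀ (Function.update lev v l) (Function.update ptr v p) +
      (lev v * (P.deg v + 1) + ptr v) = labelWork P A₀ lev ptr + (l * (P.deg v + 1) + p) := by
  rw [labelWork, labelWork, ← Finset.add_sum_erase _ _ hv,
    ← Finset.add_sum_erase _ (fun v => lev v * (P.deg v + 1) + ptr v) hv,
    Finset.sum_congr (g := fun v => lev v * (P.deg v + 1) + ptr v) rfl fun u hu => ?_]
  · simp only [Function.update_self]
    omega
  · rw [Function.update_of_ne (Finset.ne_of_mem_erase hu),
      Function.update_of_ne (Finset.ne_of_mem_erase hu)]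

/-- A move gains one level in `h - lev cur`. A relabeling loses one there, but label work counts
twice: replacing a full pointer by a level raises it by one. A new cut costs `2 * deg + 3` and is
paid by `10 * deg`, as the degree is positive. -/
theorem Inv.walkStep (hP : P.Fits G A₀ L) (h : Inv G P A₀ N s) (hm : s.mode = 2) :
    Inv G P A₀ N (s.walkStep P) ∧ measure P A₀ s + 1 ≤ measure P A₀ (s.walkStep P) := by
  have hl := h.label
  have hcA := (hl.active hm).1
  rw [State.walkStep]
  split_ifs with h₁ h₂ h₃ h₄
  · refine ⟨h.startCut hP hm h₁ h₂, ?_⟩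
    have hdeg := h.deg_pos hP hcA (by omega)
    have hR := removedVol_erase (P := P) hl.sub hcA
    simp [measure, modeWork, hm, State.startCut, hR, scanWork, h₂]
    omega
  · refine ⟨h.relabel hP hm h₁ h₂ h₃, ?_⟩
    have hw := labelWork_update (P := P) (lev := s.lev) (ptr := s.ptr) (hl.sub hcA)
      (s.lev s.cur + 1) 0
    rw [h₃] at hw
    have hw' : labelWork P A₀ (Function.update s.lev s.cur (s.lev s.cur + 1))
        (Function.update s.ptr s.cur 0) = labelWork P A₀ s.lev s.ptr + 1 := by
      linarith
    simp [measure, modeWork, hm, State.relabel, hw']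
    linarith
  · refine ⟨h.move hP hm h₁ (hP.arc_link (hP.mem_lt hl hcA) (lt_of_le_of_ne (hl.ptr_le _) h₃))
      h₄.1.1 h₄.1.2 h₄.2, ?_⟩
    generalize P.arcEdge s.cur (s.ptr s.cur) = e at *
    generalize P.arcEnd s.cur (s.ptr s.cur) = u at *
    obtain ⟨e₁, e₂, e₃, e₄, e₅⟩ := push_eq_same (s := s) e u
    have hne : u ≠ s.cur := fun hc => by rw [hc] at h₄; omega
    have ht := total_move (hl.sub hcA) (hl.sub h₄.1.1) hne (by omega : 0 < s.mass s.cur)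
    simp only [measure, modeWork, hm, State.move, e₁, e₂, e₃, e₄, e₅, ht, h₄.2]
    push_cast
    linarith
  · refine ⟨h.advance hP hm h₁ h₃ h₄, ?_⟩
    have hw := labelWork_update (P := P) (lev := s.lev) (ptr := s.ptr) (hl.sub hcA)
      (s.lev s.cur) (s.ptr s.cur + 1)
    rw [Function.update_eq_self] at hw
    have hw' : labelWork P A₀ s.lev (Function.update s.ptr s.cur (s.ptr s.cur + 1)) =
        labelWork P A₀ s.lev s.ptr + 1 := by
      linarith
    simp [measure, modeWork, hm, State.advance, hw']
  · refine ⟨h.settle hm (by omega), ?_⟩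
    simp [measure, modeWork, hm]

/-- An arc is worth `2`: a recorded arc spends one on its scan and leaves one for its turn in mode
`4`. The surcharge `3` of a vertex pays for leaving it and for the possible end of the layer. -/
theorem Inv.scanStep (hP : P.Fits G A₀ L) (h : Inv G P A₀ N s) (hm : s.mode = 3) :
    Inv G P A₀ N (s.scanStep P) ∧ measure P A₀ s + 1 ≤ measure P A₀ (s.scanStep P) := by
  have hs := h.scan (by omega)
  have hsc := hs.scanning hm
  rw [State.scanStep]
  split_ifs with h₁ h₂ h₃ h₄
  · refine ⟨h.toGrow hm h₁ h₂, ?_⟩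
    have := hs.k_zero h₁
    simp [measure, modeWork, hm, h₁, this, scanWork, hsc]
  · refine ⟨h.commit hP hm h₁ (by omega), ?_⟩
    have := hs.k_zero h₁
    simp [measure, modeWork, hm, h₁, this, scanWork, hsc, State.commit]
    linarith
  · refine ⟨h.nextVertex hm h₁ h₃, ?_⟩
    have hlt := hs.lo_lt h₁
    have hll := lt_of_le_of_ne hs.lo_le h₁
    have : scanWork P s = 2 * P.deg (s.lst s.lo) + 3 + scanWork P { s with lo := s.lo + 1, k := 0 } := by
      rw [scanWork, scanWork, Finset.sum_eq_sum_Ico_succ_bot hlt]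
    simp only [measure, modeWork, hm, this, h₃, if_pos hll]
    push_cast
    split_ifs <;> linarith
  · refine ⟨h.record hP hm h₁ h₃ h₄.1 h₄.2, ?_⟩
    simp [measure, modeWork, hm, State.record, scanWork]
    linarith
  · refine ⟨h.nextArc hP hm h₁ h₃ h₄, ?_⟩
    simp [measure, modeWork, hm, scanWork]

/-- Absorbing a vertex adds scan work `2 * deg + 3`, less than the gain `10 * deg` in removed
volume. A new layer is never empty, so the next scan starts without the surcharge for an exhausted
layer. -/
theorem Inv.growStep (hP : P.Fits G A₀ L) (h : Inv G P A₀ N s) (hm : s.mode = 4) :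
    Inv G P A₀ N (s.growStep P) ∧ measure P A₀ s + 1 ≤ measure P A₀ (s.growStep P) := by
  have hs := h.scan (by omega)
  have hgr := hs.growing hm
  rw [State.growStep]
  split_ifs with h₁ h₂
  · refine ⟨h.nextLayer hP hm h₁, ?_⟩
    have := h.le_lt_ln hP hm h₁
    have hk := hs.k_zero hgr.1
    simp [measure, modeWork, hm, h₁, scanWork, State.nextLayer, hgr.1, this, hk]
    linarith
  · refine ⟨h.absorb hP hm h₁ h₂, ?_⟩
    have hjz : s.j < s.z := lt_of_le_of_ne hs.j_le h₁
    have hR := removedVol_erase (P := P) h.label.sub h₂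
    obtain ⟨w, -, hlk⟩ := h.queue.link (s.qlen + s.j) (by omega)
    obtain ⟨k, hk, -⟩ := hP.exists_arc hlk
    generalize s.qv (s.qlen + s.j) = u at *
    have : scanWork P (s.absorb P u) = scanWork P s + (2 * P.deg u + 3) := by
      have hle := hs.le_ln
      simp only [scanWork, State.absorb]
      rw [Finset.sum_Ico_succ_top (by omega), Function.update_self]
      congr 1
      refine Finset.sum_congr rfl fun i hi => ?_
      rw [Function.update_of_ne (by rw [Finset.mem_Ico] at hi; omega)]
    simp only [measure, modeWork, this, hm]
    simp [State.absorb, hm, hR]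
    linarith
  · refine ⟨h.pass hm h₁ h₂, ?_⟩
    simp [measure, modeWork, hm, scanWork]

theorem Inv.step (hP : P.Fits G A₀ L) (h : Inv G P A₀ N s) (hm : s.mode ≠ 0) :
    Inv G P A₀ N (s.step P) ∧ measure P A₀ s + 1 ≤ measure P A₀ (s.step P) := by
  have := h.range.mode
  rw [State.step]
  split_ifs with h₁ h₂ h₃
  exacts [h.sourceStep hP h₁, h.walkStep hP h₂, h.scanStep hP h₃, h.growStep hP (by omega)]

theorem Inv.run_bodyProgram (hP : P.Fits G A₀ L) (h : Inv G P A₀ N s) (hm : s.mode ≠ 0) :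
    bodyProgram.run (s.toStore P) = (s.step P).toStore P := by
  have hmode := h.range.mode
  rw [bodyProgram, run_ite, if_congr (evalNat_eq_ne_zero _ _ _) rfl rfl, run_ite,
    if_congr (evalNat_eq_ne_zero _ _ _) rfl rfl, run_ite, if_congr (evalNat_eq_ne_zero _ _ _) rfl rfl,
    State.step, toStore_ite, toStore_ite, toStore_ite]
  refine if_congr_ctx Iff.rfl (fun _ => run_sourceProgram) fun h₁ =>
    if_congr_ctx Iff.rfl (fun h₂ => ?_) fun h₂ => if_congr_ctx Iff.rfl (fun h₃ => ?_) fun h₃ => ?_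
  · exact run_walkProgram (hP.mem_lt h.label (h.label.active h₂).1) (h.label.ptr_le _)
  · have hs := h.scan (by omega)
    exact run_scanProgram (fun hlo => hs.lst_lt hP (hs.lo_lt hlo)) fun hlo => hs.k_le (hs.lo_lt hlo)
  · have hs := h.scan (by omega)
    refine run_growProgram fun hj => ?_
    have := lt_of_le_of_ne hs.j_le hj
    obtain ⟨w, -, hlk⟩ := h.queue.link (s.qlen + s.j) (by omega)
    exact hP.vertex.1 hlk.left_mem

/-! ### Bounds -/

theorem Inv.removedVol_le (h : Inv G P A₀ N s) : removedVol P A₀ s.A ≤ total A₀ s.mass := by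
  refine (Finset.sum_le_sum fun v hv => ?_).trans
    (Finset.sum_le_sum_of_subset (Finset.sdiff_subset : A₀ \ s.A ⊆ A₀))
  rw [Finset.mem_sdiff] at hv
  exact h.label.removed v hv.1 hv.2

theorem Inv.supply_le (h : Inv G P A₀ N s) :
    4 * total A₀ s.mass ≤ 4 * (P.c * N) + removedVol P A₀ s.A := by
  have h₁ := h.queue.supply
  have h₂ : 0 ≤ pending G P s := Finset.sum_nonneg fun i _ => h.flow.pending_term_nonneg i
  zify
  linarith

/-- Cuts bring in a quarter of the volume that they remove, and that volume is itself at most the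
mass: `4T ≤ 4cN + R` and `R ≤ T`. -/
theorem Inv.total_le (h : Inv G P A₀ N s) : 3 * total A₀ s.mass ≤ 4 * (P.c * N) := by
  have := h.supply_le
  have := h.removedVol_le
  omega

theorem Inv.qlen_le (hP : P.Fits G A₀ L) (h : Inv G P A₀ N s) : s.qlen ≤ N + 2 * (P.c * N) := by
  have h₁ := h.queue.length
  have h₂ := h.removedVol_le
  have h₃ := h.total_le
  have h₄ := hP.c_pos
  have h₅ : 8 * P.c * s.qlen ≤ 8 * P.c * (N + 2 * (P.c * N)) := by nlinarith
  exact Nat.le_of_mul_le_mul_left h₅ (by omega)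

/-- A vertex with nonzero level or pointer satisfies `1 ≤ deg ≤ mass`, so its work `(h + 1) * (deg +
1)` is at most `(h + 1) * 2 * mass`. Other vertices contribute nothing. -/
theorem Inv.labelWork_le (h : Inv G P A₀ N s) :
    labelWork P A₀ s.lev s.ptr ≤ (P.h + 1) * (2 * total A₀ s.mass) := by
  rw [labelWork, total, Finset.mul_sum, Finset.mul_sum]
  refine Finset.sum_le_sum fun v _ => ?_
  have hl := h.label.lev_le v
  have hp := h.label.ptr_le v
  by_cases h0 : 0 < s.lev v ∨ 0 < s.ptr v
  · obtain ⟨h₁, h₂⟩ := h.label.full v h0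
    nlinarith
  · have h₁ : s.lev v = 0 := by omega
    have h₂ : s.ptr v = 0 := by omega
    simp [h₁, h₂]

theorem Inv.modeWork_le (h : Inv G P A₀ N s) : modeWork P s ≤ P.h + 2 := by
  rw [modeWork]
  have hmode := h.range.mode
  split_ifs with h₁ h₂ h₃ h₄ h₅
  · omega
  · omega
  · omega
  · have hs := h.scan (by omega)
    have hk := hs.k_le (h₅.trans_le hs.le_ln)
    have : 2 * P.deg (s.lst s.lo) + 3 ≤ scanWork P s := by
      refine Finset.single_le_sum (f := fun i => 2 * P.deg (s.lst i) + 3) (fun _ _ => Nat.zero_le _)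
        (Finset.mem_Ico.2 ⟨le_rfl, h₅.trans_le hs.le_ln⟩)
    omega
  · have hs := h.scan (by omega)
    have hk := hs.k_zero (by have := hs.lo_le; omega)
    omega
  · have hs := h.scan (by omega)
    have := hs.j_le
    omega

/-- An upper bound for the number of iterations. -/
def maxWork (P : Params) (N : ℕ) : ℕ := N + (P.c * N) * (10 * P.h + 40) + P.h + 2

theorem Inv.measure_le (hP : P.Fits G A₀ L) (h : Inv G P A₀ N s) :
    measure P A₀ s ≤ maxWork P N := by
  have h₁ := h.queue.qi_le.trans (h.qlen_le hP)
  have h₂ := h.total_le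
  have h₃ := h.labelWork_le
  have h₄ := h.modeWork_le
  have h₅ := h.removedVol_le
  have h₆ : s.qi + (P.h + 4) * total A₀ s.mass + 2 * labelWork P A₀ s.lev s.ptr +
      10 * removedVol P A₀ s.A + (P.h + 2) ≤ maxWork P N := by
    rw [maxWork]
    nlinarith
  zify at h₆
  rw [measure]
  linarith

end Transitions

end Trimming

/-! ### Volumes and conductance -/

namespace Graph

variable {α β : Type*} {G : Graph α β}

theorem vol_coe (S : Finset α) : G.vol S = ∑ v ∈ S, G.deg v :=
  finsum_mem_coe_finset _ _

theorem vol_congr {H : Graph α β} {S : Set α} (h : ∀ v ∈ S, G.deg v = H.deg v) :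
    G.vol S = H.vol S :=
  finsum_mem_congr rfl h

theorem vol_add_vol_diff {A S : Set α} (hA : A.Finite) (hS : S ⊆ A) :
    G.vol S + G.vol (A \ S) = G.vol A := by
  have := finsum_mem_union (f := G.deg) (Set.disjoint_sdiff_right (s := S) (t := A))
    (hA.subset hS) (hA.subset Set.sdiff_subset)
  rwa [Set.union_sdiff_cancel hS, eq_comm] at this

theorem edgesBetween_comm (S T : Set α) : G.edgesBetween S T = G.edgesBetween T S := by
  ext e
  constructor <;> rintro ⟨u, hu, v, hv, h⟩ <;> exact ⟨v, hv, u, hu, h.symm⟩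

theorem vertexSet_inducedWithLoops {A : Set α} (hA : A ⊆ G.vertexSet) :
    (G.inducedWithLoops A).vertexSet = A :=
  Set.inter_eq_right.2 hA

theorem deg_inducedWithLoops {A : Set α} {v : α} (hv : v ∈ A) :
    (G.inducedWithLoops A).deg v = G.deg v := by
  rw [deg, deg]
  congr 1
  ext e
  constructor
  · rintro ⟨u, ⟨-, -, h⟩ | ⟨-, -, z, -, h⟩⟩
    exacts [⟨u, h⟩, ⟨z, h⟩]
  · rintro ⟨u, h⟩
    by_cases hu : u ∈ A
    · exact ⟨u, .inl ⟨hv, hu, h⟩⟩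
    · exact ⟨v, .inr ⟨rfl, hv, u, hu, h⟩⟩

theorem edgesBetween_inducedWithLoops {A S T : Set α} (hS : S ⊆ A) (hT : T ⊆ A)
    (hST : Disjoint S T) : (G.inducedWithLoops A).edgesBetween S T = G.edgesBetween S T := by
  ext e
  constructor
  · rintro ⟨u, hu, v, hv, ⟨-, -, h⟩ | ⟨rfl, -⟩⟩
    · exact ⟨u, hu, v, hv, h⟩
    · exact absurd rfl (hST.ne_of_mem hu hv)
  · rintro ⟨u, hu, v, hv, h⟩
    exact ⟨u, hu, v, hv, .inl ⟨hS hu, hT hv, h⟩⟩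

/-- A lower bound for the conductance of `G{A}`. -/
theorem le_conductance_inducedWithLoops {A : Set α} (hfin : A.Finite) (hA : A ⊆ G.vertexSet)
    {ψ : ℝ} (hψ : ψ ≤ 1) (h : ∀ S ⊆ A, (G.vol S : ℝ) ≤ G.vol A / 2 →
      ψ * G.vol S ≤ (G.edgesBetween S (A \ S)).ncard) :
    ψ ≤ (G.inducedWithLoops A).conductance := by
  have hvol {S : Set α} (hS : S ⊆ A) : (G.inducedWithLoops A).vol S = G.vol S :=
    vol_congr fun v hv => deg_inducedWithLoops (hS hv)
  rw [conductance]
  split_ifs with hne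
  · refine le_csInf (hne.image _) ?_
    rintro _ ⟨S, ⟨hS, h₁, h₂⟩, rfl⟩
    rw [vertexSet_inducedWithLoops hA] at hS h₂
    rw [cutConductance, cutSize, vertexSet_inducedWithLoops hA,
      edgesBetween_inducedWithLoops hS Set.sdiff_subset Set.disjoint_sdiff_right]
    rw [hvol hS] at h₁ ⊢
    rw [hvol Set.sdiff_subset] at h₂ ⊢
    have hsum : (G.vol S : ℝ) + G.vol (A \ S) = G.vol A := by
      exact_mod_cast vol_add_vol_diff hfin hS
    rw [le_div_iff₀ (by exact_mod_cast lt_min h₁ h₂)]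
    rcases le_total (G.vol S) (G.vol (A \ S)) with hle | hle
    · rw [min_eq_left hle]
      refine h S hS ?_
      have : (G.vol S : ℝ) ≤ G.vol (A \ S) := by exact_mod_cast hle
      linarith
    · rw [min_eq_right hle, edgesBetween_comm]
      have : (G.vol (A \ S) : ℝ) ≤ G.vol S := by exact_mod_cast hle
      have := h (A \ S) Set.sdiff_subset (by linarith)
      rwa [Set.sdiff_sdiff_cancel_left hS] at this
  · exact hψ

end Graph

/-! ### The guarantees that hold when all sources are exhausted -/

namespace Trimming

section Certificate

variable {G : Graph ℕ ℕ} {P : Params} {A₀ : Finset ℕ} {N L : ℕ} {s : State}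

theorem Params.Represents.deg_eq (hP : P.Represents G) {v : ℕ} (hv : v < P.n) : G.deg v = P.deg v := by
  have : {e | G.Inc e v} = ((Finset.range (P.deg v)).image (P.arcEdge v) : Finset ℕ) := by
    ext e
    simp only [Set.mem_ofPred_eq, Finset.coe_image, Finset.coe_range, Set.mem_image, Set.mem_Iio]
    constructor
    · rintro ⟨u, h⟩
      obtain ⟨k, hk, h₁, -⟩ := hP.exists_arc h
      exact ⟨k, hk, h₁⟩
    · rintro ⟨k, hk, rfl⟩
      exact ⟨_, hP.arc_link hv hk⟩
  rw [Graph.deg, this, Set.ncard_coe_finset, Finset.card_image_of_injOn, Finset.card_range]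
  intro k hk k' hk' hkk
  simp only [Finset.coe_range, Set.mem_Iio] at hk hk'
  exact hP.arc_inj hv hk hk' hkk

theorem Params.Fits.vol_eq (hP : P.Fits G A₀ L) {S : Finset ℕ} (hS : S ⊆ A₀) :
    G.vol S = ∑ v ∈ S, P.deg v := by
  rw [Graph.vol_coe]
  exact Finset.sum_congr rfl fun v hv => hP.deg_eq (hP.lt_n (hS hv))

open Classical in
theorem Params.Represents.ncard_edgesBetween (hP : P.Represents G) (S T : Set ℕ) :
    ((G.edgesBetween S T).ncard : ℤ) =
      ∑ e ∈ Finset.range P.m, if e ∈ G.edgesBetween S T then (1 : ℤ) else 0 := by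
  have : G.edgesBetween S T =
      ((Finset.range P.m).filter fun e => e ∈ G.edgesBetween S T : Finset ℕ) := by
    ext e
    simp only [Finset.coe_filter, Finset.mem_range, Set.mem_ofPred_eq, iff_and_self]
    rintro ⟨u, -, v, -, h⟩
    exact hP.edge.1 h.edge_mem
  conv_lhs => rw [this, Set.ncard_coe_finset]
  simp

open Classical in
-- The contribution of a single edge to the mass inside `S`: exactly `c` if it leaves the current
-- set, at least `-c` if it goes to the rest of that set, and zero if both ends are in `S`.
theorem FlowInv.edge_bound (h : FlowInv G P s) {S : Finset ℕ} (hS : S ⊆ s.A)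
    (hsat : ∀ e v u, G.IsLink e v u → v ∈ s.A → u ∉ s.A → s.Sat P e v) (e : ℕ) :
    (if e ∈ G.edgesBetween S (G.vertexSet \ s.A) then (P.c : ℤ) else 0) -
      (if e ∈ G.edgesBetween S (s.A \ S) then (P.c : ℤ) else 0) ≤
      ∑ v ∈ S, netFlow G s.X s.H e v := by
  have single {u v : ℕ} (hu : u ∈ S) (hv : v ∉ S) (hlk : G.IsLink e u v) :
      ∑ v ∈ S, netFlow G s.X s.H e v = netFlow G s.X s.H e u := by
    refine Finset.sum_eq_single u (fun x hx hxu => ?_) fun h => absurd hu h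
    rw [netFlow, if_neg]
    intro hinc
    rcases hinc.eq_or_eq_of_isLink hlk with rfl | rfl
    exacts [hxu rfl, hv hx]
  by_cases h₁ : e ∈ G.edgesBetween S (G.vertexSet \ s.A)
  · obtain ⟨u, hu, v, hv, hlk⟩ := h₁
    have hs := hsat e u v hlk (hS hu) hv.2
    rw [single hu (fun hc => hv.2 (hS hc)) hlk, netFlow, if_pos hlk.inc_left, if_pos hs.2, hs.1]
    split_ifs <;> omega
  by_cases h₂ : e ∈ G.edgesBetween S (s.A \ S)
  · rw [if_neg h₁, if_pos h₂]
    obtain ⟨u, hu, v, hv, hlk⟩ := h₂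
    rw [single hu (by simpa using hv.2) hlk]
    have := h.neg_le_netFlow e u
    omega
  rw [if_neg h₁, if_neg h₂, sub_zero]
  by_cases hinc : ∃ u ∈ S, G.Inc e u
  · obtain ⟨u, hu, v, hlk⟩ := hinc
    have hvA : v ∈ s.A := by
      by_contra hc
      exact h₁ ⟨u, hu, v, ⟨hlk.right_mem, hc⟩, hlk⟩
    have hvS : v ∈ S := by
      by_contra hc
      exact h₂ ⟨u, hu, v, ⟨hvA, hc⟩, hlk⟩
    by_cases hX : s.X e = 0
    · exact Finset.sum_nonneg fun x _ => by simp [netFlow, hX]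
    -- An edge that carries flow is not a self-loop, so its two ends contribute opposite amounts.
    obtain ⟨y, hy, hlk'⟩ := h.head e hX
    have hyS : y ∈ S ∧ s.H e ∈ S := by
      rcases hlk.eq_and_eq_or_eq_and_eq hlk' with ⟨rfl, rfl⟩ | ⟨rfl, rfl⟩
      exacts [⟨hu, hvS⟩, ⟨hvS, hu⟩]
    have hpair : ({y, s.H e} : Finset ℕ) ⊆ S := by
      intro x hx
      simp only [Finset.mem_insert, Finset.mem_singleton] at hx
      rcases hx with rfl | rfl
      exacts [hyS.1, hyS.2]
    rw [← Finset.sum_subset hpair fun x _ hx => ?_]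
    · rw [Finset.sum_pair hy, netFlow, netFlow, if_pos hlk'.inc_left, if_pos hlk'.inc_right,
        if_neg hy.symm, if_pos rfl]
      omega
    · rw [netFlow, if_neg]
      intro hinc
      simp only [Finset.mem_insert, Finset.mem_singleton, not_or] at hx
      rcases hinc.eq_or_eq_of_isLink hlk' with h' | h'
      exacts [hx.1 h', hx.2 h']
  · push Not at hinc
    exact Finset.sum_nonneg fun x hx => by simp [netFlow, hinc x hx]

/-- If all edges that leave the current set are saturated, then the mass inside `S` bounds the number
of these edges at `S`. -/
theorem FlowInv.mass_bound (hP : P.Fits G A₀ L) (h : FlowInv G P s) {S : Finset ℕ} (hS : S ⊆ s.A)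
    (hsat : ∀ e v u, G.IsLink e v u → v ∈ s.A → u ∉ s.A → s.Sat P e v) :
    P.c * (G.edgesBetween S (G.vertexSet \ s.A)).ncard ≤
      ∑ v ∈ S, s.mass v + P.c * (G.edgesBetween S (s.A \ S)).ncard := by
  classical
  have h₁ := Finset.sum_le_sum fun e (_ : e ∈ Finset.range P.m) => h.edge_bound hS hsat e
  rw [Finset.sum_comm, ← Finset.sum_congr rfl fun v hv => h.cons v (hS hv),
    Finset.sum_sub_distrib] at h₁
  zify
  rw [hP.ncard_edgesBetween, hP.ncard_edgesBetween, Finset.mul_sum, Finset.mul_sum]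
  simp only [mul_ite, mul_one, mul_zero]
  linarith

theorem Inv.sat_of_done (h : Inv G P A₀ N s) (hm : s.mode = 0) :
    ∀ e v u, G.IsLink e v u → v ∈ s.A → u ∉ s.A → s.Sat P e v := by
  intro e v u hlk hv hu
  have hi := h.idle (by omega)
  have hq := h.queue.done hm
  have hz := hi.z
  have hn := hi.ln
  rcases h.queue.boundary e v u hlk hv hu with h' | ⟨i, h₁, h₂, -⟩ | ⟨i, k, -, h₂, -⟩
  · exact h'
  · omega
  · omega

theorem total_split {A : Finset ℕ} (hA : A ⊆ A₀) (mass : ℕ → ℕ) :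
    total A₀ mass = ∑ v ∈ A₀ \ A, mass v + ∑ v ∈ A, mass v :=
  (Finset.sum_sdiff hA).symm

/-- With `S` the whole current set, the boundary size times `c` is at most the mass left inside.
That is at most `cN + R/4 - R`, since removed vertices hold at least the removed volume `R`. -/
theorem Inv.cutSize_le (hP : P.Fits G A₀ L) (h : Inv G P A₀ N s) (hm : s.mode = 0) :
    G.cutSize s.A ≤ N := by
  have h₁ := h.flow.mass_bound hP (Finset.Subset.refl s.A) (h.sat_of_done hm)
  have h₀ : G.edgesBetween (s.A : Set ℕ) (s.A \ s.A) = ∅ := by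
    ext e
    simp [Graph.edgesBetween]
  rw [h₀, Set.ncard_empty, mul_zero, add_zero] at h₁
  have h₂ := h.supply_le
  rw [total_split h.label.sub] at h₂
  have h₃ : removedVol P A₀ s.A ≤ ∑ v ∈ A₀ \ s.A, s.mass v := Finset.sum_le_sum fun v hv => by
    rw [Finset.mem_sdiff] at hv
    exact h.label.removed v hv.1 hv.2
  rw [Graph.cutSize]
  exact Nat.le_of_mul_le_mul_left (by omega : P.c * _ ≤ P.c * N) hP.c_pos

theorem Inv.vol_le (hP : P.Fits G A₀ L) (h : Inv G P A₀ N s) :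
    3 * G.vol A₀ ≤ 3 * G.vol s.A + 4 * (P.c * N) := by
  have h₁ := h.removedVol_le
  have h₂ := h.total_le
  rw [hP.vol_eq subset_rfl, hP.vol_eq h.label.sub, ← Finset.sum_sdiff h.label.sub]
  rw [removedVol] at h₁
  omega

theorem Inv.le_conductance (hP : P.Fits G A₀ L) (h : Inv G P A₀ N s) (hm : s.mode = 0) {φ : ℝ}
    (hφ : φ ≤ 1) (hc : 3 / 2 ≤ P.c * φ) (hA : G.IsNearlyExpander φ A₀) :
    φ / 6 ≤ (G.inducedWithLoops s.A).conductance := by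
  have hmono : G.vol s.A ≤ G.vol A₀ := by
    rw [hP.vol_eq subset_rfl, hP.vol_eq h.label.sub]
    exact Finset.sum_le_sum_of_subset h.label.sub
  refine Graph.le_conductance_inducedWithLoops s.A.finite_toSet
    (fun v hv => hP.vertex.2 (hP.mem_lt h.label hv)) (by linarith) fun S hS hvol => ?_
  obtain ⟨S, rfl⟩ := (s.A.finite_toSet.subset hS).exists_finset_coe
  have hS' : S ⊆ s.A := by exact_mod_cast hS
  have h₁ := h.flow.mass_bound hP hS' (h.sat_of_done hm)
  have h₂ : ∑ v ∈ S, s.mass v ≤ G.vol S := by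
    rw [hP.vol_eq (hS'.trans h.label.sub)]
    exact Finset.sum_le_sum fun v hv => h.label.of_ne_two (by omega) v (hS' hv)
  -- Near expansion applies to `S`, since half the volume of the smaller set is at most half that of
  -- `A₀`.
  have h₃ : φ * G.vol S ≤ G.cutSize S := by
    refine hA S (by exact_mod_cast hS'.trans h.label.sub) ?_
    have : (G.vol s.A : ℝ) ≤ G.vol A₀ := by exact_mod_cast hmono
    linarith
  have h₄ : G.cutSize S ≤ (G.edgesBetween S (G.vertexSet \ s.A)).ncard +
      (G.edgesBetween S (s.A \ S)).ncard := by
    refine (Set.ncard_le_ncard ?_ ?_).trans (Set.ncard_union_le _ _)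
    · rintro e ⟨u, hu, v, hv, hlk⟩
      by_cases hvA : v ∈ s.A
      · exact .inr ⟨u, hu, v, ⟨hvA, hv.2⟩, hlk⟩
      · exact .inl ⟨u, hu, v, ⟨hv.1, hvA⟩, hlk⟩
    · refine (Set.finite_Iio P.m).subset ?_
      rintro e (⟨u, -, v, -, hlk⟩ | ⟨u, -, v, -, hlk⟩) <;> exact hP.edge.1 hlk.edge_mem
  have h₅ : (P.c * (G.edgesBetween S (G.vertexSet \ s.A)).ncard : ℝ) ≤
      G.vol S + P.c * (G.edgesBetween S (s.A \ S)).ncard := by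
    exact_mod_cast h₁.trans (Nat.add_le_add_right h₂ _)
  have h₆ : (G.cutSize S : ℝ) ≤ (G.edgesBetween S (G.vertexSet \ s.A)).ncard +
      (G.edgesBetween S (s.A \ S)).ncard := by exact_mod_cast h₄
  have hc0 : (0 : ℝ) < P.c := by exact_mod_cast hP.c_pos
  have hvol0 : (0 : ℝ) ≤ G.vol S := Nat.cast_nonneg _
  generalize ((G.edgesBetween S (G.vertexSet \ s.A)).ncard : ℝ) = x at *
  generalize ((G.edgesBetween S (s.A \ S)).ncard : ℝ) = y at *
  generalize (G.vol S : ℝ) = V at *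
  have h₇ : P.c * (φ * V) ≤ P.c * (x + y) := mul_le_mul_of_nonneg_left (h₃.trans h₆) hc0.le
  have h₈ : 3 / 2 * V ≤ P.c * φ * V := mul_le_mul_of_nonneg_right hc hvol0
  -- From `cφV ≤ c(x + y) ≤ V + 2cy` and `V ≤ (2/3) cφV` it follows that `cφV / 3 ≤ 2cy`.
  have h₉ : P.c * (φ / 6 * V) ≤ P.c * y := by linarith
  exact le_of_mul_le_mul_left h₉ hc0

end Certificate

end Trimming

namespace Trimming

open WordRAM

/-! ### The main loop -/

section MainLoop

variable {G : Graph ℕ ℕ} {P : Params} {A₀ : Finset ℕ} {N L : ℕ} {s : State}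

open Classical in
theorem Params.Represents.deg_eq_sum (hP : P.Represents G) {v : ℕ} (hv : v < P.n) :
    P.deg v = ∑ e ∈ Finset.range P.m, if G.Inc e v then 1 else 0 := by
  have : {e | G.Inc e v} = ((Finset.range P.m).filter fun e => G.Inc e v : Finset ℕ) := by
    ext e
    simp only [Finset.coe_filter, Finset.mem_range, Set.mem_ofPred_eq, iff_and_self]
    exact fun h => hP.edge.1 h.edge_mem
  rw [← hP.deg_eq hv, Graph.deg, this, Set.ncard_coe_finset, Finset.card_filter]

/-- Only an inequality, because a self-loop counts once. -/
theorem Params.Represents.sum_deg_le (hP : P.Represents G) :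
    ∑ v ∈ Finset.range P.n, P.deg v ≤ 2 * P.m := by
  classical
  rw [Finset.sum_congr rfl fun v hv => hP.deg_eq_sum (Finset.mem_range.1 hv), Finset.sum_comm]
  refine (Finset.sum_le_card_nsmul _ _ 2 fun e he => ?_).trans (by simp [mul_comm])
  rw [Finset.mem_range, ← hP.edge] at he
  obtain ⟨x, y, hxy⟩ := G.exists_isLink_of_mem_edgeSet he
  rw [← Finset.card_filter]
  refine (Finset.card_le_card (t := {x, y}) fun v hv => ?_).trans Finset.card_le_two
  simp only [Finset.mem_filter] at hv
  simpa using hv.2.eq_or_eq_of_isLink hxy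

theorem Params.Represents.deg_le (hP : P.Represents G) {v : ℕ} (hv : v < P.n) :
    P.deg v ≤ 2 * P.m :=
  (Finset.single_le_sum (fun _ _ => Nat.zero_le _) (Finset.mem_range.2 hv)).trans hP.sum_deg_le

theorem Params.Represents.sum_deg_subset_le (hP : P.Represents G)
    (hA : ∀ {v}, v ∈ A₀ → v < P.n) : ∑ v ∈ A₀, P.deg v ≤ 2 * P.m :=
  (Finset.sum_le_sum_of_subset fun _ hv => Finset.mem_range.2 (hA hv)).trans hP.sum_deg_le

/-- A bound for all words in the memory. -/
def maxWord (P : Params) (N : ℕ) : ℕ :=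
  P.n + P.m + P.p + P.q + P.c + P.D + P.h + N + 2 * (P.c * N) + 2 * P.m + 4

theorem ScanInv.ln_le (hP : P.Fits G A₀ L) (hs : ScanInv P A₀ s) : s.ln ≤ P.n := by
  rw [← Finset.card_range s.ln, ← Finset.card_range P.n]
  refine Finset.card_le_card_of_injOn s.lst (fun i hi => ?_) fun i hi i' hi' hii => ?_
  · simp only [Finset.coe_range, Set.mem_Iio] at hi ⊢
    exact hs.lst_lt hP hi
  · simp only [Finset.coe_range, Set.mem_Iio] at hi hi'
    exact hs.inj i hi i' hi' hii

theorem Inv.z_le (hP : P.Fits G A₀ L) (h : Inv G P A₀ N s) (hs : ScanInv P A₀ s) : s.z ≤ P.m := by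
  rw [← Finset.card_range s.z, ← Finset.card_range P.m]
  refine Finset.card_le_card_of_injOn (fun i => s.qe (s.qlen + i)) (fun i hi => ?_)
    fun i hi i' hi' hii => ?_
  · simp only [Finset.coe_range, Set.mem_Iio] at hi ⊢
    obtain ⟨u, -, hlk⟩ := h.queue.link (s.qlen + i) (by omega)
    exact hP.edge.1 hlk.edge_mem
  · simp only [Finset.coe_range, Set.mem_Iio] at hi hi'
    exact hs.found_inj i hi i' hi' hii

theorem Inv.scan_le (hP : P.Fits G A₀ L) (h : Inv G P A₀ N s) : s.lo ≤ P.n ∧ s.le ≤ P.n ∧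
    s.ln ≤ P.n ∧ s.k ≤ 2 * P.m ∧ s.z ≤ P.m ∧ s.j ≤ P.m ∧ s.vol ≤ 2 * P.m := by
  by_cases hm : s.mode ≤ 2
  · obtain ⟨h₁, h₂, h₃, h₄, h₅, h₆, h₇⟩ := h.idle hm
    omega
  · have hs := h.scan (by omega)
    have h₁ := hs.ln_le hP
    have h₂ := h.z_le hP hs
    have h₃ := hs.le_ln
    have h₄ := hs.lo_le
    have h₅ := hs.vol_le.trans (hP.sum_deg_subset_le hP.lt_n)
    have h₆ := hs.j_le
    have h₇ : s.k ≤ 2 * P.m := by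
      by_cases hlo : s.lo = s.le
      · rw [hs.k_zero hlo]
        exact Nat.zero_le _
      · have hlt := hs.lo_lt hlo
        exact (hs.k_le hlt).trans (hP.deg_le (hs.lst_lt hP hlt))
    omega

theorem Params.Represents.entries_le (hP : P.Represents G) (i : ℕ) :
    ((entries P.n P.adj).getD i (0, 0)).1 ≤ P.m ∧ ((entries P.n P.adj).getD i (0, 0)).2 ≤ P.n := by
  by_cases hi : i < (entries P.n P.adj).length
  · rw [List.getD_eq_getElem _ _ hi]
    obtain ⟨v, hv, hmem⟩ := List.mem_flatMap.1 (List.getElem_mem hi)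
    obtain ⟨k, hk, hk'⟩ := List.getElem_of_mem hmem
    have hlk := hP.arc_link (List.mem_range.1 hv) hk
    rw [Params.arcEdge, Params.arcEnd, List.getD_eq_getElem _ _ hk, hk'] at hlk
    exact ⟨(hP.edge.1 hlk.edge_mem).le, (hP.vertex.1 hlk.right_mem).le⟩
  · rw [List.getD_eq_default _ _ (by omega)]
    exact ⟨Nat.zero_le _, Nat.zero_le _⟩

theorem Params.Represents.offset_le (hP : P.Represents G) {v : ℕ} (hv : v ≤ P.n) :
    offset P.adj v ≤ 2 * P.m :=
  (Finset.sum_le_sum_of_subset (Finset.range_mono hv)).trans hP.sum_deg_le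

theorem Inv.mass_le (h : Inv G P A₀ N s) (v : ℕ) : s.mass v ≤ 2 * (P.c * N) := by
  by_cases hv : v ∈ A₀
  · have h₁ : s.mass v ≤ total A₀ s.mass := Finset.single_le_sum (fun _ _ => Nat.zero_le _) hv
    have h₂ := h.total_le
    omega
  · rw [h.label.supp v hv]
    exact Nat.zero_le _

theorem Inv.ptr_le_two_mul (hP : P.Fits G A₀ L) (h : Inv G P A₀ N s) (v : ℕ) :
    s.ptr v ≤ 2 * P.m := by
  by_cases hv : v ∈ A₀
  · exact (h.label.ptr_le v).trans (hP.deg_le (hP.lt_n hv))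
  -- Outside `A₀` no mass ever arrives, so by `full` the pointer cannot have moved.
  · by_contra hc
    have h₁ := h.label.full v (.inr (by omega))
    rw [h.label.supp v hv] at h₁
    omega

theorem Inv.bounded (hP : P.Fits G A₀ L) (h : Inv G P A₀ N s) :
    (s.toStore P).Bounded (maxWord P N) := by
  have hq := h.qlen_le hP
  have hqi := h.queue.qi_le
  obtain ⟨h₁, h₂, h₃, h₄, h₅, h₆, h₇⟩ := h.scan_le hP
  have hmode := h.range.mode
  have hcur := h.range.cur
  constructor
  · intro x
    iterate 18
      rcases x with _ | x
      · simp only [State.toStore, maxWord]; omega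
    exact Nat.zero_le _
  · intro a i
    rcases a with _ | a
    · simp only [State.toStore, maxWord]
      split_ifs with hi
      · have := hP.offset_le hi
        omega
      · exact Nat.zero_le _
    rcases a with _ | a
    · exact (hP.entries_le i).1.trans (by simp only [maxWord]; omega)
    rcases a with _ | a
    · exact (hP.entries_le i).2.trans (by simp only [maxWord]; omega)
    rcases a with _ | a
    · refine (show membership s.A i ≤ 1 from ?_).trans (by simp only [maxWord]; omega)
      rw [membership]
      split_ifs <;> omega
    rcases a with _ | a
    · exact (h.range.qe i).trans (by simp only [maxWord]; omega)
    rcases a with _ | a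
    · exact (h.range.qv i).trans (by simp only [maxWord]; omega)
    rcases a with _ | a
    · exact (h.flow.cap i).trans (by simp only [maxWord]; omega)
    rcases a with _ | a
    · exact (h.range.H i).trans (by simp only [maxWord]; omega)
    rcases a with _ | a
    · exact (h.mass_le i).trans (by simp only [maxWord]; omega)
    rcases a with _ | a
    · exact (h.label.lev_le i).trans (by simp only [maxWord]; omega)
    rcases a with _ | a
    · exact (h.ptr_le_two_mul hP i).trans (by simp only [maxWord]; omega)
    rcases a with _ | a
    · exact (h.range.lst i).trans (by simp only [maxWord]; omega)
    exact Nat.zero_le _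

theorem bodyProgram_loopFree : bodyProgram.LoopFree := by
  simp [bodyProgram, sourceProgram, walkProgram, scanProgram, growProgram, pushProgram, incr,
    incrAt, decrAt, Program.LoopFree]

/-- The main loop halts, in a state that satisfies the invariants. -/
theorem exists_exec_mainLoop : ∃ κ B : ℕ, ∀ {G : Graph ℕ ℕ} {P : Params} {A₀ : Finset ℕ} {N L : ℕ}
    {s : State} {w : ℕ}, P.Fits G A₀ L → Inv G P A₀ N s → 0 ≤ measure P A₀ s →
      (maxWord P N + 2) ^ (κ + 1) < 2 ^ w → ∃ (t : ℕ) (s' : State),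
        Exec w (.loop (.var 8) bodyProgram) (s.toStore P) t (s'.toStore P) ∧ Inv G P A₀ N s' ∧
          s'.mode = 0 ∧ t ≤ (maxWork P N + 1) * B := by
  obtain ⟨κ, hκ⟩ := bodyProgram.exists_exec_run bodyProgram_loopFree
  refine ⟨κ, bodyProgram.maxCost + 2, fun {G P A₀ N L s w} hP h hμ hw => ?_⟩
  have hstep (s : State) (hs : Inv G P A₀ N s)
      (h0 : (Expr.var 8).eval w (s.toStore P) ≠ 0) : ∃ t ≤ bodyProgram.maxCost, ∃ s' : State,
        Exec w bodyProgram (s.toStore P) t (s'.toStore P) ∧ Inv G P A₀ N s' ∧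
          measure P A₀ s + 1 ≤ measure P A₀ s' := by
    obtain ⟨⟨r, hr, he⟩, -⟩ := hκ w _ _ (hs.bounded hP) hw
    rw [hs.run_bodyProgram hP h0] at he
    exact ⟨r, hr, _, he, hs.step hP h0⟩
  obtain ⟨t, s', h₁, h₂, h₃, h₄⟩ :=
    exec_loop (State.toStore P) (fun s hs => hs.measure_le hP) hstep h
  refine ⟨t, s', h₁, h₂, h₃, ?_⟩
  have h₅ : (t : ℤ) ≤ (maxWork P N + 1) * (bodyProgram.maxCost + 2) := by
    refine h₄.trans ?_
    have : ((Expr.var 8).cost : ℤ) = 1 := rfl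
    rw [this, add_assoc (bodyProgram.maxCost : ℤ)]
    exact mul_le_mul_of_nonneg_right (by linarith) (by positivity)
  exact_mod_cast h₅

end MainLoop

/-! ### The initial state -/

section Start

/-- The state in which the main loop starts. -/
def start (A : Finset ℕ) (cut : List (ℕ × ℕ)) : State where
  mode := 1
  qi := 0
  qlen := cut.length
  cur := 0
  lo := 0
  le := 0
  ln := 0
  k := 0
  z := 0
  j := 0
  vol := 0
  dep := 0
  A := A
  qe := fun i => (cut.getD i (0, 0)).1
  qv := fun i => (cut.getD i (0, 0)).2
  X := fun _ => 0
  H := fun _ => 0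
  mass := fun _ => 0
  lev := fun _ => 0
  ptr := fun _ => 0
  lst := fun _ => 0

variable {G : Graph ℕ ℕ} {P : Params} {A₀ : Finset ℕ} {L : ℕ} {cut : List (ℕ × ℕ)}

theorem IsCutList.getD_isLink (hcut : IsCutList G A₀ cut) {i : ℕ} (hi : i < cut.length) :
    ∃ u, u ∉ A₀ ∧ G.IsLink (cut.getD i (0, 0)).1 (cut.getD i (0, 0)).2 u := by
  rw [List.getD_eq_getElem _ _ hi]
  obtain ⟨-, u, hu, hlk⟩ := (hcut.2 _ _).1 (List.getElem_mem hi)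
  exact ⟨u, fun h => hu.2 h, hlk⟩

theorem IsCutList.length_eq (hcut : IsCutList G A₀ cut) : cut.length = G.cutSize A₀ := by
  have hinj : Set.InjOn Prod.fst {x | x ∈ cut} := by
    rintro ⟨e, v⟩ h₁ ⟨e', v'⟩ h₂ (rfl : e = e')
    obtain ⟨hv, u, hu, hlk⟩ := (hcut.2 _ _).1 h₁
    obtain ⟨hv', u', hu', hlk'⟩ := (hcut.2 _ _).1 h₂
    rcases hlk.left_eq_or_eq hlk' with rfl | rfl
    · rfl
    · exact absurd hv hu'.2
  have himg : G.edgesBetween A₀ (G.vertexSet \ A₀) = Prod.fst '' {x | x ∈ cut} := by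
    ext e
    constructor
    · rintro ⟨v, hv, u, hu, hlk⟩
      exact ⟨(e, v), (hcut.2 _ _).2 ⟨hv, u, hu, hlk⟩, rfl⟩
    · rintro ⟨⟨e, v⟩, hmem, rfl⟩
      obtain ⟨hv, u, hu, hlk⟩ := (hcut.2 _ _).1 hmem
      exact ⟨v, hv, u, hu, hlk⟩
  have hset : {x | x ∈ cut} = (cut.toFinset : Set (ℕ × ℕ)) := by
    ext x
    simp
  rw [Graph.cutSize, himg, hinj.ncard_image, hset, Set.ncard_coe_finset,
    List.toFinset_card_of_nodup hcut.1]

theorem inv_start (hP : P.Fits G A₀ L) (hcut : IsCutList G A₀ cut) :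
    Inv G P A₀ cut.length (start A₀ cut) := by
  have hnet (e v : ℕ) : netFlow G (start A₀ cut).X (start A₀ cut).H e v = 0 := by
    simp [netFlow, start]
  refine ⟨⟨fun _ => Nat.zero_le _, fun _ h => absurd rfl h, fun v _ => ?_⟩,
    ⟨fun v h => absurd h (by simp [start]), fun _ _ _ _ _ _ => Nat.zero_le _,
      fun _ _ _ _ _ _ => Nat.zero_le _, fun _ => Nat.zero_le _, fun _ => Nat.zero_le _,
      fun _ _ => rfl, subset_rfl, fun v h₁ h₂ => absurd h₁ h₂, fun _ _ => .inr (Nat.zero_le _),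
      fun h => by simp [start] at h⟩,
    ⟨fun i hi => hcut.getD_isLink hi, fun e v u hlk hv hu => ?_, ?_, ?_, Nat.zero_le _,
      fun h => by simp [start] at h⟩,
    ⟨fun i => ?_, fun i => ?_, fun _ => Nat.zero_le _, fun _ => Nat.zero_le _, Nat.zero_le _,
      by simp [start]⟩,
    fun _ => ⟨rfl, rfl, rfl, rfl, rfl, rfl, rfl⟩, fun h => by simp [start] at h⟩
  · simp only [hnet, Finset.sum_const_zero]
    rfl
  · have hmem : (e, v) ∈ cut := (hcut.2 _ _).2 ⟨hv, u, ⟨hlk.right_mem, fun h => hu h⟩, hlk⟩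
    obtain ⟨i, hi, hi'⟩ := List.getElem_of_mem hmem
    refine .inr (.inl ⟨i, Nat.zero_le _, hi, ?_, ?_⟩) <;>
      simp [start, List.getElem?_eq_getElem hi, hi']
  · have h₁ : pending G P (start A₀ cut) ≤ cut.length * P.c := by
      refine (Finset.sum_le_card_nsmul _ _ (P.c : ℤ) fun i _ => ?_).trans (by simp [start])
      rw [hnet]
      split_ifs <;> omega
    have h₂ : total A₀ (start A₀ cut).mass = 0 := by simp [total, start]
    have h₃ : (start A₀ cut).vol = 0 := rfl
    rw [h₂, h₃]
    push_cast
    nlinarith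
  · simp [start]
  · by_cases hi : i < cut.length
    · obtain ⟨u, -, hlk⟩ := hcut.getD_isLink hi
      exact (hP.edge.1 hlk.edge_mem).le
    · simp [start, List.getElem?_eq_none (not_lt.1 hi)]
  · by_cases hi : i < cut.length
    · obtain ⟨u, -, hlk⟩ := hcut.getD_isLink hi
      exact (hP.vertex.1 hlk.left_mem).le
    · simp [start, List.getElem?_eq_none (not_lt.1 hi)]

theorem measure_start_nonneg : 0 ≤ measure P A₀ (start A₀ cut) := by
  have : 0 ≤ modeWork P (start A₀ cut) := by
    simp only [modeWork, start]
    norm_num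
    positivity
  simp only [measure]
  positivity

/-! ### The computation of the parameters -/

/-- The memory before the main loop, with the given values of the parameters and of the counter. -/
noncomputable def initStore (P : Params) (s : State) (c D h x : ℕ) : Store where
  var := Function.update (Function.update (Function.update (Function.update (Function.update
    (s.toStore P).var 5 c) 6 D) 7 h) 8 0) 18 x
  arr := (s.toStore P).arr

variable {s : State}

theorem initStore_bounded {b c D h x : ℕ} (hs : (s.toStore P).Bounded b) (hc : c ≤ b) (hD : D ≤ b)
    (hh : h ≤ b) (hx : x ≤ b) : (initStore P s c D h x).Bounded b := by
  refine ⟨fun y => ?_, hs.2⟩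
  simp only [initStore, Function.update_apply]
  split_ifs
  exacts [hx, Nat.zero_le _, hh, hD, hc, hs.1 y]

theorem run_setupProgram {c D : ℕ} (hc : c = 3 * P.q / (2 * P.p) + 1) (hD : D = 8 * c) :
    setupProgram.run (initStore P s 0 0 0 0) = initStore P s c D (D + 2) P.m := by
  subst hD hc
  simp only [setupProgram, Program.run, initStore, Store.mk.injEq, and_true]
  funext x
  iterate 19 (rcases x with _ | x; · rfl)
  rfl

theorem run_levelBody {c D h x : ℕ} :
    levelBody.run (initStore P s c D h x) = initStore P s c D (h + D) (x / 2) := by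
  simp only [levelBody, Program.run, initStore, Store.mk.injEq, and_true]
  funext x
  iterate 19 (rcases x with _ | x; · rfl)
  rfl

theorem initStore_eq_input (hcut : (start A₀ cut).toStore P = s.toStore P) :
    initStore P s 0 0 0 0 = input P.n P.m P.p P.q P.adj A₀ cut := by
  simp only [initStore, ← hcut]
  simp only [input, Store.mk.injEq]
  constructor
  · funext x
    iterate 19 (rcases x with _ | x; · rfl)
    rfl
  · funext x
    iterate 12 (rcases x with _ | x; · rfl)
    rfl

/-- The two conditions on `i` say that it is the number of binary digits of `x`. The quantity `h + x
* D` does not increase, so one bound `b` serves the whole loop. -/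
theorem exec_levelLoop : ∃ κ B : ℕ, ∀ {P : Params} {s : State} {c D b w : ℕ} (i h x : ℕ),
    (s.toStore P).Bounded b → c ≤ b → D ≤ b → h + x * D ≤ b → x ≤ b → x < 2 ^ i →
    (i = 0 ∨ 2 ^ (i - 1) ≤ x) → (b + 2) ^ (κ + 1) < 2 ^ w →
      ∃ t ≤ (i + 1) * B, Exec w (.loop (.var 18) levelBody) (initStore P s c D h x) t
        (initStore P s c D (h + i * D) 0) := by
  obtain ⟨κ, hκ⟩ := levelBody.exists_exec_run (by simp [levelBody, Program.LoopFree])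
  refine ⟨κ, levelBody.maxCost + 2, fun {P s c D b w} i => ?_⟩
  induction i with
  | zero =>
    intro h x _ _ _ _ _ hx _ _
    obtain rfl : x = 0 := by simpa using hx
    refine ⟨_, ?_, by simpa using Exec.loop_false (by rfl)⟩
    simp [Expr.cost]
  | succ i ih =>
    intro h x hs hc hD hh hx hlt hle hw
    have hpos : 0 < x := lt_of_lt_of_le (by positivity) (hle.resolve_left (by omega))
    obtain ⟨⟨r, hr, he⟩, -⟩ := hκ w b (initStore P s c D h x)
      (initStore_bounded hs hc hD (by omega) hx) hw
    rw [run_levelBody] at he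
    -- For `x ≥ 1`, halving frees at least the one `D` that is added to `h`.
    have hmul : (x / 2 + 1) * D ≤ x * D := Nat.mul_le_mul_right _ (by omega)
    obtain ⟨t, ht, he'⟩ := ih (h + D) (x / 2) hs hc hD (by linarith) (by omega)
      (by rw [pow_succ] at hlt; omega) (by
        rcases Nat.eq_zero_or_pos i with rfl | hi
        · exact .inl rfl
        · right
          have h₁ := hle.resolve_left (by omega)
          obtain ⟨i, rfl⟩ : ∃ i', i = i' + 1 := ⟨i - 1, by omega⟩
          simp only [Nat.add_sub_cancel] at h₁ ⊢
          rw [pow_succ] at h₁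
          omega) hw
    have hend : h + D + i * D = h + (i + 1) * D := by ring
    rw [hend] at he'
    refine ⟨_, ?_, .loop_true (show x ≠ 0 by omega) he he'⟩
    simp only [Expr.cost]
    nlinarith

end Start

end Trimming

namespace Trimming

open WordRAM

/-! ### The parameters -/

section Parameters

/-- The capacity of an edge. -/
def capacity (p q : ℕ) : ℕ := 3 * q / (2 * p) + 1

/-- The parameters for an input. -/
def params (n m p q : ℕ) (adj : ℕ → List (ℕ × ℕ)) : Params where
  n := n
  m := m
  p := p
  q := q
  c := capacity p q
  D := 8 * capacity p q
  h := 8 * capacity p q + 2 + m.size * (8 * capacity p q)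
  adj := adj

variable {G : Graph ℕ ℕ} {n m p q : ℕ} {adj : ℕ → List (ℕ × ℕ)} {A₀ : Finset ℕ}

theorem params_represents (hn : G.vertexSet = Set.Iio n) (hm : G.edgeSet = Set.Iio m)
    (hadj : IsAdjacencyLists G adj) : (params n m p q adj).Represents G := by
  have arc {v k : ℕ} (hv : v < n) (hk : k < (adj v).length) :
      (adj v).getD k (0, 0) = (adj v)[k] := List.getD_eq_getElem _ _ hk
  have link {v k : ℕ} (hv : v < n) (hk : k < (adj v).length) :
      G.IsLink (adj v)[k].1 v (adj v)[k].2 :=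
    ((hadj v (hn ▸ hv)).2 _ _).1 (List.getElem_mem hk)
  refine ⟨by simp [hn, params], by simp [hm, params], fun {v k} hv hk => ?_,
    fun {e v u} hlk => ?_, fun {v k k'} hv hk hk' he => ?_⟩
  · simpa only [Params.arcEdge, Params.arcEnd, params, arc hv hk] using link hv hk
  · obtain ⟨k, hk, hk'⟩ := List.getElem_of_mem (((hadj v hlk.left_mem).2 _ _).2 hlk)
    refine ⟨k, hk, ?_, ?_⟩ <;>
      simp only [Params.arcEdge, Params.arcEnd, params, List.getD_eq_getElem _ _ hk, hk']
  · simp only [Params.arcEdge, params, arc hv hk, arc hv hk'] at he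
    have h₁ := link hv hk
    rw [he] at h₁
    exact (hadj v (hn ▸ hv)).1.getElem_inj_iff.1
      (Prod.ext he (h₁.right_unique (link hv hk')))

theorem params_fits (hn : G.vertexSet = Set.Iio n) (hm : G.edgeSet = Set.Iio m)
    (hadj : IsAdjacencyLists G adj) (hA : (A₀ : Set ℕ) ⊆ G.vertexSet) :
    (params n m p q adj).Fits G A₀ (m.size + 1) := by
  have hR := params_represents (p := p) (q := q) hn hm hadj
  have hlt {v : ℕ} (hv : v ∈ A₀) : v < n := by simpa [hn] using hA hv
  refine ⟨hR, hlt, Nat.succ_pos _, rfl, ?_, ?_⟩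
  · simp only [params]
    ring
  · refine (hR.sum_deg_subset_le hlt).trans_lt ?_
    -- The volume is at most `2 * m`, which accounts for the extra digit in `L = m.size + 1`.
    have : m < 2 ^ m.size := Nat.lt_size_self m
    rw [pow_succ]
    simp only [params]
    omega

/-- A bound for the numbers that occur in the computation, including those that the computation of
the parameters produces. -/
theorem word_bound {N : ℕ} (hp : 0 < p) (hpq : p ≤ q) (hN : N ≤ m) :
    maxWord (params n m p q adj) N + (8 * capacity p q + 2 + m * (8 * capacity p q)) + 2 ≤
      (n + m + p + q + 2) ^ 6 := by
  have hc : capacity p q ≤ 3 * q + 1 := Nat.succ_le_succ (Nat.div_le_self _ _)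
  have hs : m.size ≤ m := Nat.size_le.2 Nat.lt_two_pow_self
  obtain ⟨x, hx⟩ : ∃ x, x = n + m + p + q + 2 := ⟨_, rfl⟩
  have hcx : capacity p q ≤ 3 * x := by omega
  have h₁ : m.size * (8 * capacity p q) ≤ x * (8 * (3 * x)) :=
    Nat.mul_le_mul (by omega) (by omega)
  have h₂ : m * (8 * capacity p q) ≤ x * (8 * (3 * x)) := Nat.mul_le_mul (by omega) (by omega)
  have h₃ : capacity p q * N ≤ 3 * x * x := Nat.mul_le_mul hcx (by omega)
  have h₄ : 4 * x ≤ x * x := Nat.mul_le_mul_right _ (by omega)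
  have h₅ : 256 ≤ x ^ 4 := Nat.pow_le_pow_left (by omega : 4 ≤ x) 4
  have h₆ : 256 * (x * x) ≤ x ^ 6 := by
    calc 256 * (x * x) ≤ x ^ 4 * (x * x) := Nat.mul_le_mul_right _ h₅
      _ = x ^ 6 := by ring
  rw [← hx]
  refine le_trans ?_ h₆
  simp only [maxWord, params]
  nlinarith

theorem three_halves_le_capacity_mul (hp : 0 < p) (hpq : p ≤ q) :
    (3 / 2 : ℝ) ≤ capacity p q * (p / q) := by
  have hq : 0 < q := hp.trans_le hpq
  have h : 3 * q ≤ capacity p q * (2 * p) :=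
    (Nat.lt_mul_of_div_lt (Nat.lt_succ_self _) (by positivity)).le
  have h' : (3 * q : ℝ) ≤ capacity p q * (2 * p) := by exact_mod_cast h
  rw [← mul_div_assoc, le_div_iff₀ (by exact_mod_cast hq)]
  linarith

/-- The quotient contributes at most `3/2` and the rounding summand at most `φ ≤ 1`. -/
theorem capacity_mul_le (hp : 0 < p) (hpq : p ≤ q) : capacity p q * (p / q : ℝ) ≤ 5 / 2 := by
  have hq : 0 < q := hp.trans_le hpq
  have h : 3 * q / (2 * p) * (2 * p) ≤ 3 * q := Nat.div_mul_le_self _ _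
  have h' : ((3 * q / (2 * p) : ℕ) : ℝ) * (2 * p) ≤ 3 * q := by exact_mod_cast h
  have hpq' : (p : ℝ) ≤ q := by exact_mod_cast hpq
  rw [← mul_div_assoc, div_le_iff₀ (by exact_mod_cast hq), capacity]
  push_cast at h' ⊢
  linarith

theorem size_add_one_le (hm : 2 ≤ m) : (m.size + 1 : ℝ) ≤ 5 * Real.log m := by
  have hpos : 0 < m.size := Nat.size_pos.2 (by omega)
  obtain ⟨i, hi⟩ : ∃ i, m.size = i + 1 := ⟨m.size - 1, by omega⟩
  have h₁ : 2 ^ i ≤ m := Nat.lt_size.1 (by omega)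
  have h₂ : i * Real.log 2 ≤ Real.log m := by
    rw [← Real.log_pow]
    exact Real.log_le_log (by positivity) (by exact_mod_cast h₁)
  have h₃ : Real.log 2 ≤ Real.log m := Real.log_le_log (by norm_num) (by exact_mod_cast hm)
  have h₄ := Real.log_two_gt_d9
  rw [hi]
  push_cast
  nlinarith

/-- The dominant term is `c N h`, with `c ≤ 5/(2φ)` and `h = O(log m / φ)`. The lower-order terms
are absorbed by `N ≥ 1`, `1/φ ≥ 1` and `log m ≥ 0.69`. -/
theorem maxWork_le {N : ℕ} (hp : 0 < p) (hpq : p ≤ q) (hm : 2 ≤ m) (hN : 1 ≤ N) :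
    (maxWork (params n m p q adj) N + 1 : ℝ) ≤
      3000 * (N * Real.log m / (p / q : ℝ) ^ 2) := by
  obtain ⟨φ, hφ⟩ : ∃ φ : ℝ, φ = p / q := ⟨_, rfl⟩
  have hc := capacity_mul_le hp hpq
  have hφ0 : 0 < φ := hφ ▸ div_pos (by exact_mod_cast hp) (by exact_mod_cast hp.trans_le hpq)
  have hφ1 : φ ≤ 1 := hφ ▸ div_le_one_of_le₀ (by exact_mod_cast hpq) (by positivity)
  rw [← hφ] at hc ⊢
  obtain ⟨ψ, hψ⟩ : ∃ ψ : ℝ, ψ = 1 / φ := ⟨_, rfl⟩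
  have hψ1 : 1 ≤ ψ := hψ ▸ (one_le_div hφ0).2 hφ1
  have hcψ : (capacity p q : ℝ) ≤ 5 / 2 * ψ := by
    rw [hψ, mul_one_div]
    exact (le_div_iff₀ hφ0).2 hc
  obtain ⟨ℓ, hℓ⟩ : ∃ ℓ : ℝ, ℓ = Real.log m := ⟨_, rfl⟩
  have hℓ1 : 0.69 ≤ ℓ := hℓ ▸ (by linarith [Real.log_two_gt_d9] : (0.69 : ℝ) ≤ Real.log 2).trans
    (Real.log_le_log (by norm_num) (by exact_mod_cast hm))
  have hsize := size_add_one_le hm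
  have hN1 : (1 : ℝ) ≤ N := by exact_mod_cast hN
  have hh : ((params n m p q adj).h : ℝ) ≤ 104 * (ℓ * ψ) := by
    have h₁ : (m.size + 1 : ℝ) * (8 * capacity p q) ≤ 5 * ℓ * (8 * (5 / 2 * ψ)) :=
      mul_le_mul (hℓ ▸ hsize) (by linarith) (by positivity) (by linarith)
    have h₂ : 0.69 ≤ ℓ * ψ := by nlinarith
    simp only [params]
    push_cast
    linarith
  have hℓψ : 0.69 ≤ ℓ * ψ := by nlinarith
  have h₁ : (capacity p q * N : ℝ) ≤ 5 / 2 * ψ * N :=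
    mul_le_mul_of_nonneg_right hcψ (by linarith)
  have h₂ : (capacity p q * N : ℝ) * (10 * (params n m p q adj).h + 40) ≤
      5 / 2 * ψ * N * (1100 * (ℓ * ψ)) :=
    mul_le_mul h₁ (by linarith) (by positivity) (by positivity)
  have h₃ : ℓ * ψ ≤ N * ℓ * ψ ^ 2 := by
    have : 1 ≤ N * ψ := one_le_mul_of_one_le_of_one_le hN1 hψ1
    calc ℓ * ψ ≤ ℓ * ψ * (N * ψ) := le_mul_of_one_le_right (by linarith) this
      _ = N * ℓ * ψ ^ 2 := by ring
  have h₄ : 0.69 * N ≤ N * ℓ * ψ ^ 2 := by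
    calc 0.69 * N ≤ (ℓ * ψ) * N := mul_le_mul_of_nonneg_right hℓψ (by linarith)
      _ ≤ (ℓ * ψ) * N * ψ := le_mul_of_one_le_right (by nlinarith) hψ1
      _ = N * ℓ * ψ ^ 2 := by ring
  have hQ : N * ℓ / φ ^ 2 = N * ℓ * ψ ^ 2 := by
    rw [hψ]
    ring
  have hc' : (params n m p q adj).c = capacity p q := rfl
  rw [← hℓ, hQ, maxWork, hc']
  push_cast
  linarith

/-! ### The whole program -/

theorem exec_trimProgram_of_eq_zero {cut : List (ℕ × ℕ)} (h : cut.length = 0) (w : ℕ) :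
    Exec w trimProgram (input n m p q adj A₀ cut) 3 (input n m p q adj A₀ cut) :=
  .ite_false (σ := input n m p q adj A₀ cut) (b := .var 4) h (.skip _)

theorem exec_assign_mode {P : Params} {cut : List (ℕ × ℕ)} {w : ℕ} (hw : 1 < 2 ^ w) :
    Exec w (.assign 8 (.const 1)) (initStore P (start A₀ cut) P.c P.D P.h 0) 2
      ((start A₀ cut).toStore P) := by
  have h := Exec.assign (w := w) (initStore P (start A₀ cut) P.c P.D P.h 0) 8 (.const 1)
  rw [Expr.eval, Nat.mod_eq_of_lt hw] at h
  have hstore : (start A₀ cut).toStore P =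
      { initStore P (start A₀ cut) P.c P.D P.h 0 with
        var := Function.update (initStore P (start A₀ cut) P.c P.D P.h 0).var 8 1 } := by
    refine (Store.mk.injEq _ _ _ _).mpr ⟨funext fun x => ?_, rfl⟩
    iterate 19 (rcases x with _ | x; · rfl)
    rfl
  rw [hstore]
  exact h

/-- The program halts, in a state of the main loop in which no unit is left. -/
theorem exists_exec_trimProgram : ∃ κ B : ℕ, ∀ {G : Graph ℕ ℕ} {n m p q : ℕ}
    {adj : ℕ → List (ℕ × ℕ)} {A₀ : Finset ℕ} {cut : List (ℕ × ℕ)} {w : ℕ},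
    G.vertexSet = Set.Iio n → G.edgeSet = Set.Iio m → 0 < p → p ≤ q →
    (A₀ : Set ℕ) ⊆ G.vertexSet → IsAdjacencyLists G adj → IsCutList G A₀ cut →
    cut.length ≠ 0 → cut.length ≤ m → (n + m + p + q + 2) ^ κ ≤ 2 ^ w →
      ∃ (t : ℕ) (s : State),
        Exec w trimProgram (input n m p q adj A₀ cut) t (s.toStore (params n m p q adj)) ∧
          Inv G (params n m p q adj) A₀ cut.length s ∧ s.mode = 0 ∧
          t ≤ (maxWork (params n m p q adj) cut.length + 1 + m.size + 2) * B := by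
  obtain ⟨κ₁, h₁⟩ := setupProgram.exists_exec_run (by simp [setupProgram, Program.LoopFree])
  obtain ⟨κ₂, B₂, h₂⟩ := exec_levelLoop
  obtain ⟨κ₃, B₃, h₃⟩ := exists_exec_mainLoop
  -- The `6` is the exponent of `word_bound`, and the last `+ 1` makes the comparison with `2 ^ w`
  -- strict. The `4` counts the outer test and the assignment of the mode, two steps each.
  refine ⟨6 * (κ₁ + κ₂ + κ₃ + 1) + 1, 4 + setupProgram.maxCost + B₂ + B₃,
    fun {G n m p q adj A₀ cut w} hn hm hp hpq hA hadj hcut hne hle hw => ?_⟩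
  obtain ⟨P, hP⟩ : ∃ P, P = params n m p q adj := ⟨_, rfl⟩
  have hfits : P.Fits G A₀ (m.size + 1) := hP ▸ params_fits hn hm hadj hA
  obtain ⟨c, hc⟩ : ∃ c, c = capacity p q := ⟨_, rfl⟩
  have hinv := inv_start hfits hcut
  obtain ⟨b, hb⟩ : ∃ b, b = maxWord P cut.length + (8 * c + 2 + m * (8 * c)) := ⟨_, rfl⟩
  have hb6 : b + 2 ≤ (n + m + p + q + 2) ^ 6 := by
    rw [hb, hc, hP]
    exact word_bound hp hpq hle
  have hword {κ : ℕ} (hκ : κ ≤ κ₁ + κ₂ + κ₃) : (b + 2) ^ (κ + 1) < 2 ^ w := by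
    calc (b + 2) ^ (κ + 1) ≤ ((n + m + p + q + 2) ^ 6) ^ (κ₁ + κ₂ + κ₃ + 1) :=
          (Nat.pow_le_pow_left hb6 _).trans (Nat.pow_le_pow_right (by positivity) (by omega))
      _ = (n + m + p + q + 2) ^ (6 * (κ₁ + κ₂ + κ₃ + 1)) := (pow_mul _ _ _).symm
      _ < (n + m + p + q + 2) ^ (6 * (κ₁ + κ₂ + κ₃ + 1) + 1) :=
          Nat.pow_lt_pow_right (by omega) (by omega)
      _ ≤ 2 ^ w := hw
  have hbounded : ((start A₀ cut).toStore P).Bounded b :=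
    (hinv.bounded hfits).mono (by omega)
  have hmP : P.m = m := by rw [hP]; rfl
  have hmc : c ≤ b ∧ m ≤ b := by
    rw [hb, hP, maxWord]
    simp only [params]
    omega
  obtain ⟨⟨t₁, ht₁, he₁⟩, -⟩ := h₁ w b (initStore P (start A₀ cut) 0 0 0 0)
    (initStore_bounded hbounded (by omega) (by omega) (by omega) (by omega)) (hword (by omega))
  rw [run_setupProgram (c := c) (D := 8 * c) (by rw [hc, hP]; rfl) rfl, initStore_eq_input rfl]
    at he₁
  obtain ⟨t₂, ht₂, he₂⟩ := h₂ (P := P) (s := start A₀ cut) (c := c) (D := 8 * c) (b := b) (w := w)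
    m.size (8 * c + 2) P.m hbounded hmc.1 (by omega) (by rw [hmP]; omega) (hmP ▸ hmc.2) (hmP ▸ Nat.lt_size_self m) (by
      rw [hmP]
      rcases Nat.eq_zero_or_pos m.size with h | h
      · exact .inl h
      · exact .inr (Nat.lt_size.1 (by omega))) (hword (by omega))
  obtain ⟨t₃, s, he₃, hs, hmode, ht₃⟩ := h₃ hfits hinv measure_start_nonneg
    ((Nat.pow_le_pow_left (by omega) _).trans_lt (hword (κ := κ₃) (by omega)))
  have hone : 1 < 2 ^ w := (Nat.one_lt_pow (by omega) (by omega)).trans (hword (κ := 0) (by omega))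
  have he := exec_assign_mode (P := P) (A₀ := A₀) (cut := cut) hone
  rw [show P.c = c by rw [hP, hc]; rfl, show P.D = 8 * c by rw [hP, hc]; rfl,
    show P.h = 8 * c + 2 + m.size * (8 * c) by rw [hP, hc]; rfl] at he
  have hexec : Exec w trimProgram (input P.n P.m P.p P.q P.adj A₀ cut)
      ((Expr.var 4).cost + 1 + (t₁ + (t₂ + (2 + t₃)))) (s.toStore P) := by
    have h0 : (Expr.var 4).eval w (input P.n P.m P.p P.q P.adj A₀ cut) ≠ 0 := hne
    rw [trimProgram]
    exact .ite_true h0 (.seq he₁ (.seq he₂ (.seq he he₃)))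
  have ht : (Expr.var 4).cost + 1 + (t₁ + (t₂ + (2 + t₃))) ≤
      (maxWork P cut.length + 1 + m.size + 2) * (4 + setupProgram.maxCost + B₂ + B₃) := by
    simp only [Expr.cost]
    obtain ⟨W, hW⟩ : ∃ W, W = maxWork P cut.length + 1 + m.size + 2 := ⟨_, rfl⟩
    have e₁ : 4 + setupProgram.maxCost ≤ W * (4 + setupProgram.maxCost) :=
      Nat.le_mul_of_pos_left _ (by omega)
    have e₂ : (m.size + 1) * B₂ ≤ W * B₂ := Nat.mul_le_mul_right _ (by omega)
    have e₃ : (maxWork P cut.length + 1) * B₃ ≤ W * B₃ := Nat.mul_le_mul_right _ (by omega)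
    rw [← hW, mul_add, mul_add]
    omega
  subst hP
  exact ⟨_, s, hexec, hs, hmode, ht⟩

end Parameters

end Trimming

open Trimming in
/-- **Trimming.** There is one program `P` that, on every `n`-vertex, `m`-edge multigraph `G` and
every nearly `φ` expander `A` in `G` with few outgoing edges, computes a set `A' ⊆ A` of large volume
and small boundary such that `G{A'}` is a `φ / 6` expander. Its number of steps on words of
logarithmic length is `O(|E(A, V ∖ A)| log m / φ²)`, where at least constant time is allowed. -/
theorem mainTheorem3 :
    ∃ (P : WordRAM.Program) (C : ℝ) (K : ℕ),
      ∀ (n m : ℕ) (G : Graph ℕ ℕ), G.vertexSet = Set.Iio n → G.edgeSet = Set.Iio m →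
      ∀ (p q : ℕ) (φ : ℝ), 0 < p → p ≤ q → φ = (p : ℝ) / (q : ℝ) →
      ∀ A : Set ℕ, A ⊆ G.vertexSet →
        G.IsNearlyExpander φ A →
        (G.cutSize A : ℝ) ≤ φ * G.vol A / 10 →
      ∀ (adj : ℕ → List (ℕ × ℕ)) (cut : List (ℕ × ℕ)),
        Trimming.IsAdjacencyLists G adj → Trimming.IsCutList G A cut →
      ∀ w : ℕ, (n + m + p + q + 2) ^ K ≤ 2 ^ w →
        ∃ (t : ℕ) (τ : WordRAM.Store) (A' : Set ℕ),
          WordRAM.Exec w P (Trimming.input n m p q adj A cut) t τ ∧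
          Trimming.Outputs n τ A' ∧
          (t : ℝ) ≤ C * max 1 (G.cutSize A * Real.log m / φ ^ 2) ∧
          A' ⊆ A ∧
          φ / 6 ≤ (G.inducedWithLoops A').conductance ∧
          (G.vol A : ℝ) - 4 * G.cutSize A / φ ≤ G.vol A' ∧
          G.cutSize A' ≤ 2 * G.cutSize A := by
  obtain ⟨K, B, hprog⟩ := exists_exec_trimProgram
  refine ⟨trimProgram, 3 + 3008 * B, K, ?_⟩
  intro n m G hn hm p q φ hp hpq hφ A hA hexp hcutA adj cut hadj hcut w hw
  have hq : 0 < q := hp.trans_le hpq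
  have hφ0 : 0 < φ := hφ ▸ div_pos (by exact_mod_cast hp) (by exact_mod_cast hq)
  have hφ1 : φ ≤ 1 := hφ ▸ div_le_one_of_le₀ (by exact_mod_cast hpq) (by positivity)
  obtain ⟨A₀, rfl⟩ := ((hn ▸ Set.finite_Iio n).subset hA).exists_finset_coe
  have hfits : (params n m p q adj).Fits G A₀ (m.size + 1) := params_fits hn hm hadj hA
  have hlen := hcut.length_eq
  have hrun : ∃ (t : ℕ) (τ : WordRAM.Store) (s : State),
      WordRAM.Exec w trimProgram (input n m p q adj A₀ cut) t τ ∧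
      τ.arr 3 = membership s.A ∧ Inv G (params n m p q adj) A₀ cut.length s ∧
      s.mode = 0 ∧
      (t : ℝ) ≤ (3 + 3008 * B) * max 1 (cut.length * Real.log m / φ ^ 2) := by
    by_cases h0 : cut.length = 0
    -- Without boundary edges the initial state is already final, up to its mode, and the array of
    -- `A` needs no change.
    · refine ⟨3, _, _, exec_trimProgram_of_eq_zero h0 w, rfl,
        (inv_start hfits hcut).finish rfl h0.symm, rfl, ?_⟩
      calc ((3 : ℕ) : ℝ) ≤ (3 + 3008 * B) * 1 := by
            push_cast
            linarith [(Nat.cast_nonneg B : (0 : ℝ) ≤ B)]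
        _ ≤ _ := mul_le_mul_of_nonneg_left (le_max_left _ _) (by positivity)
    · have hvol : G.vol A₀ ≤ 2 * m := by
        rw [hfits.vol_eq subset_rfl]
        exact hfits.sum_deg_subset_le hfits.lt_n
      -- The sparse boundary of `A` forces `m ≥ 5` when there is a boundary edge. So `log m` is
      -- bounded away from `0`, and the time bound absorbs additive constants.
      have h10 : 10 * cut.length ≤ 2 * m := by
        have h₁ : (G.vol A₀ : ℝ) ≤ (2 * m : ℕ) := by exact_mod_cast hvol
        have h₂ : φ * G.vol A₀ ≤ 1 * G.vol A₀ :=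
          mul_le_mul_of_nonneg_right hφ1 (by positivity)
        rw [← hlen] at hcutA
        have : (10 * cut.length : ℝ) ≤ (2 * m : ℕ) := by linarith
        exact_mod_cast this
      obtain ⟨t, s, hexec, hs, hmode, ht⟩ :=
        hprog hn hm hp hpq hA hadj hcut h0 (by omega) hw
      refine ⟨t, _, s, hexec, rfl, hs, hmode, ?_⟩
      have hwork := maxWork_le (n := n) (adj := adj) hp hpq (by omega : 2 ≤ m)
        (Nat.one_le_iff_ne_zero.2 h0)
      rw [← hφ] at hwork
      have hlog := size_add_one_le (by omega : 2 ≤ m)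
      have hsize : (m.size + 2 : ℝ) ≤ 8 * (cut.length * Real.log m / φ ^ 2) := by
        have hℓ : 0.69 ≤ Real.log m :=
          (by linarith [Real.log_two_gt_d9] : (0.69 : ℝ) ≤ Real.log 2).trans
            (Real.log_le_log (by norm_num) (by exact_mod_cast (by omega : 2 ≤ m)))
        have hN : (1 : ℝ) ≤ cut.length := by exact_mod_cast Nat.one_le_iff_ne_zero.2 h0
        have : Real.log m ≤ cut.length * Real.log m / φ ^ 2 := by
          rw [le_div_iff₀ (by positivity)]
          calc Real.log m * φ ^ 2 ≤ Real.log m * 1 :=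
                mul_le_mul_of_nonneg_left (pow_le_one₀ hφ0.le hφ1) (by linarith)
            _ ≤ cut.length * Real.log m := by nlinarith
        linarith
      have ht' : (t : ℝ) ≤
          (maxWork (params n m p q adj) cut.length + 1 + m.size + 2) * B := by
        exact_mod_cast ht
      have hB : (0 : ℝ) ≤ B := Nat.cast_nonneg B
      -- `3000` comes from the main loop and `8` from the loop over the digits of `m`.
      calc (t : ℝ) ≤ (3008 * (cut.length * Real.log m / φ ^ 2)) * B :=
            ht'.trans (mul_le_mul_of_nonneg_right (by linarith) hB)
        _ ≤ (3008 * max 1 (cut.length * Real.log m / φ ^ 2)) * B := by gcongr; exact le_max_right _ _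
        _ ≤ _ := by nlinarith [le_max_left (1 : ℝ) (cut.length * Real.log m / φ ^ 2)]
  obtain ⟨t, τ, s, hexec, hτ, hs, hmode, ht⟩ := hrun
  have hcφ := three_halves_le_capacity_mul hp hpq
  have hcφ' := capacity_mul_le hp hpq
  rw [← hφ] at hcφ hcφ'
  rw [← hlen]
  refine ⟨t, τ, s.A, hexec, fun v _ => congrFun hτ v, ht, fun v hv => hs.label.sub hv,
    hs.le_conductance hfits hmode hφ1 hcφ hexp, ?_, ?_⟩
  -- The loss is at most `(4/3) * (5/2) * N / φ = (10/3) * N / φ`, below the allowed `4 * N / φ`.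
  · have hvol : (3 * G.vol A₀ : ℝ) ≤ 3 * G.vol s.A + 4 * (capacity p q * cut.length) := by
      exact_mod_cast hs.vol_le hfits
    have hcap : (capacity p q * cut.length : ℝ) ≤ 5 / 2 * (cut.length / φ) := by
      rw [← mul_div_assoc, le_div_iff₀ hφ0, mul_right_comm]
      exact mul_le_mul_of_nonneg_right hcφ' (by positivity)
    have hnn : (0 : ℝ) ≤ cut.length / φ := by positivity
    rw [mul_div_assoc]
    linarith
  · exact (hs.cutSize_le hfits hmode).trans (by omega)
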